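/- Let $k,n\ge 1$, let $t$ be a formal parameter, and let $\Lambda_k$ be the ring of symmetric polynomials in $x_1,\dots,x_k$ with coefficients in $\mathbb{Q}(t)$. For a partition $\lambda$ with at most $k$ parts, padded with zeroes to $k$ parts, let $$P^\lambda=\sum_{w\in S_k/S_\lambda}w\Big(x_1^{\lambda_1}\cdots x_k^{\lambda_k}\prod_{i,j:\ \lambda_i>\lambda_j}\frac{x_i-t x_j}{x_i-x_j}\Big)\in\Lambda_k$$ be the Hall–Littlewood polynomial, where $S_\lambda$ is the stabilizer of $\lambda$ in $S_k$. Let $\mathcal P_{k,n}$ be the set of partitions with at most $k$ parts and $\lambda_1\le n-1$, let $m_r(\lambda)$ be the number of parts of $\lambda$ equal to $r$ (for $0\le r\le n-1$), and let $\Lambda_{k,n}$ be the quotient of $\Lambda_k$ by the ideal generated by all $P^\lambda$ with $\lambda\notin\mathcal P_{k,n}$. A honeycomb is an assignment of nonnegative integer multiplicities to the edges of the triangular lattice such that: (i) at every lattice point, if $j,i,j',i',j'',i''$ are the multiplicities of the edges leaving it in the directions E, NE, NW, W, SW, SE, then $i'-j=i''-j'=i-j''$; (ii) it has finitely many vertices,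 a vertex being a lattice point at which the edges of nonzero multiplicity do not just form a single straight line of constant multiplicity; (iii) its semi-infinite segments go only in the directions W, NE and SE. For sequences $\lambda,\mu,\nu$ of $k$ nonnegative integers, a honeycomb has boundaries $\lambda,\mu,\nu$ if all its vertices lie in a fixed upright equilateral lattice triangle of size $n-1$ and, numbering the lattice points of each side of the triangle from $0$ to $n-1$ from left to right, exactly $m_r(\lambda)$ (resp. $m_r(\mu)$, $m_r(\nu)$) semi-infinite lines going W (resp. NE, SE) pass through point $r$ of its NW (resp. NE, S) side, for $0\le r\le n-1$. With $\alpha_i=\prod_{r=1}^{i}(1-t^r)$, the fugacity of a vertex is $$\sum_{r=0}^{\min(i,i')}(-1)^r t^{j'r+r(r+1)/2}\frac{\alpha_{i+j-r}}{\alpha_{i-r}\,\alpha_r\,\alpha_{i'-r}},$$ and the fugacity $\mathrm{fug}(H)$ of a honeycomb $H$ is the product of the fugacities of its vertices. **Proposition.** The classes of the $P^\lambda$, $\lambda\in\mathcal P_{k,n}$, form a basis of $\Lambda_{k,n}$. Let $\times$ be the bilinear operation on $\Lambda_{k,n}$ defined by $$P^\lambda\times P^\mu=\sum_{\nu\in\mathcal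 P_{k,n}}\Big(\sum_{H\text{ with boundaries }\lambda,\mu,\nu}\mathrm{fug}(H)\Big)P^\nu\qquad(\lambda,\mu\in\mathcal P_{k,n}).$$ Then for every $\lambda\in\mathcal P_{k,n}$ and every integer $r>0$, one has in $\Lambda_{k,n}$ $$P^\lambda\times P^{(r)}=P^\lambda P^{(r)}=\sum_{\nu}\Big(\frac1{1-t}\prod_{c}(1-t^{m_c(\nu)})\Big)P^\nu,$$ where $\nu$ runs over the elements of $\mathcal P_{k,n}$ such that $\nu/\lambda$ is a horizontal strip with $r$ boxes, and $c$ runs over the columns such that $\nu/\lambda$ has a box in column $c$ but none in column $c+1$. Moreover, for $\nu\in\mathcal P_{k,n}$: if there is a honeycomb with boundaries $\lambda,(r),\nu$, then $\nu/\lambda$ is a horizontal strip with $r$ boxes; conversely, if $\nu/\lambda$ is a horizontal strip with $r$ boxes, there is exactly one such honeycomb, and its fugacity is $\frac1{1-t}\prod_c(1-t^{m_c(\nu)})$, with $c$ as above. -/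

import Mathlib

noncomputable section

namespace HallHoneycomb

/-- The field `ℚ(t)` of rational functions of the formal parameter `t`. -/
abbrev Coef : Type := RatFunc ℚ

/-- The formal parameter `t`. -/
abbrev t : Coef := RatFunc.X

/-! ### Partitions -/

/-- `m_r(l)`, the number of parts of `l` that are equal to `r`. -/
def partMult {k : ℕ} (l : Fin k → ℕ) (r : ℕ) : ℕ :=
  (Finset.univ.filter fun i => l i = r).card

/-- The partitions with at most `k` parts and largest part at most `n - 1`, written as weakly
decreasing sequences of `k` natural numbers (padded with zeroes). -/
def BoxPartition (k n : ℕ) : Type :=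
  {l : Fin k → ℕ // Antitone l ∧ ∀ i, l i < n}

instance (k n : ℕ) : Finite (BoxPartition k n) :=
  Finite.of_injective (β := Fin k → Fin n) (fun l i => ⟨l.1 i, l.2.2 i⟩) fun l m h => by
    apply Subtype.ext
    funext i
    have := congrFun h i
    simpa using this

instance (k n : ℕ) : Fintype (BoxPartition k n) := Fintype.ofFinite _

/-- The one-row partition `(r)`, padded with zeroes. -/
def row (k r : ℕ) : Fin k → ℕ := fun i => if (i : ℕ) = 0 then r else 0

/-- The skew diagram `ν / l` has a box in row `p` (numbered from `0`) and column `c` (numbered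
from `1`). -/
def HasBox {k : ℕ} (l ν : Fin k → ℕ) (p : Fin k) (c : ℕ) : Prop := l p < c ∧ c ≤ ν p

/-- `ν / l` is a horizontal strip with `r` boxes: `l ⊆ ν`, each column contains at most one
box of `ν / l`, and there are `r` boxes. -/
def IsHorizontalStrip {k : ℕ} (l ν : Fin k → ℕ) (r : ℕ) : Prop :=
  (∀ p, l p ≤ ν p) ∧ (∀ c p q, HasBox l ν p c → HasBox l ν q c → p = q) ∧
    ∑ p, ν p = ∑ p, l p + r

open Classical in
/-- The partitions `ν` in the box such that `ν / l` is a horizontal strip with `r` boxes. -/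
def strips {k : ℕ} (n : ℕ) (l : Fin k → ℕ) (r : ℕ) : Finset (BoxPartition k n) :=
  Finset.univ.filter fun ν => IsHorizontalStrip l ν.1 r

open Classical in
/-- The columns `c` such that `ν / l` has a box in column `c` but not in column `c + 1`
(all columns of `ν / l` are at most `∑ p, ν p`). -/
def stripColumns {k : ℕ} (l ν : Fin k → ℕ) : Finset ℕ :=
  (Finset.Icc 1 (∑ p, ν p)).filter fun c =>
    (∃ p, HasBox l ν p c) ∧ ¬ ∃ p, HasBox l ν p (c + 1)

/-- The coefficient `(1 - t)⁻¹ ∏_c (1 - t ^ m_c(ν))` of the Pieri rule. -/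
def pieriCoeff {k : ℕ} (l ν : Fin k → ℕ) : Coef :=
  1 / (1 - t) * ∏ c ∈ stripColumns l ν, (1 - t ^ partMult ν c)

/-! ### Hall--Littlewood polynomials -/

/-- The Hall--Littlewood polynomial of `l` as a rational function in `x_1, …, x_k`:
`∑_w w (x^l ∏_{l_i > l_j} (x_i - t x_j) / (x_i - x_j))`, where `w` runs over the symmetric group
modulo the stabilizer of `l`. The coset of `w` is recorded by the rearrangement `a = w l` of `l`,
and the summand is `x^a ∏_{a_i > a_j} (x_i - t x_j) / (x_i - x_j)`. -/
def hallLittlewoodFrac {k : ℕ} (l : Fin k → ℕ) : FractionRing (MvPolynomial (Fin k) Coef) :=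
  ∑ a ∈ Finset.univ.image (fun w : Equiv.Perm (Fin k) => l ∘ w),
    (∏ i, algebraMap (MvPolynomial (Fin k) Coef) _ (MvPolynomial.X i) ^ a i) *
      ∏ p ∈ Finset.univ.filter (fun p : Fin k × Fin k => a p.2 < a p.1),
        algebraMap (MvPolynomial (Fin k) Coef) _
            (MvPolynomial.X p.1 - MvPolynomial.C t * MvPolynomial.X p.2) /
          algebraMap (MvPolynomial (Fin k) Coef) _
            (MvPolynomial.X p.1 - MvPolynomial.X p.2)

section Polynomiality

open MvPolynomial

variable {k : ℕ}

local notation "RR" => MvPolynomial (Fin k) Coef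
local notation "FF" => FractionRing (MvPolynomial (Fin k) Coef)

/-- Substitution of `X b` for `X a`. -/
def merge (a b : Fin k) : RR →ₐ[Coef] RR := aeval fun c => if c = a then X b else X c

theorem dvd_sub_merge (a b : Fin k) (p : RR) : (X a - X b : RR) ∣ p - merge a b p := by
  induction p using MvPolynomial.induction_on with
  | C c => simp [merge]
  | add p q hp hq =>
    have : p + q - merge a b (p + q) = (p - merge a b p) + (q - merge a b q) := by
      rw [map_add]; ring
    rw [this]; exact dvd_add hp hq
  | mul_X p c hp =>
    have : p * X c - merge a b (p * X c)
        = (p - merge a b p) * X c + merge a b p * (X c - merge a b (X c)) := by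
      rw [map_mul]; ring
    rw [this]
    refine dvd_add (Dvd.dvd.mul_right hp _) (Dvd.dvd.mul_left ?_ _)
    by_cases h : c = a
    · subst h; simp [merge]
    · simp [merge, h]

theorem dvd_iff_merge (a b : Fin k) (hab : a ≠ b) (p : RR) :
    (X a - X b : RR) ∣ p ↔ merge a b p = 0 := by
  constructor
  · rintro ⟨q, rfl⟩
    rw [map_mul]
    simp [merge, hab.symm]
  · intro h
    have := dvd_sub_merge a b p
    rwa [h, sub_zero] at this

theorem X_sub_X_ne_zero {a b : Fin k} (hab : a ≠ b) : (X a - X b : RR) ≠ 0 :=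
  sub_ne_zero.2 fun h => hab (X_injective h)

theorem prime_X_sub_X {a b : Fin k} (hab : a ≠ b) : Prime (X a - X b : RR) := by
  refine ⟨X_sub_X_ne_zero hab, fun hu => ?_, fun p q h => ?_⟩
  · have h1 : (X a - X b : RR) ∣ 1 := hu.dvd
    rw [dvd_iff_merge a b hab] at h1
    simp at h1
  · rw [dvd_iff_merge a b hab, map_mul, mul_eq_zero] at h
    rwa [dvd_iff_merge a b hab, dvd_iff_merge a b hab]

theorem isRelPrime_X_sub_X {a b c d : Fin k} (hab : a ≠ b) (hcd : c ≠ d)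
    (h1 : ¬ (a = c ∧ b = d)) (h2 : ¬ (a = d ∧ b = c)) :
    IsRelPrime (X a - X b : RR) (X c - X d) := by
  rw [(prime_X_sub_X hab).irreducible.isRelPrime_iff_not_dvd,
    dvd_iff_merge a b hab, map_sub, sub_eq_zero]
  simp only [merge, aeval_X]
  intro h
  split_ifs at h with h3 h4 h4 <;> have h5 := X_injective (R := Coef) h
  · exact hcd (h3.trans h4.symm)
  · exact h1 ⟨h3.symm, h5⟩
  · exact h2 ⟨h4.symm, h5.symm⟩
  · exact hcd h5

/-- The Vandermonde product of the differences `X j - X i`, `i < j`. -/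
def vand (k : ℕ) : MvPolynomial (Fin k) Coef :=
  ∏ p ∈ Finset.univ.filter (fun p : Fin k × Fin k => p.1 < p.2), (X p.2 - X p.1)

theorem vand_ne_zero : vand k ≠ 0 :=
  Finset.prod_ne_zero_iff.2 fun _ hp => X_sub_X_ne_zero (Finset.mem_filter.1 hp).2.ne'

theorem X_sub_X_dvd_vand {a b : Fin k} (hab : a ≠ b) : (X a - X b : RR) ∣ vand k := by
  rcases lt_or_gt_of_ne hab with h | h
  · rw [← neg_sub, neg_dvd]
    have hm : (a, b) ∈ Finset.univ.filter (fun p : Fin k × Fin k => p.1 < p.2) := by simpa using h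
    have hd := Finset.dvd_prod_of_mem (fun p : Fin k × Fin k => (X p.2 - X p.1 : RR)) hm
    unfold vand
    exact hd
  · have hm : (b, a) ∈ Finset.univ.filter (fun p : Fin k × Fin k => p.1 < p.2) := by simpa using h
    have hd := Finset.dvd_prod_of_mem (fun p : Fin k × Fin k => (X p.2 - X p.1 : RR)) hm
    unfold vand
    exact hd

theorem vand_dvd {N : RR} (h : ∀ a b : Fin k, a ≠ b → (X a - X b : RR) ∣ N) : vand k ∣ N := by
  refine Finset.prod_dvd_of_isRelPrime ?_ ?_
  · rintro ⟨a, b⟩ hp ⟨c, d⟩ hq hne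
    have hab : a < b := (Finset.mem_filter.1 hp).2
    have hcd : c < d := (Finset.mem_filter.1 hq).2
    refine isRelPrime_X_sub_X hab.ne' hcd.ne' ?_ ?_
    · rintro ⟨rfl, rfl⟩; exact hne rfl
    · rintro ⟨rfl, rfl⟩; exact absurd hab hcd.not_gt
  · rintro ⟨a, b⟩ hp
    exact h b a (Finset.mem_filter.1 hp).2.ne'

theorem prod_dvd_vand (a : Fin k → ℕ) :
    (∏ p ∈ Finset.univ.filter (fun p : Fin k × Fin k => a p.2 < a p.1), (X p.1 - X p.2 : RR))
      ∣ vand k := by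
  refine Finset.prod_dvd_of_isRelPrime ?_ ?_
  · rintro ⟨i, j⟩ hp ⟨c, d⟩ hq hne
    have hij : a j < a i := (Finset.mem_filter.1 hp).2
    have hcd : a d < a c := (Finset.mem_filter.1 hq).2
    refine isRelPrime_X_sub_X ?_ ?_ ?_ ?_
    · exact fun h => hij.ne (congrArg a h).symm
    · exact fun h => hcd.ne (congrArg a h).symm
    · rintro ⟨rfl, rfl⟩; exact hne rfl
    · rintro ⟨rfl, rfl⟩; exact absurd hij hcd.not_gt
  · rintro ⟨i, j⟩ hp
    refine X_sub_X_dvd_vand ?_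
    have hij : a j < a i := (Finset.mem_filter.1 hp).2
    exact fun h => hij.ne (congrArg a h).symm

theorem vand_eq_det : vand k = (Matrix.vandermonde (X : Fin k → RR)).det := by
  rw [Matrix.det_vandermonde, vand, Finset.prod_filter, ← Finset.univ_product_univ,
    Finset.prod_product]
  refine Finset.prod_congr rfl fun i _ => ?_
  rw [← Finset.prod_filter]
  refine Finset.prod_congr ?_ fun _ _ => rfl
  ext j; simp

theorem rename_swap_vand {a b : Fin k} (hab : a ≠ b) :
    rename (Equiv.swap a b) (vand k) = - vand k := by
  rw [vand_eq_det, AlgHom.map_det]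
  have : (rename (Equiv.swap a b) : RR →ₐ[Coef] RR).mapMatrix (Matrix.vandermonde (X : Fin k → RR))
      = (Matrix.vandermonde (X : Fin k → RR)).submatrix (Equiv.swap a b) id := by
    ext1 i j
    simp [Matrix.vandermonde_apply]
  rw [this, Matrix.det_permute, Equiv.Perm.sign_swap hab]
  simp

/-- The action of a permutation of the variables on rational functions. -/
def permFrac (σ : Equiv.Perm (Fin k)) : FF ≃+* FF :=
  IsFractionRing.ringEquivOfRingEquiv (renameEquiv Coef σ).toRingEquiv

theorem permFrac_algebraMap (σ : Equiv.Perm (Fin k)) (p : RR) :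
    permFrac σ (algebraMap RR FF p) = algebraMap RR FF (rename σ p) := by
  simp [permFrac]

theorem permFrac_hallLittlewoodFrac (σ : Equiv.Perm (Fin k)) (l : Fin k → ℕ) :
    permFrac σ (hallLittlewoodFrac l) = hallLittlewoodFrac l := by
  rw [hallLittlewoodFrac, map_sum]
  refine Finset.sum_bij' (fun a _ => a ∘ σ.symm) (fun a _ => a ∘ σ) ?_ ?_ ?_ ?_ ?_
  · intro a ha
    obtain ⟨w, -, rfl⟩ := Finset.mem_image.1 ha
    exact Finset.mem_image.2 ⟨σ.symm.trans w, Finset.mem_univ _, by ext; simp⟩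
  · intro a ha
    obtain ⟨w, -, rfl⟩ := Finset.mem_image.1 ha
    exact Finset.mem_image.2 ⟨σ.trans w, Finset.mem_univ _, by ext; simp⟩
  · intro a _; ext; simp
  · intro a _; ext; simp
  · intro a _
    rw [map_mul, map_prod, map_prod]
    congr 1
    · refine Fintype.prod_equiv σ _ _ fun i => ?_
      rw [map_pow, permFrac_algebraMap]
      simp
    · refine Finset.prod_equiv (σ.prodCongr σ) ?_ ?_
      · intro p; simp
      · intro p _
        rw [map_div₀, permFrac_algebraMap, permFrac_algebraMap]
        simp

theorem exists_algebraMap_eq_mul_vand (l : Fin k → ℕ) :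
    ∃ N : RR, algebraMap RR FF N = hallLittlewoodFrac l * algebraMap RR FF (vand k) := by
  rw [hallLittlewoodFrac, Finset.sum_mul]
  choose q hq using fun a : Fin k → ℕ => prod_dvd_vand a
  refine ⟨∑ a ∈ Finset.univ.image (fun w : Equiv.Perm (Fin k) => l ∘ w), (∏ i, X i ^ a i) *
    (∏ p ∈ Finset.univ.filter (fun p : Fin k × Fin k => a p.2 < a p.1),
      (X p.1 - C t * X p.2)) * q a, ?_⟩
  rw [map_sum]
  refine Finset.sum_congr rfl fun a _ => ?_
  rw [Finset.prod_div_distrib, ← map_prod, ← map_prod, hq a]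
  have hD : algebraMap RR FF (∏ p ∈ Finset.univ.filter
      (fun p : Fin k × Fin k => a p.2 < a p.1), (X p.1 - X p.2)) ≠ 0 := by
    rw [Ne, FaithfulSMul.algebraMap_eq_zero_iff, Finset.prod_eq_zero_iff]
    rintro ⟨p, hp, h⟩
    refine X_sub_X_ne_zero ?_ h
    have := (Finset.mem_filter.1 hp).2
    intro h'
    rw [h'] at this
    exact lt_irrefl _ this
  simp only [map_mul, ← map_pow, ← map_prod]
  field_simp

/-- The Hall--Littlewood rational function is a symmetric polynomial. -/
theorem exists_symmetric_eq_hallLittlewoodFrac (l : Fin k → ℕ) :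
    ∃ p : symmetricSubalgebra (Fin k) Coef, algebraMap RR FF p.1 = hallLittlewoodFrac l := by
  obtain ⟨N, hN⟩ := exists_algebraMap_eq_mul_vand l
  have hinj : Function.Injective (algebraMap RR FF) := FaithfulSMul.algebraMap_injective _ _
  have hdvd : vand k ∣ N := by
    refine vand_dvd fun a b hab => ?_
    have hsw : rename (Equiv.swap a b) N = -N := by
      apply hinj
      rw [← permFrac_algebraMap, hN, map_mul, permFrac_hallLittlewoodFrac, permFrac_algebraMap,
        rename_swap_vand hab, map_neg, map_neg, hN, mul_neg]
    have hm : merge a b (rename (Equiv.swap a b) N) = merge a b N := by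
      rw [merge, aeval_rename]
      congr 2
      funext c
      rcases eq_or_ne c a with rfl | hca
      · simp
      · rcases eq_or_ne c b with rfl | hcb
        · simp
        · simp [Equiv.swap_apply_of_ne_of_ne hca hcb]
    rw [hsw, map_neg] at hm
    rw [dvd_iff_merge a b hab]
    exact self_eq_neg.1 hm.symm
  obtain ⟨p, rfl⟩ := hdvd
  have hv : algebraMap RR FF (vand k) ≠ 0 := by
    rw [Ne, FaithfulSMul.algebraMap_eq_zero_iff]
    exact vand_ne_zero
  have hp : algebraMap RR FF p = hallLittlewoodFrac l := by
    apply mul_right_cancel₀ hv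
    rw [← hN, map_mul, mul_comm]
  refine ⟨⟨p, ?_⟩, hp⟩
  rw [mem_symmetricSubalgebra]
  intro σ
  apply hinj
  rw [← permFrac_algebraMap, hp, permFrac_hallLittlewoodFrac]

end Polynomiality

/-- The Hall--Littlewood polynomial `P^l(x_1, …, x_k)`, an element of the ring `Λ_k` of symmetric
polynomials in `k` variables. -/
def hallLittlewood {k : ℕ} (l : Fin k → ℕ) : MvPolynomial.symmetricSubalgebra (Fin k) Coef :=
  (exists_symmetric_eq_hallLittlewoodFrac l).choose

theorem algebraMap_hallLittlewood {k : ℕ} (l : Fin k → ℕ) :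
    algebraMap (MvPolynomial (Fin k) Coef) (FractionRing (MvPolynomial (Fin k) Coef))
      (hallLittlewood l).1 = hallLittlewoodFrac l :=
  (exists_symmetric_eq_hallLittlewoodFrac l).choose_spec

/-! ### The quotient ring `Λ_{k,n}` -/

/-- The ideal of `Λ_k` generated by the `P^l`, where `l` runs over the partitions with at most `k`
parts whose largest part is not at most `n - 1`. -/
def truncIdeal (k n : ℕ) : Ideal (MvPolynomial.symmetricSubalgebra (Fin k) Coef) :=
  Ideal.span {p | ∃ l : Fin k → ℕ, Antitone l ∧ (¬ ∀ i, l i < n) ∧ p = hallLittlewood l}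

/-- The ring `Λ_{k,n}`. -/
abbrev TruncSym (k n : ℕ) : Type :=
  MvPolynomial.symmetricSubalgebra (Fin k) Coef ⧸ truncIdeal k n

/-- The class of `P^l` in `Λ_{k,n}`. -/
def hallLittlewoodTrunc {k : ℕ} (n : ℕ) (l : Fin k → ℕ) : TruncSym k n :=
  Ideal.Quotient.mk (truncIdeal k n) (hallLittlewood l)

/-! ### Honeycombs

The lattice `{(a, b, c) ∈ ℤ³ : a + b + c = 0}` is parametrized by `(x, y) ∈ ℤ²` through
`(a, b, c) = (y, -x-y, x)`. In these coordinates the directions West `(0, 1, -1)`,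
North-East `(1, -1, 0)` and South-East `(-1, 0, 1)` are `(-1, 0)`, `(0, 1)` and `(1, -1)`. -/

/-- The vertices of the triangular lattice. -/
abbrev Lattice : Type := ℤ × ℤ

/-- The unit vector pointing West (angle 180°). -/
def dirW : Lattice := (-1, 0)

/-- The unit vector pointing North-East (angle 60°). -/
def dirNE : Lattice := (0, 1)

/-- The unit vector pointing South-East (angle 300°). -/
def dirSE : Lattice := (1, -1)

/-- Multiplicities of the edges of the triangular lattice: `W v`, `NE v`, `SE v` are the
multiplicities of the edges that join `v` to `v + dirW`, `v + dirNE`, `v + dirSE`. Each edge occurs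
exactly once in this way. -/
@[ext]
structure EdgeMult where
  W : Lattice → ℕ
  NE : Lattice → ℕ
  SE : Lattice → ℕ

namespace EdgeMult

variable (H : EdgeMult) (v : Lattice)

/-- The multiplicity of the edge that leaves `v` towards the East. -/
def E : ℕ := H.W (v - dirW)

/-- The multiplicity of the edge that leaves `v` towards the South-West. -/
def SW : ℕ := H.NE (v - dirNE)

/-- The multiplicity of the edge that leaves `v` towards the North-West. -/
def NW : ℕ := H.SE (v - dirSE)

/-- The balance condition at `v`. -/
def Balanced : Prop :=
  (H.W v : ℤ) - H.E v = H.SE v - H.NW v ∧ (H.SE v : ℤ) - H.NW v = H.NE v - H.SW v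

/-- `v` is a vertex of the configuration: it is not the case that the edges at `v` form (at most)
a single straight line of constant multiplicity. -/
def IsVertex : Prop :=
  ¬ ((H.W v = H.E v ∧ H.SE v = 0 ∧ H.NW v = 0 ∧ H.NE v = 0 ∧ H.SW v = 0) ∨
     (H.SE v = H.NW v ∧ H.W v = 0 ∧ H.E v = 0 ∧ H.NE v = 0 ∧ H.SW v = 0) ∨
     (H.NE v = H.SW v ∧ H.W v = 0 ∧ H.E v = 0 ∧ H.SE v = 0 ∧ H.NW v = 0))

end EdgeMult

/-- A honeycomb: edge multiplicities that are balanced at every lattice point, with finitely many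
vertices, and such that every line that is followed towards the East, North-West or South-West
eventually stops, so that the only semi-infinite segments go off West, North-East or South-East.
(The number `k` of semi-infinite segments in each direction is fixed by `HasBoundaries`.) -/
@[ext]
structure Honeycomb extends EdgeMult where
  balanced : ∀ v, toEdgeMult.Balanced v
  finite_vertices : {v | toEdgeMult.IsVertex v}.Finite
  noRayE : ∀ v, ∃ s : ℕ, W (v - s • dirW) = 0
  noRayNW : ∀ v, ∃ s : ℕ, SE (v - s • dirSE) = 0
  noRaySW : ∀ v, ∃ s : ℕ, NE (v - s • dirNE) = 0

/-- The lattice points of the upright equilateral triangle of size `n - 1` with corners `(0, 0)`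
(South-West), `(n - 1, 0)` (South-East) and `(0, n - 1)` (North). -/
def triangle (n : ℕ) : Set Lattice :=
  {v | 0 ≤ v.1 ∧ 0 ≤ v.2 ∧ v.1 + v.2 ≤ (n : ℤ) - 1}

/-- `H` is a `GL(k)` honeycomb with boundaries `l`, `m`, `ν`: its vertices lie in the triangle of
size `n - 1`, and, with the lattice points of each side numbered from `0` to `n - 1` from left to
right, the number of semi-infinite lines going West (resp. North-East, South-East) through
point `r` of the North-West (resp. North-East, South) side is the number of parts of `l`
(resp. `m`, `ν`) equal to `r`. -/
def Honeycomb.HasBoundaries {k : ℕ} (n : ℕ) (H : Honeycomb) (l m ν : Fin k → ℕ) : Prop :=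
  (∀ v, H.IsVertex v → v ∈ triangle n) ∧
    ∀ r : ℕ, r < n →
      H.W (0, (r : ℤ)) = partMult l r ∧
      H.NE ((r : ℤ), (n : ℤ) - 1 - r) = partMult m r ∧
      H.SE ((r : ℤ), 0) = partMult ν r

/-- `α_i = ∏_{r=1}^i (1 - t^r)`. -/
def alpha (i : ℕ) : Coef := ∏ r ∈ Finset.Icc 1 i, (1 - t ^ r)

/-- The fugacity of a vertex with multiplicities `j` (East), `i` (North-East), `j'` (North-West)
and `i'` (West); the other two multiplicities are determined by the balance condition. -/
def fug (j i j' i' : ℕ) : Coef :=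
  ∑ r ∈ Finset.range (min i i' + 1),
    (-1) ^ r * t ^ (j' * r + r * (r + 1) / 2) *
      (alpha (i + j - r) / (alpha (i - r) * alpha r * alpha (i' - r)))

/-- The fugacity of a honeycomb is the product of the fugacities of its vertices. -/
def Honeycomb.fugacity (H : Honeycomb) : Coef :=
  ∏ᶠ (v : Lattice) (_ : H.IsVertex v), fug (H.E v) (H.NE v) (H.NW v) (H.W v)

/-- The sum of the fugacities of the honeycombs with boundaries `l`, `m`, `ν`
(there are finitely many of them). -/
def honeycombCoeff {k : ℕ} (n : ℕ) (l m ν : Fin k → ℕ) : Coef :=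
  ∑ᶠ (H : Honeycomb) (_ : H.HasBoundaries n l m ν), H.fugacity

/-- The honeycomb product on `Λ_{k,n}`: the bilinear operation which, for a basis `b` of `Λ_{k,n}`
(to be used with `b l = P^l`), sends `(b l, b m)` to `∑_ν (∑_H fug(H)) b ν`, the inner sum over the
honeycombs `H` with boundaries `l`, `m`, `ν`. -/
def honeycombMul {k n : ℕ} (b : Module.Basis (BoxPartition k n) Coef (TruncSym k n)) :
    TruncSym k n →ₗ[Coef] TruncSym k n →ₗ[Coef] TruncSym k n :=
  b.constr Coef fun l => b.constr Coef fun m =>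
    ∑ ν : BoxPartition k n, honeycombCoeff n l.1 m.1 ν.1 • b ν

end HallHoneycomb

end

/-!
Both sides of the statement are computed as a sum over sets of columns.

*Pieri rule.* Let `g i j = (x i - t x j) / (x i - x j)`, and let `u` be the parameter of the
generating function `∏ Q i`, `Q i = (1 - t u x i) / (1 - u x i)`, whose coefficients are
`(1 - t) P^(r)`. On functions of finite sets of variables there is an associative product,
`shuffle`, in which a set is split into a lower and an upper part, the pairs of variables between
the two being weighted by `g`; in it, a Hall--Littlewood polynomial is the product of its levels,
`m_0` variables with exponent `0`, `m_1` variables with exponent `1`, and so on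
(`levels_eq_sum_fillings`). Multiplication by `∏ Q` is an automorphism of this product. Two partial
fraction identities, `IsKernel.prod_mul_level_succ` and `IsKernel.carry_shuffle_level`, describe
what happens at one level: it may receive a growing row from below, and it may send one upwards.
The levels passed by a growing row form the set `C` of columns of a horizontal strip, and the
weights that are collected are those of the Pieri rule (`hallLittlewood_mul_row`).

*Basis.* By the Pieri rule, the span of the `P^l` for a set of partitions that is closed upwards is
stable under multiplication by all `P^(r)`. These generate the ring of symmetric polynomials
(`rowAlgebra_eq_top`): `∏ (1 - u x i) ∏ Q i = ∏ (1 - t u x i)` is a recursion for the elementary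
symmetric polynomials. So all `P^l` together span the ring, and those outside of the box span the
ideal. They are linearly independent because at `t = 1` they become the monomial symmetric
polynomials (`linearIndependent_hallLittlewood`).

*Honeycombs.* Outside of the triangle all lines are straight, so a honeycomb is determined by its
horizontal edges, and the number of horizontal edges in each vertical strip of the triangle is
prescribed by the North-East boundary (`Honeycomb.sum_W_add`). If that boundary is a row `(r)`, there
is one horizontal edge in each of the strips `1, …, r`, none further East, and the heights of these
edges increase weakly (`Honeycomb.exists_path`). The diagonals that contain these edges are the
columns of the horizontal strip, which makes honeycombs and horizontal strips correspond
(`Honeycomb.exists_eq_stripHoneycomb`, `stripHoneycomb_hasBoundaries`). On the North-West side all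
fugacities are `1` by two summations of `q`-binomial type, `sum_alpha_eq_one` and
`sum_alpha_eq_zero`; along the path they telescope to the coefficient of the Pieri rule
(`prod_diagFug`).
-/

noncomputable section

namespace HallHoneycomb

open Finset

/-! ### A partial fraction identity -/

section PartialFractions

variable {ι A : Type*} [DecidableEq ι] [CommRing A]

/-- Partial fractions for a product of fractions `N z / D z`, stated without denominators. The
coefficient of the pole at `z` is `∏ g z y`; both hypotheses are the case of two factors, the
first one for the fractions `g w z / 1`. -/
theorem prod_sub_prod_eq_sum_of_pairwise (g : ι → ι → A)
    (hg : ∀ w z y, w ≠ z → w ≠ y → z ≠ y →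
      g w z * g w y - 1 = (g w z - 1) * g z y + (g w y - 1) * g y z)
    (J : Finset ι) (N D : ι → A)
    (hND : ∀ w ∈ J, ∀ z ∈ J, w ≠ z →
      N w * N z - D w * D z = (N z - D z) * D w * g z w + (N w - D w) * D z * g w z) :
    ∏ z ∈ J, N z - ∏ z ∈ J, D z = ∑ z ∈ J, (N z - D z) * ∏ y ∈ J.erase z, D y * g z y := by
  induction J using Finset.induction_on generalizing N D with
  | empty => simp
  | insert w J hw ih =>
    have hne : ∀ z ∈ J, w ≠ z := fun z hz h => hw (h ▸ hz)
    have ih1 := ih N D fun a ha b hb =>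
      hND a (mem_insert_of_mem ha) b (mem_insert_of_mem hb)
    have ih2 := ih (fun z => g w z) (fun _ => 1) fun a ha b hb hab => by
      have := hg w a b (hne a ha) (hne b hb) hab
      linear_combination this
    have e1 : ∀ z ∈ J, (N z - D z) * ∏ y ∈ (insert w J).erase z, D y * g z y
        = N w * ((N z - D z) * ∏ y ∈ J.erase z, D y * g z y)
          - (N w - D w) * (∏ y ∈ J, D y) * ((g w z - 1) * ∏ y ∈ J.erase z, g z y) := by
      intro z hz
      rw [erase_insert_of_ne (hne z hz), prod_insert (fun h => hw (mem_of_mem_erase h)),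
        ← mul_prod_erase J D hz, prod_mul_distrib]
      have := hND w (mem_insert_self _ _) z (mem_insert_of_mem hz) (hne z hz)
      linear_combination (-(∏ y ∈ J.erase z, D y) * ∏ y ∈ J.erase z, g z y) * this
    rw [sum_insert hw, prod_insert hw, prod_insert hw, erase_insert hw, sum_congr rfl e1,
      sum_sub_distrib, ← mul_sum, ← mul_sum, ← ih1, prod_mul_distrib]
    simp only [one_mul, prod_const_one] at ih2
    rw [← ih2]
    ring

end PartialFractions

/-! ### The twisted shuffle product -/

section Shuffle

variable {ι A : Type*} [DecidableEq ι] [CommRing A]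

/-- The product of `g i j` over `i ∈ J` and `j ∈ I`. -/
def cross (g : ι → ι → A) (J I : Finset ι) : A := ∏ i ∈ J, ∏ j ∈ I, g i j

/-- The shuffle product of two functions on finite sets of variables, twisted by `g`: the value at
`S` is the sum over all splittings of `S` into a lower part `I` and an upper part `S \ I`. -/
def shuffle (g : ι → ι → A) (φ ψ : Finset ι → A) (S : Finset ι) : A :=
  ∑ I ∈ S.powerset, φ I * ψ (S \ I) * cross g (S \ I) I

/-- The unit of the twisted shuffle product. -/
def shuffleOne (S : Finset ι) : A := if S = ∅ then 1 else 0

variable (g : ι → ι → A)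

theorem cross_union_left {J K : Finset ι} (h : Disjoint J K) (I : Finset ι) :
    cross g (J ∪ K) I = cross g J I * cross g K I := prod_union h

theorem cross_union_right (J : Finset ι) {I K : Finset ι} (h : Disjoint I K) :
    cross g J (I ∪ K) = cross g J I * cross g J K := by
  simp only [cross, prod_union h, prod_mul_distrib]

theorem shuffle_one_left (φ : Finset ι → A) : shuffle g shuffleOne φ = φ := by
  funext S
  rw [shuffle, sum_eq_single ∅]
  · simp [shuffleOne, cross]
  · intro I _ h
    simp [shuffleOne, h]
  · simp

theorem shuffle_one_right (φ : Finset ι → A) : shuffle g φ shuffleOne = φ := by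
  funext S
  rw [shuffle, sum_eq_single S]
  · simp [shuffleOne, cross]
  · intro I hI h
    have : S \ I ≠ ∅ := fun h' => h (Subset.antisymm (mem_powerset.1 hI)
      (sdiff_eq_empty_iff_subset.1 h'))
    simp [shuffleOne, this]
  · simp

theorem shuffle_add_left (φ φ' ψ : Finset ι → A) :
    shuffle g (φ + φ') ψ = shuffle g φ ψ + shuffle g φ' ψ := by
  funext S
  simp [shuffle, add_mul, sum_add_distrib]

theorem shuffle_smul_left (c : A) (φ ψ : Finset ι → A) :
    shuffle g (c • φ) ψ = c • shuffle g φ ψ := by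
  funext S
  simp [shuffle, mul_sum, mul_assoc]

theorem shuffle_smul_right (c : A) (φ ψ : Finset ι → A) :
    shuffle g φ (c • ψ) = c • shuffle g φ ψ := by
  funext S
  simp only [shuffle, Pi.smul_apply, smul_eq_mul, mul_sum]
  exact sum_congr rfl fun _ _ => by ring

theorem shuffle_sum_right {β : Type*} (s : Finset β) (φ : Finset ι → A) (ψ : β → Finset ι → A) :
    shuffle g φ (∑ b ∈ s, ψ b) = ∑ b ∈ s, shuffle g φ (ψ b) := by
  funext S
  simp only [shuffle, Finset.sum_apply, mul_sum, sum_mul]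
  rw [sum_comm]

theorem shuffle_assoc (φ ψ χ : Finset ι → A) :
    shuffle g (shuffle g φ ψ) χ = shuffle g φ (shuffle g ψ χ) := by
  funext S
  simp only [shuffle, sum_mul, mul_sum]
  rw [sum_sigma', sum_sigma']
  refine sum_bij' (fun p _ => ⟨p.2, p.1 \ p.2⟩) (fun p _ => ⟨p.1 ∪ p.2, p.1⟩) ?_ ?_ ?_ ?_ ?_
  · rintro ⟨J, I⟩ h
    simp only [mem_sigma, mem_powerset] at h ⊢
    exact ⟨h.2.trans h.1, sdiff_subset_sdiff h.1 subset_rfl⟩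
  · rintro ⟨I, K⟩ h
    simp only [mem_sigma, mem_powerset] at h ⊢
    exact ⟨union_subset h.1 (h.2.trans sdiff_subset), subset_union_left⟩
  · rintro ⟨J, I⟩ h
    simp only [mem_sigma, mem_powerset] at h
    simp [union_sdiff_of_subset h.2]
  · rintro ⟨I, K⟩ h
    simp only [mem_sigma, mem_powerset] at h
    have hd : Disjoint I K := disjoint_of_subset_right h.2 disjoint_sdiff
    simp [union_sdiff_cancel_left hd]
  · rintro ⟨J, I⟩ h
    simp only [mem_sigma, mem_powerset] at h
    have e1 : (S \ I) \ (J \ I) = S \ J := by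
      ext a
      simp only [mem_sdiff]
      have := @h.2 a
      tauto
    have e2 : S \ I = (J \ I) ∪ (S \ J) := by
      ext a
      simp only [mem_sdiff, mem_union]
      have := @h.2 a
      have := @h.1 a
      tauto
    have e3 : J = I ∪ (J \ I) := (union_sdiff_of_subset h.2).symm
    have d1 : Disjoint (J \ I) (S \ J) := disjoint_of_subset_left sdiff_subset disjoint_sdiff
    have c1 : cross g (S \ I) I = cross g (J \ I) I * cross g (S \ J) I := by
      rw [e2, cross_union_left g d1]
    have c2 : cross g (S \ J) J = cross g (S \ J) I * cross g (S \ J) (J \ I) := by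
      conv_lhs => rw [e3]
      rw [cross_union_right g _ disjoint_sdiff, ← e3]
    simp only [e1, c1, c2]
    ring

/-- Shuffling with a function supported on singletons, as the upper factor. -/
theorem shuffle_singleton_right (φ ψ : Finset ι → A) (hψ : ∀ I, I.card ≠ 1 → ψ I = 0)
    (S : Finset ι) :
    shuffle g φ ψ S = ∑ z ∈ S, φ (S.erase z) * ψ {z} * ∏ y ∈ S.erase z, g z y := by
  have hinj : ∀ z ∈ S, ∀ z' ∈ S, S.erase z = S.erase z' → z = z' := by
    intro z hz z' hz' h
    by_contra hne
    have : z ∈ S.erase z' := mem_erase.2 ⟨hne, hz⟩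
    rw [← h] at this
    exact notMem_erase _ _ this
  have hs : ∀ z ∈ S, S \ S.erase z = {z} := fun z hz => by
    rw [← sdiff_singleton_eq_erase, Finset.sdiff_sdiff_eq_self (singleton_subset_iff.2 hz)]
  rw [shuffle, ← sum_subset (s₁ := S.image fun z => S.erase z), sum_image hinj]
  · refine sum_congr rfl fun z hz => ?_
    rw [hs z hz]
    simp [cross]
  · intro I hI
    obtain ⟨z, -, rfl⟩ := mem_image.1 hI
    exact mem_powerset.2 (erase_subset _ _)
  · intro I hI hI'
    rw [hψ (S \ I)]
    · simp
    · intro h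
      obtain ⟨z, hz⟩ := card_eq_one.1 h
      have hzS : z ∈ S := (mem_sdiff.1 (hz ▸ mem_singleton_self z)).1
      refine hI' (mem_image.2 ⟨z, hzS, ?_⟩)
      rw [← sdiff_singleton_eq_erase, ← hz, Finset.sdiff_sdiff_eq_self (mem_powerset.1 hI)]

/-- Shuffling with a function supported on singletons, as the lower factor. -/
theorem shuffle_singleton_left (φ ψ : Finset ι → A) (hφ : ∀ I, I.card ≠ 1 → φ I = 0)
    (S : Finset ι) :
    shuffle g φ ψ S = ∑ z ∈ S, φ {z} * ψ (S.erase z) * ∏ y ∈ S.erase z, g y z := by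
  rw [shuffle, ← sum_subset (s₁ := S.image fun z => {z}),
    sum_image (fun _ _ _ _ h => singleton_injective h)]
  · refine sum_congr rfl fun z hz => ?_
    rw [sdiff_singleton_eq_erase]
    simp [cross]
  · intro I hI
    obtain ⟨z, hz, rfl⟩ := mem_image.1 hI
    exact mem_powerset.2 (singleton_subset_iff.2 hz)
  · intro I hI hI'
    rw [hφ I]
    · simp
    · intro h
      obtain ⟨z, rfl⟩ := card_eq_one.1 h
      exact hI' (mem_image.2 ⟨z, singleton_subset_iff.1 (mem_powerset.1 hI), rfl⟩)

/-- Multiplication by a multiplicative function of finite sets is compatible with shuffling. -/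
theorem prod_mul_shuffle (Q : ι → A) (φ ψ : Finset ι → A) :
    (fun S => (∏ z ∈ S, Q z) * shuffle g φ ψ S)
      = shuffle g (fun S => (∏ z ∈ S, Q z) * φ S) (fun S => (∏ z ∈ S, Q z) * ψ S) := by
  funext S
  simp only [shuffle, mul_sum]
  refine sum_congr rfl fun I hI => ?_
  rw [← prod_sdiff (mem_powerset.1 hI)]
  ring

end Shuffle

/-! ### The transfer identities -/

section Transfer

variable {ι A : Type*} [CommRing A]

/-- The situation of the Pieri rule, in a domain: `g i j = (x i - t x j) / (x i - x j)` and
`Q i = (1 - t u x i) / (1 - u x i)`, where `u` is the parameter of the generating function. -/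
structure IsKernel (x : ι → A) (g : ι → ι → A) (Q : ι → A) (t u : A) : Prop where
  ne : ∀ i j, i ≠ j → x i - x j ≠ 0
  mul_g : ∀ i j, i ≠ j → (x i - x j) * g i j = x i - t * x j
  ne' : ∀ i, 1 - u * x i ≠ 0
  mul_Q : ∀ i, (1 - u * x i) * Q i = 1 - t * u * x i

variable {x : ι → A} {g : ι → ι → A} {Q : ι → A} {t u : A}

theorem IsKernel.mul_sub (h : IsKernel x g Q t u) (z : ι) : u * x z * (Q z - t) = Q z - 1 := by
  linear_combination - h.mul_Q z

/-- The monomial `∏ x i ^ s`, on the sets with `m` elements. -/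
def level (x : ι → A) (s m : ℕ) (I : Finset ι) : A :=
  if I.card = m then ∏ i ∈ I, x i ^ s else 0

/-- The generating function `∑_b (1 - t) u^b z^(s+b)` of the rows of length at least `s` in a
single variable `z`, on the sets with one element. -/
def carry (x Q : ι → A) (t : A) (s : ℕ) (I : Finset ι) : A :=
  if I.card = 1 then ∏ z ∈ I, (Q z - t) * x z ^ s else 0

theorem carry_eq_zero (s : ℕ) (I : Finset ι) (h : I.card ≠ 1) : carry x Q t s I = 0 := if_neg h

theorem prod_mul_level_zero [DecidableEq ι] (s : ℕ) :
    (fun S => (∏ z ∈ S, Q z) * level x s 0 S) = level x s 0 := by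
  funext S
  by_cases h : S = ∅ <;> simp [level, h]

theorem level_zero [DecidableEq ι] (s : ℕ) : level x s 0 = (shuffleOne : Finset ι → A) := by
  funext S
  by_cases h : S = ∅ <;> simp [level, shuffleOne, h]

theorem level_shuffle_carry [DecidableEq ι] (s m : ℕ) (S : Finset ι) :
    shuffle g (level x s m) (carry x Q t (s + 1)) S =
      if S.card = m + 1 then
        (∏ i ∈ S, x i ^ s) * ∑ z ∈ S, (x z * (Q z - t)) * ∏ y ∈ S.erase z, g z y
      else 0 := by
  rw [shuffle_singleton_right g _ _ (carry_eq_zero _)]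
  split_ifs with h
  · rw [mul_sum]
    refine sum_congr rfl fun z hz => ?_
    have h' : (S.erase z).card = m := by rw [card_erase_of_mem hz, h]; rfl
    rw [level, if_pos h', carry, if_pos (card_singleton z), prod_singleton,
      ← mul_prod_erase S _ hz]
    ring
  · refine sum_eq_zero fun z hz => ?_
    have h' : (S.erase z).card ≠ m := by
      rw [card_erase_of_mem hz]
      have := card_pos.2 ⟨z, hz⟩
      omega
    rw [level, if_neg h']
    ring

variable [IsDomain A]

namespace IsKernel

theorem g_relation (h : IsKernel x g Q t u) (w z y : ι) (h1 : w ≠ z) (h2 : w ≠ y) (h3 : z ≠ y) :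
    g w z * g w y - 1 = (g w z - 1) * g z y + (g w y - 1) * g y z := by
  apply mul_left_cancel₀ (h.ne _ _ h1)
  apply mul_left_cancel₀ (h.ne _ _ h2)
  apply mul_left_cancel₀ (h.ne _ _ h3)
  have a1 := h.mul_g _ _ h1
  have a2 := h.mul_g _ _ h2
  have a3 := h.mul_g _ _ h3
  have a4 := h.mul_g _ _ h3.symm
  have b1 : (x w - x z) * (x w - x y) * (x z - x y) *
      (g w z * g w y - 1 - ((g w z - 1) * g z y + (g w y - 1) * g y z)) =
      (x z - x y) * (((x w - x z) * g w z) * ((x w - x y) * g w y) - (x w - x z) * (x w - x y))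
      - ((x w - x z) * g w z - (x w - x z)) * ((x z - x y) * g z y) * (x w - x y)
      + ((x w - x y) * g w y - (x w - x y)) * ((x y - x z) * g y z) * (x w - x z) := by ring
  rw [a1, a2, a3, a4] at b1
  linear_combination b1

theorem g_relation' (h : IsKernel x g Q t u) (w z y : ι) (h1 : w ≠ z) (h2 : w ≠ y) (h3 : z ≠ y) :
    g z w * g y w - 1 = (g z w - 1) * g y z + (g y w - 1) * g z y := by
  apply mul_left_cancel₀ (h.ne _ _ h1)
  apply mul_left_cancel₀ (h.ne _ _ h2)
  apply mul_left_cancel₀ (h.ne _ _ h3)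
  have a1 := h.mul_g _ _ h1.symm
  have a2 := h.mul_g _ _ h2.symm
  have a3 := h.mul_g _ _ h3
  have a4 := h.mul_g _ _ h3.symm
  have b1 : (x w - x z) * (x w - x y) * (x z - x y) *
      (g z w * g y w - 1 - ((g z w - 1) * g y z + (g y w - 1) * g z y)) =
      (x z - x y) * (((x z - x w) * g z w) * ((x y - x w) * g y w) - (x w - x z) * (x w - x y))
      - ((x z - x w) * g z w - (x z - x w)) * ((x y - x z) * g y z) * (x w - x y)
      + ((x y - x w) * g y w - (x y - x w)) * ((x z - x y) * g z y) * (x w - x z) := by ring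
  rw [a1, a2, a3, a4] at b1
  linear_combination b1

theorem Q_relation (h : IsKernel x g Q t u) (w z : ι) (hwz : w ≠ z) :
    Q w * Q z - 1 = (Q z - 1) * g z w + (Q w - 1) * g w z := by
  apply mul_left_cancel₀ (h.ne _ _ hwz)
  apply mul_left_cancel₀ (h.ne' w)
  apply mul_left_cancel₀ (h.ne' z)
  have a1 := h.mul_Q w
  have a2 := h.mul_Q z
  have a3 := h.mul_g _ _ hwz
  have a4 := h.mul_g _ _ hwz.symm
  have b1 : (x w - x z) * (1 - u * x w) * (1 - u * x z) *
      (Q w * Q z - 1 - ((Q z - 1) * g z w + (Q w - 1) * g w z)) =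
      (x w - x z) * (((1 - u * x w) * Q w) * ((1 - u * x z) * Q z)
        - (1 - u * x w) * (1 - u * x z))
      + ((1 - u * x z) * Q z - (1 - u * x z)) * ((x z - x w) * g z w) * (1 - u * x w)
      - ((1 - u * x w) * Q w - (1 - u * x w)) * ((x w - x z) * g w z) * (1 - u * x z) := by ring
  rw [a1, a2, a3, a4] at b1
  linear_combination b1

theorem Q_relation' (h : IsKernel x g Q t u) (w z : ι) (hwz : w ≠ z) :
    t * t - Q w * Q z = (t - Q z) * Q w * g w z + (t - Q w) * Q z * g z w := by
  apply mul_left_cancel₀ (h.ne _ _ hwz)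
  apply mul_left_cancel₀ (h.ne' w)
  apply mul_left_cancel₀ (h.ne' z)
  have a1 := h.mul_Q w
  have a2 := h.mul_Q z
  have a3 := h.mul_g _ _ hwz
  have a4 := h.mul_g _ _ hwz.symm
  have b1 : (x w - x z) * (1 - u * x w) * (1 - u * x z) *
      (t * t - Q w * Q z - ((t - Q z) * Q w * g w z + (t - Q w) * Q z * g z w)) =
      (x w - x z) * (t * t * (1 - u * x w) * (1 - u * x z)
        - ((1 - u * x w) * Q w) * ((1 - u * x z) * Q z))
      - (t * (1 - u * x z) - (1 - u * x z) * Q z) * ((1 - u * x w) * Q w) *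
          ((x w - x z) * g w z)
      + (t * (1 - u * x w) - (1 - u * x w) * Q w) * ((1 - u * x z) * Q z) *
          ((x z - x w) * g z w) := by ring
  rw [a1, a2, a3, a4] at b1
  linear_combination b1

/-- Partial fractions for `∏ Q`. -/
theorem sum_Q_sub_one [DecidableEq ι] (h : IsKernel x g Q t u) (J : Finset ι) :
    ∑ z ∈ J, (Q z - 1) * ∏ y ∈ J.erase z, g z y = ∏ z ∈ J, Q z - 1 := by
  have := prod_sub_prod_eq_sum_of_pairwise g h.g_relation J Q (fun _ => 1) fun w _ z _ hwz => by
    linear_combination h.Q_relation w z hwz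
  simpa using this.symm

/-- Partial fractions for `∏ Q⁻¹`, multiplied by `∏ Q`. -/
theorem sum_Q_sub_t [DecidableEq ι] (h : IsKernel x g Q t u) (J : Finset ι) :
    ∑ z ∈ J, (Q z - t) * (∏ y ∈ J.erase z, Q y) * ∏ y ∈ J.erase z, g y z
      = ∏ z ∈ J, Q z - t ^ J.card := by
  have := prod_sub_prod_eq_sum_of_pairwise (fun i j => g j i) h.g_relation' J (fun _ => t) Q
    fun w _ z _ hwz => h.Q_relation' w z hwz
  rw [prod_const] at this
  rw [← neg_inj, neg_sub, this, ← sum_neg_distrib]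
  refine sum_congr rfl fun z _ => ?_
  rw [prod_mul_distrib]
  ring

end IsKernel

variable [DecidableEq ι]

/-- A level without an incoming row: at most one row of the level grows. -/
theorem IsKernel.prod_mul_level_succ (h : IsKernel x g Q t u) (s m : ℕ) :
    (fun S => (∏ z ∈ S, Q z) * level x s (m + 1) S) =
      level x s (m + 1) + u • shuffle g (level x s m) (carry x Q t (s + 1)) := by
  funext S
  rw [Pi.add_apply, Pi.smul_apply, level_shuffle_carry, level]
  split_ifs with hS
  · rw [smul_eq_mul, ← mul_assoc, mul_comm u, mul_assoc, mul_sum]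
    simp only [← mul_assoc, h.mul_sub]
    rw [h.sum_Q_sub_one]
    ring
  · simp

/-- A level with an incoming row, which either stops there, or passes and is then replaced by one
row of the enlarged level. -/
theorem IsKernel.carry_shuffle_level (h : IsKernel x g Q t u) (s m : ℕ) :
    shuffle g (carry x Q t s) (fun S => (∏ z ∈ S, Q z) * level x s m S) =
      (1 - t ^ (m + 1)) • level x s (m + 1) +
        u • shuffle g (level x s m) (carry x Q t (s + 1)) := by
  funext S
  rw [Pi.add_apply, Pi.smul_apply, Pi.smul_apply, level_shuffle_carry,
    shuffle_singleton_left g _ _ (carry_eq_zero _), level]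
  split_ifs with hS
  · have e : ∀ z ∈ S, carry x Q t s {z} * ((∏ z ∈ S.erase z, Q z) * level x s m (S.erase z)) *
        ∏ y ∈ S.erase z, g y z = (∏ i ∈ S, x i ^ s) *
          ((Q z - t) * (∏ y ∈ S.erase z, Q y) * ∏ y ∈ S.erase z, g y z) := by
      intro z hz
      have h' : (S.erase z).card = m := by rw [card_erase_of_mem hz, hS]; rfl
      rw [level, if_pos h', carry, if_pos (card_singleton z), prod_singleton,
        ← mul_prod_erase S _ hz]
      ring
    rw [sum_congr rfl e, ← mul_sum, h.sum_Q_sub_t, hS, smul_eq_mul, smul_eq_mul,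
      ← mul_assoc u, mul_comm u, mul_assoc _ u, mul_sum]
    simp only [← mul_assoc u, h.mul_sub]
    rw [h.sum_Q_sub_one]
    ring
  · rw [smul_zero, smul_zero, add_zero]
    refine sum_eq_zero fun z hz => ?_
    have h' : (S.erase z).card ≠ m := by
      rw [card_erase_of_mem hz]
      have := card_pos.2 ⟨z, hz⟩
      omega
    rw [level, if_neg h']
    ring

end Transfer

/-! ### Hall--Littlewood sums as shuffle products, and their transfer expansion -/

section Levels

variable {ι A : Type*} [DecidableEq ι] [CommRing A]

/-- The shuffle product of the levels `s, …, s + N - 1`, where level `v` has multiplicity `m v`: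
the Hall--Littlewood polynomial with `m v` parts equal to `v`. -/
def levels (g : ι → ι → A) (x : ι → A) (m : ℕ → ℕ) : ℕ → ℕ → Finset ι → A
  | _, 0 => shuffleOne
  | s, N + 1 => shuffle g (level x s (m s)) (levels g x m (s + 1) N)

/-- The indicator function of a finite set of columns. -/
def chi (C : Finset ℕ) (v : ℕ) : ℕ := if v ∈ C then 1 else 0

/-- The multiplicities of the parts after a box has been added in each of the columns `C`. -/
def addStrip (m : ℕ → ℕ) (C : Finset ℕ) (v : ℕ) : ℕ := m v + chi C v - chi C (v + 1)

/-- The weight of level `v` when boxes are added in the columns `C`. It vanishes if column `v + 1`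
gets a box that cannot be supported by level `v`. -/
def stepWeight (t u : A) (m : ℕ → ℕ) (C : Finset ℕ) (v : ℕ) : A :=
  if v + 1 ∈ C then (if m v + chi C v = 0 then 0 else u)
  else if v ∈ C then 1 - t ^ (m v + 1) else 1

/-- The last factor of the transfer expansion: a row that reaches beyond level `s`, if any. -/
def tailTerm (x Q : ι → A) (t : A) (C : Finset ℕ) (s : ℕ) : Finset ι → A :=
  if s ∈ C then carry x Q t s else shuffleOne

/-- The contribution of the set `C` of columns to the transfer expansion. -/
def transferTerm (g : ι → ι → A) (x Q : ι → A) (t u : A) (m : ℕ → ℕ) (C : Finset ℕ) :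
    ℕ → ℕ → Finset ι → A
  | s, 0 => tailTerm x Q t C s
  | s, N + 1 => stepWeight t u m C s •
      shuffle g (level x s (addStrip m C s)) (transferTerm g x Q t u m C (s + 1) N)

variable {x : ι → A} {g : ι → ι → A} {Q : ι → A} {t u : A}

theorem transferTerm_eq (m : ℕ → ℕ) (C : Finset ℕ) (s N : ℕ) :
    transferTerm g x Q t u m C s N = (∏ v ∈ Ico s (s + N), stepWeight t u m C v) •
      shuffle g (levels g x (addStrip m C) s N) (tailTerm x Q t C (s + N)) := by
  induction N generalizing s with
  | zero => simp [transferTerm, levels, shuffle_one_left]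
  | succ N ih =>
    rw [transferTerm, ih, shuffle_smul_right, ← shuffle_assoc, smul_smul, levels,
      prod_eq_prod_Ico_succ_bot (show s < s + (N + 1) by omega), show s + 1 + N = s + (N + 1) by omega]

variable [IsDomain A]

/-- One level of the transfer: the row coming from below, if any, meets level `s`. -/
theorem IsKernel.tailTerm_shuffle_level (h : IsKernel x g Q t u) (m : ℕ → ℕ) (C : Finset ℕ)
    (s : ℕ) (hC : s + 1 ∉ C) :
    shuffle g (tailTerm x Q t C s) (fun S => (∏ z ∈ S, Q z) * level x s (m s) S) =
      stepWeight t u m C s • level x s (addStrip m C s) +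
      stepWeight t u m (insert (s + 1) C) s •
        shuffle g (level x s (addStrip m (insert (s + 1) C) s)) (carry x Q t (s + 1)) := by
  by_cases hs : s ∈ C
  · simp [tailTerm, hs, stepWeight, addStrip, chi, hC, h.carry_shuffle_level]
  · rcases hm : m s with _ | k
    · simp [tailTerm, hs, stepWeight, addStrip, chi, hC, hm, shuffle_one_left,
        prod_mul_level_zero]
    · simp [tailTerm, hs, stepWeight, addStrip, chi, hC, hm, shuffle_one_left,
        h.prod_mul_level_succ]

/-- Multiplication by `∏ Q` is passed upwards through the levels one at a time; at each level the
growing row either stops or continues, which gives a sum over sets of columns. -/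
theorem IsKernel.tailTerm_shuffle_levels (h : IsKernel x g Q t u) (m : ℕ → ℕ) (N s : ℕ)
    (C₀ : Finset ℕ) (hC₀ : ∀ c ∈ C₀, c ≤ s) :
    shuffle g (tailTerm x Q t C₀ s) (fun S => (∏ z ∈ S, Q z) * levels g x m s N S) =
      ∑ C ∈ (Ioc s (s + N)).powerset, transferTerm g x Q t u m (C₀ ∪ C) s N := by
  induction N generalizing s C₀ with
  | zero =>
    have : (fun S => (∏ z ∈ S, Q z) * levels g x m s 0 S) = shuffleOne := by
      rw [levels, ← level_zero (x := x) s, prod_mul_level_zero]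
    simp [this, shuffle_one_right, transferTerm]
  | succ N ih =>
    have hs : s + 1 ∉ C₀ := fun h' => by have := hC₀ _ h'; omega
    have hI : Ioc s (s + (N + 1)) = insert (s + 1) (Ioc (s + 1) (s + 1 + N)) := by
      ext c
      simp only [mem_Ioc, mem_insert]
      omega
    have ih0 := ih (s + 1) C₀ fun c hc => (hC₀ c hc).trans (Nat.le_succ s)
    have ih1 := ih (s + 1) (insert (s + 1) C₀) fun c hc => by
      rcases mem_insert.1 hc with rfl | hc
      · exact le_rfl
      · exact (hC₀ c hc).trans (Nat.le_succ s)
    have ht0 : tailTerm x Q t C₀ (s + 1) = shuffleOne := if_neg hs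
    have ht1 : tailTerm x Q t (insert (s + 1) C₀) (s + 1) = carry x Q t (s + 1) :=
      if_pos (mem_insert_self _ _)
    rw [ht0, shuffle_one_left] at ih0
    rw [ht1] at ih1
    rw [levels, prod_mul_shuffle, ← shuffle_assoc, h.tailTerm_shuffle_level m C₀ s hs,
      shuffle_add_left, shuffle_smul_left, shuffle_smul_left, shuffle_assoc, ih1, ih0, hI,
      sum_powerset_insert (by simp), shuffle_sum_right, shuffle_sum_right, smul_sum, smul_sum]
    have hmem : ∀ C ∈ (Ioc (s + 1) (s + 1 + N)).powerset, s ∉ C ∧ s + 1 ∉ C := fun C hC => by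
      have hC := mem_powerset.1 hC
      exact ⟨fun h' => by have := mem_Ioc.1 (hC h'); omega,
        fun h' => by have := mem_Ioc.1 (hC h'); omega⟩
    congr 1
    · refine sum_congr rfl fun C hC => ?_
      obtain ⟨h1, h2⟩ := hmem C hC
      simp [transferTerm, stepWeight, addStrip, chi, h1, h2]
    · refine sum_congr rfl fun C hC => ?_
      obtain ⟨h1, h2⟩ := hmem C hC
      rw [union_insert, ← insert_union]
      simp [transferTerm, stepWeight, addStrip, chi, h1, h2]

end Levels

section Fillings

variable {ι A : Type*} [DecidableEq ι] [CommRing A]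

/-- The summand of a Hall--Littlewood polynomial that belongs to a rearrangement `a`. -/
def fillTerm (g : ι → ι → A) (x : ι → A) (S : Finset ι) (a : ι → ℕ) : A :=
  (∏ i ∈ S, x i ^ a i) * ∏ p ∈ (S ×ˢ S).filter (fun p => a p.2 < a p.1), g p.1 p.2

theorem fillTerm_eq (g : ι → ι → A) (x : ι → A) (S I : Finset ι) (hI : I ⊆ S) (a b : ι → ℕ)
    (s : ℕ) (ha : ∀ i ∈ I, a i = s) (hb : ∀ i ∈ S \ I, a i = b i) (hs : ∀ i ∈ S \ I, s < a i) :
    fillTerm g x S a = (∏ i ∈ I, x i ^ s) * fillTerm g x (S \ I) b * cross g (S \ I) I := by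
  have e1 : ∏ i ∈ S, x i ^ a i = (∏ i ∈ S \ I, x i ^ b i) * ∏ i ∈ I, x i ^ s := by
    rw [← prod_sdiff hI, prod_congr rfl fun i hi => by rw [hb i hi],
      prod_congr (s₁ := I) rfl fun i hi => by rw [ha i hi]]
  have e2 : (S ×ˢ S).filter (fun p => a p.2 < a p.1) =
      ((S \ I) ×ˢ (S \ I)).filter (fun p => b p.2 < b p.1) ∪ (S \ I) ×ˢ I := by
    ext ⟨i, j⟩
    simp only [mem_filter, mem_product, mem_union, mem_sdiff] at hb hs ⊢
    by_cases hi : i ∈ I <;> by_cases hj : j ∈ I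
    · simp [hi, hj, ha i hi, ha j hj]
    · simp only [hi, hj, ha i hi]
      have := hs j
      simp only [hj, not_false_eq_true, and_true] at this
      simp only [not_true_eq_false, and_false, false_and, or_false, iff_false]
      intro h
      have := this h.1.2
      omega
    · simp only [hi, hj, ha j hj]
      have := hs i
      simp only [hi, not_false_eq_true, and_true] at this
      have := hI hj
      grind
    · have h1 := hb i
      have h2 := hb j
      simp only [hi, hj, not_false_eq_true, and_true] at h1 h2 ⊢
      grind
  have hd : Disjoint (((S \ I) ×ˢ (S \ I)).filter (fun p => b p.2 < b p.1)) ((S \ I) ×ˢ I) := by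
    rw [disjoint_left]
    rintro ⟨i, j⟩ h1 h2
    simp only [mem_filter, mem_product, mem_sdiff] at h1 h2
    exact h1.1.2.2 h2.2
  rw [fillTerm, fillTerm, e1, e2, prod_union hd, cross, prod_product]
  ring

variable [Fintype ι]

/-- The functions on `S` (extended by zero) with values in `[s, s + N)` that take each value `v`
exactly `m v` times. -/
def fillings (m : ℕ → ℕ) (s N : ℕ) (S : Finset ι) : Finset (ι → ℕ) :=
  (Fintype.piFinset fun i => if i ∈ S then Ico s (s + N) else {0}).filter
    fun a => ∀ v ∈ Ico s (s + N), (S.filter fun i => a i = v).card = m v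

theorem mem_fillings {m : ℕ → ℕ} {s N : ℕ} {S : Finset ι} {a : ι → ℕ} :
    a ∈ fillings m s N S ↔ (∀ i ∉ S, a i = 0) ∧ (∀ i ∈ S, s ≤ a i ∧ a i < s + N) ∧
      ∀ v, s ≤ v → v < s + N → (S.filter fun i => a i = v).card = m v := by
  simp only [fillings, mem_filter, Fintype.mem_piFinset, mem_Ico, and_imp, ← and_assoc]
  refine and_congr_left fun _ => ⟨fun h => ⟨fun i hi => ?_, fun i hi => ?_⟩, fun h i => ?_⟩
  · simpa [hi] using h i
  · simpa [hi] using h i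
  · by_cases hi : i ∈ S
    · simpa [hi] using h.2 i hi
    · simpa [hi] using h.1 i hi

theorem levels_eq_sum_fillings (g : ι → ι → A) (x : ι → A) (m : ℕ → ℕ) (N s : ℕ) (S : Finset ι) :
    levels g x m s N S = ∑ a ∈ fillings m s N S, fillTerm g x S a := by
  induction N generalizing s S with
  | zero =>
    rw [levels, shuffleOne]
    split_ifs with hS
    · subst hS
      have : fillings m s 0 (∅ : Finset ι) = {0} := by
        ext a
        rw [mem_fillings, mem_singleton]
        simp [funext_iff]
        intros; omega
      simp [this, fillTerm]
    · obtain ⟨i, hi⟩ := nonempty_iff_ne_empty.2 hS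
      rw [sum_eq_zero]
      intro a ha
      have := (mem_fillings.1 ha).2.1 i hi
      omega
  | succ N ih =>
    rw [levels, shuffle, ← sum_fiberwise_of_maps_to (s := fillings m s (N + 1) S)
      (t := S.powerset) (g := fun a => S.filter fun i => a i = s)
      (fun a _ => mem_powerset.2 (filter_subset _ _))]
    refine sum_congr rfl fun I hI => ?_
    have hI := mem_powerset.1 hI
    rw [level]
    split_ifs with hc
    · rw [ih, mul_sum, sum_mul]
      refine sum_bij' (fun b _ i => if i ∈ I then s else b i)
        (fun a _ i => if i ∈ S \ I then a i else 0) ?_ ?_ ?_ ?_ ?_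
      · intro b hb
        obtain ⟨h1, h2, h3⟩ := mem_fillings.1 hb
        have hfil : S.filter (fun i => (if i ∈ I then s else b i) = s) = I := by
          ext i
          simp only [mem_filter]
          have := h2 i
          have := @hI i
          simp only [mem_sdiff] at *
          grind
        refine mem_filter.2 ⟨mem_fillings.2 ⟨?_, ?_, ?_⟩, hfil⟩
        · intro i hi
          have : i ∉ I := fun h => hi (hI h)
          simp only [this, if_false]
          exact h1 i fun h => hi (mem_sdiff.1 h).1
        · intro i hi
          by_cases h : i ∈ I
          · simp [h]
          · have := h2 i (mem_sdiff.2 ⟨hi, h⟩)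
            simp only [h, if_false]
            omega
        · intro v hv1 hv2
          rcases eq_or_lt_of_le hv1 with rfl | hv
          · rw [hfil, hc]
          · rw [← h3 v (by omega) (by omega)]
            congr 1
            ext i
            simp only [mem_filter, mem_sdiff]
            grind
      · intro a ha
        obtain ⟨ha, hf⟩ := mem_filter.1 ha
        obtain ⟨h1, h2, h3⟩ := mem_fillings.1 ha
        have hf' : ∀ i, i ∈ I ↔ i ∈ S ∧ a i = s := fun i => by rw [← hf, mem_filter]
        refine mem_fillings.2 ⟨?_, ?_, ?_⟩
        · intro i hi
          simp [hi]
        · intro i hi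
          have hi' := mem_sdiff.1 hi
          simp only [hi, if_true]
          have := h2 i hi'.1
          have : a i ≠ s := fun h => hi'.2 ((hf' i).2 ⟨hi'.1, h⟩)
          omega
        · intro v hv1 hv2
          rw [← h3 v (by omega) (by omega)]
          congr 1
          ext i
          simp only [mem_filter, mem_sdiff, hf']
          grind
      · intro b hb
        obtain ⟨h1, h2, h3⟩ := mem_fillings.1 hb
        funext i
        have := h1 i
        simp only [mem_sdiff] at *
        grind
      · intro a ha
        obtain ⟨ha, hf⟩ := mem_filter.1 ha
        obtain ⟨h1, h2, h3⟩ := mem_fillings.1 ha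
        have hf' : ∀ i, i ∈ I ↔ i ∈ S ∧ a i = s := fun i => by rw [← hf, mem_filter]
        funext i
        have := h1 i
        simp only [mem_sdiff, hf']
        grind
      · intro b hb
        obtain ⟨h1, h2, h3⟩ := mem_fillings.1 hb
        refine (fillTerm_eq g x S I hI _ b s ?_ ?_ ?_).symm
        · intro i hi
          simp [hi]
        · intro i hi
          simp [(mem_sdiff.1 hi).2]
        · intro i hi
          have := h2 i hi
          simp only [(mem_sdiff.1 hi).2, if_false]
          omega
    · rw [zero_mul, zero_mul, sum_eq_zero]
      intro a ha
      obtain ⟨ha, hf⟩ := mem_filter.1 ha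
      exact absurd (hf ▸ (mem_fillings.1 ha).2.2 s le_rfl (by omega)) hc

end Fillings

/-! ### Horizontal strips and sets of columns -/

section Strips

variable {k : ℕ}

/-- The number of parts that are at least `c`: the length of column `c` of the diagram. -/
def colLen (l : Fin k → ℕ) (c : ℕ) : ℕ := (univ.filter fun p => c ≤ l p).card

theorem colLen_zero (l : Fin k → ℕ) : colLen l 0 = k := by simp [colLen]

theorem colLen_le (l : Fin k → ℕ) (c : ℕ) : colLen l c ≤ k :=
  (card_filter_le _ _).trans (by simp)

theorem colLen_eq_zero {l : Fin k → ℕ} {c : ℕ} (h : ∀ p, l p < c) : colLen l c = 0 := by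
  rw [colLen, card_eq_zero, filter_eq_empty_iff]
  intro p _
  exact not_le.2 (h p)

theorem partMult_add_colLen (l : Fin k → ℕ) (c : ℕ) :
    partMult l c + colLen l (c + 1) = colLen l c := by
  rw [partMult, colLen, colLen, ← card_union_of_disjoint]
  · congr 1
    ext p
    simp only [mem_union, mem_filter, mem_univ, true_and]
    omega
  · rw [disjoint_filter]
    intro p _ h
    omega

theorem partMult_eq_zero {l : Fin k → ℕ} {c : ℕ} (h : ∀ p, l p < c) : partMult l c = 0 := by
  have := partMult_add_colLen l c
  have := colLen_eq_zero h
  omega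

theorem le_apply_iff {l : Fin k → ℕ} (hl : Antitone l) (c : ℕ) (p : Fin k) :
    c ≤ l p ↔ (p : ℕ) < colLen l c := by
  constructor
  · intro h
    have : Iic p ⊆ univ.filter fun p => c ≤ l p := fun q hq =>
      mem_filter.2 ⟨mem_univ _, h.trans (hl (mem_Iic.1 hq))⟩
    have := card_le_card this
    rw [Fin.card_Iic] at this
    exact this
  · intro h
    by_contra hc
    have : (univ.filter fun p => c ≤ l p) ⊆ Iio p := fun q hq => by
      rw [mem_Iio]
      by_contra hq'
      exact hc ((mem_filter.1 hq).2.trans (hl (not_lt.1 hq')))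
    have := card_le_card this
    rw [Fin.card_Iio] at this
    exact absurd h (not_lt.2 this)

theorem eq_of_colLen_eq {l ν : Fin k → ℕ} (hl : Antitone l) (hν : Antitone ν)
    (h : ∀ c, colLen l c = colLen ν c) : l = ν := by
  funext p
  refine le_antisymm ?_ ?_
  · rw [le_apply_iff hν, ← h, ← le_apply_iff hl]
  · rw [le_apply_iff hl, h, ← le_apply_iff hν]

theorem sum_eq_sum_colLen (l : Fin k → ℕ) (N : ℕ) (h : ∀ p, l p ≤ N) :
    ∑ p, l p = ∑ c ∈ Icc 1 N, colLen l c := by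
  have : ∀ p, l p = ∑ c ∈ Icc 1 N, if c ≤ l p then 1 else 0 := fun p => by
    rw [← card_filter]
    have : (Icc 1 N).filter (fun c => c ≤ l p) = Icc 1 (l p) := by
      ext c
      have := h p
      simp only [mem_filter, mem_Icc]
      omega
    simp [this]
  rw [sum_congr rfl fun p _ => this p, sum_comm]
  refine sum_congr rfl fun c _ => ?_
  rw [← card_filter, colLen]

/-- A partition with prescribed column lengths. -/
theorem exists_colLen_eq {L : ℕ → ℕ} (hL : Antitone L) (h0 : L 0 = k) {N : ℕ} (hN : L N = 0) :
    ∃ ν : Fin k → ℕ, Antitone ν ∧ (∀ p, ν p < N) ∧ ∀ c, colLen ν c = L c := by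
  let ν : Fin k → ℕ := fun p => ((Ico 1 N).filter fun c => (p : ℕ) < L c).card
  have key : ∀ c (p : Fin k), c ≤ ν p ↔ (p : ℕ) < L c := by
    intro c p
    constructor
    · intro h
      by_contra hc
      rcases Nat.eq_zero_or_pos c with rfl | hc0
      · rw [h0] at hc; exact hc p.2
      have : ((Ico 1 N).filter fun c => (p : ℕ) < L c) ⊆ Ico 1 c := fun d hd => by
        simp only [mem_filter, mem_Ico] at hd ⊢
        refine ⟨hd.1.1, ?_⟩
        by_contra hdc
        exact hc (hd.2.trans_le (hL (not_lt.1 hdc)))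
      have := card_le_card this
      rw [Nat.card_Ico] at this
      simp only [ν] at h
      omega
    · intro h
      have hcN : c < N := by
        by_contra hcN
        have := hL (not_lt.1 hcN)
        omega
      have : Icc 1 c ⊆ (Ico 1 N).filter fun c => (p : ℕ) < L c := fun d hd => by
        simp only [mem_filter, mem_Ico, mem_Icc] at hd ⊢
        exact ⟨⟨hd.1, by omega⟩, h.trans_le (hL hd.2)⟩
      have := card_le_card this
      rw [Nat.card_Icc] at this
      simpa using this
  refine ⟨ν, fun p q hpq => ?_, fun p => ?_, fun c => ?_⟩
  · rw [key]
    have := (key (ν q) q).1 le_rfl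
    exact lt_of_le_of_lt hpq this
  · by_contra h
    have := (key N p).1 (not_lt.1 h)
    omega
  · rw [colLen]
    simp only [key]
    have : L c ≤ k := h0 ▸ hL (Nat.zero_le c)
    rw [Fin.card_filter_val_lt]
    omega

/-- The diagram of `ν` is obtained from that of `l` by adding one box in each column of `C`. -/
def AddsColumns (l ν : Fin k → ℕ) (C : Finset ℕ) : Prop :=
  ∀ c, colLen ν c = colLen l c + chi C c

theorem hasBox_iff {l ν : Fin k → ℕ} (hl : Antitone l) (hν : Antitone ν) (p : Fin k) (c : ℕ) :
    HasBox l ν p c ↔ colLen l c ≤ p ∧ (p : ℕ) < colLen ν c := by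
  rw [HasBox, ← le_apply_iff hν, ← not_le, le_apply_iff hl, not_lt]

namespace AddsColumns

variable {l ν : Fin k → ℕ} {C : Finset ℕ}

theorem zero_notMem (h : AddsColumns l ν C) : 0 ∉ C := by
  intro h0
  have := h 0
  rw [colLen_zero, colLen_zero, chi, if_pos h0] at this
  omega

theorem mem_iff (h : AddsColumns l ν C) (hl : Antitone l) (hν : Antitone ν) (c : ℕ) :
    c ∈ C ↔ ∃ p, HasBox l ν p c := by
  simp only [hasBox_iff hl hν, h c]
  constructor
  · intro hc
    have h1 : colLen l c + 1 = colLen ν c := by rw [h c, chi, if_pos hc]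
    have h2 := colLen_le ν c
    exact ⟨⟨colLen l c, by omega⟩, le_rfl, by simp [chi, hc]⟩
  · rintro ⟨p, h1, h2⟩
    by_contra hc
    simp only [chi, hc, if_false] at h2
    omega

theorem lt_of_mem (h : AddsColumns l ν C) {n : ℕ} (hν : ∀ p, ν p < n) {c : ℕ} (hc : c ∈ C) :
    c < n := by
  by_contra hcn
  have := h c
  rw [chi, if_pos hc, colLen_eq_zero fun p => (hν p).trans_le (not_lt.1 hcn)] at this
  omega

theorem ext_right {ν' : Fin k → ℕ} (h : AddsColumns l ν C) (h' : AddsColumns l ν' C)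
    (hν : Antitone ν) (hν' : Antitone ν') : ν = ν' :=
  eq_of_colLen_eq hν hν' fun c => by rw [h c, h' c]

theorem ext_columns {C' : Finset ℕ} (h : AddsColumns l ν C) (h' : AddsColumns l ν C') :
    C = C' := by
  ext c
  have h1 := h c
  have h2 := h' c
  unfold chi at h1 h2
  split_ifs at h1 h2 <;> first | omega | tauto

theorem partMult_add (h : AddsColumns l ν C) (s : ℕ) :
    partMult ν s + chi C (s + 1) = partMult l s + chi C s := by
  have h1 := h s
  have h2 := h (s + 1)
  have h3 := partMult_add_colLen l s
  have h4 := partMult_add_colLen ν s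
  omega

theorem of_partMult (h : ∀ s, partMult ν s + chi C (s + 1) = partMult l s + chi C s)
    (h0 : 0 ∉ C) : AddsColumns l ν C := by
  intro c
  induction c with
  | zero => simp [colLen_zero, chi, h0]
  | succ c ih =>
    have h1 := h c
    have h3 := partMult_add_colLen l c
    have h4 := partMult_add_colLen ν c
    omega

theorem isHorizontalStrip (h : AddsColumns l ν C) (hl : Antitone l) (hν : Antitone ν) :
    IsHorizontalStrip l ν C.card := by
  have hle : ∀ p, l p ≤ ν p := fun p => by
    rw [le_apply_iff hν, h]
    have := (le_apply_iff hl (l p) p).1 le_rfl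
    omega
  refine ⟨hle, fun c p q hp hq => ?_, ?_⟩
  · rw [hasBox_iff hl hν, h c] at hp hq
    have : chi C c ≤ 1 := by unfold chi; split_ifs <;> omega
    exact Fin.ext (by omega)
  · have hN : ∀ p, ν p ≤ ∑ p, ν p := fun p =>
      single_le_sum (f := ν) (fun _ _ => Nat.zero_le _) (mem_univ p)
    rw [sum_eq_sum_colLen ν _ hN, sum_eq_sum_colLen l _ fun p => (hle p).trans (hN p),
      sum_congr rfl fun c _ => h c, sum_add_distrib]
    congr 1
    simp only [chi]
    rw [← card_filter]
    congr 1
    ext c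
    rw [mem_filter, mem_Icc, and_iff_right_iff_imp]
    intro hc
    have h1 := h.lt_of_mem (n := ∑ p, ν p + 1) (fun p => Nat.lt_succ_of_le (hN p)) hc
    have h2 : c ≠ 0 := fun h' => h.zero_notMem (h' ▸ hc)
    omega

theorem pieriCoeff_eq (h : AddsColumns l ν C) (hl : Antitone l) (hν : Antitone ν) :
    pieriCoeff l ν = 1 / (1 - t) * ∏ c ∈ C.filter (fun c => c + 1 ∉ C), (1 - t ^ partMult ν c) := by
  rw [pieriCoeff]
  congr 2
  ext c
  simp only [stripColumns, mem_filter, ← h.mem_iff hl hν, mem_Icc]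
  have hN : ∀ p, ν p ≤ ∑ p, ν p := fun p =>
      single_le_sum (f := ν) (fun _ _ => Nat.zero_le _) (mem_univ p)
  constructor
  · exact fun h => h.2
  · intro hc
    have h1 := h.lt_of_mem (n := ∑ p, ν p + 1) (fun p => Nat.lt_succ_of_le (hN p)) hc.1
    have h2 : c ≠ 0 := fun h' => h.zero_notMem (h' ▸ hc.1)
    exact ⟨by omega, hc⟩

end AddsColumns

theorem IsHorizontalStrip.exists_addsColumns {l ν : Fin k → ℕ} {r : ℕ}
    (h : IsHorizontalStrip l ν r) (hl : Antitone l) (hν : Antitone ν) :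
    ∃ C : Finset ℕ, AddsColumns l ν C ∧ C.card = r := by
  classical
  obtain ⟨h1, h2, h3⟩ := h
  have hN : ∀ p, ν p ≤ ∑ p, ν p := fun p =>
    single_le_sum (f := ν) (fun _ _ => Nat.zero_le _) (mem_univ p)
  have hC : AddsColumns l ν ((Icc 1 (∑ p, ν p)).filter fun c => ∃ p, HasBox l ν p c) := by
    intro c
    have hmono : colLen l c ≤ colLen ν c := card_le_card fun p hp =>
      mem_filter.2 ⟨mem_univ _, (mem_filter.1 hp).2.trans (h1 p)⟩
    have hk := colLen_le ν c
    unfold chi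
    split_ifs with hc
    · rw [mem_filter] at hc
      obtain ⟨p, hp⟩ := hc.2
      have hp' := (hasBox_iff hl hν p c).1 hp
      by_contra hne
      have a1 : HasBox l ν ⟨colLen l c, by omega⟩ c :=
        (hasBox_iff hl hν _ c).2 ⟨le_rfl, by simp only; omega⟩
      have a2 : HasBox l ν ⟨colLen l c + 1, by omega⟩ c :=
        (hasBox_iff hl hν _ c).2 ⟨by simp, by simp only; omega⟩
      have := congrArg Fin.val (h2 c _ _ a1 a2)
      simp only at this
      omega
    · by_contra hne
      have a1 : HasBox l ν ⟨colLen l c, by omega⟩ c :=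
        (hasBox_iff hl hν _ c).2 ⟨le_rfl, by simp only; omega⟩
      refine hc (mem_filter.2 ⟨mem_Icc.2 ⟨?_, a1.2.trans (hN _)⟩, _, a1⟩)
      have := a1.1
      omega
  refine ⟨_, hC, ?_⟩
  have := (hC.isHorizontalStrip hl hν).2.2
  omega

/-- A set of columns each of whose boxes is supported can be added to a partition. -/
theorem exists_addsColumns {l : Fin k → ℕ} {C : Finset ℕ} (h0 : 0 ∉ C)
    (hC : ∀ s, chi C (s + 1) ≤ partMult l s + chi C s) {N : ℕ} (hl : ∀ p, l p < N)
    (hN : ∀ c ∈ C, c < N) :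
    ∃ ν : Fin k → ℕ, Antitone ν ∧ (∀ p, ν p < N) ∧ AddsColumns l ν C := by
  refine exists_colLen_eq (antitone_nat_of_succ_le fun s => ?_) ?_ ?_
  · have := hC s
    have := partMult_add_colLen l s
    omega
  · simp [colLen_zero, chi, h0]
  · have : N ∉ C := fun h => lt_irrefl _ (hN N h)
    simp [colLen_eq_zero hl, chi, this]

end Strips

/-! ### The Pieri rule in the ring of symmetric polynomials -/

theorem t_pow_ne_one {r : ℕ} (hr : r ≠ 0) : 1 - t ^ r ≠ 0 := by
  intro h
  have h1 : (algebraMap (Polynomial ℚ) (RatFunc ℚ)) (Polynomial.X ^ r) =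
      algebraMap (Polynomial ℚ) (RatFunc ℚ) 1 := by
    rw [map_pow, RatFunc.algebraMap_X, map_one]
    exact (sub_eq_zero.1 h).symm
  have h2 := RatFunc.algebraMap_injective ℚ h1
  have h3 := congrArg Polynomial.natDegree h2
  rw [Polynomial.natDegree_X_pow, Polynomial.natDegree_one] at h3
  exact hr h3

theorem one_sub_t_ne_zero : 1 - t ≠ 0 := by
  simpa using t_pow_ne_one one_ne_zero

section Pieri

variable {k : ℕ}

/-- The field of rational functions in the variables `x_1, …, x_k`. -/
abbrev FracField (k : ℕ) : Type := FractionRing (MvPolynomial (Fin k) Coef)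

/-- The variable `x_i` as a rational function. -/
def fracX (i : Fin k) : FracField k :=
  algebraMap (MvPolynomial (Fin k) Coef) _ (MvPolynomial.X i)

/-- The parameter `t` as a rational function in `x_1, …, x_k`. -/
def fracT (k : ℕ) : FracField k := algebraMap Coef _ t

/-- The quotient `(x_i - t x_j) / (x_i - x_j)`. -/
def fracG (i j : Fin k) : FracField k := (fracX i - fracT k * fracX j) / (fracX i - fracX j)

theorem fracT_eq : fracT k = algebraMap (MvPolynomial (Fin k) Coef) _ (MvPolynomial.C t) :=
  IsScalarTower.algebraMap_apply Coef (MvPolynomial (Fin k) Coef) (FracField k) t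

theorem fracX_sub_ne_zero {i j : Fin k} (h : i ≠ j) : fracX i - fracX j ≠ 0 := by
  rw [fracX, fracX, ← map_sub, Ne, FaithfulSMul.algebraMap_eq_zero_iff]
  exact X_sub_X_ne_zero h

theorem hallLittlewoodFrac_eq_sum (l : Fin k → ℕ) :
    hallLittlewoodFrac l = ∑ a ∈ univ.image (fun w : Equiv.Perm (Fin k) => l ∘ w),
      fillTerm fracG fracX univ a := by
  rw [hallLittlewoodFrac]
  refine sum_congr rfl fun a _ => ?_
  rw [fillTerm, univ_product_univ]
  simp only [fracG, fracX, fracT_eq, map_sub, map_mul]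

/-- Two functions with the same multiplicities differ by a permutation. -/
theorem exists_perm_of_partMult_eq {a l : Fin k → ℕ} (h : ∀ v, partMult a v = partMult l v) :
    ∃ w : Equiv.Perm (Fin k), l ∘ w = a := by
  have e : ∀ v, Nonempty ({i // a i = v} ≃ {i // l i = v}) := fun v => by
    refine ⟨Fintype.equivOfCardEq ?_⟩
    rw [Fintype.card_subtype, Fintype.card_subtype]
    exact h v
  exact ⟨Equiv.ofFiberEquiv fun v => (e v).some, funext fun i => Equiv.ofFiberEquiv_map _ i⟩

theorem partMult_comp_perm (l : Fin k → ℕ) (w : Equiv.Perm (Fin k)) (v : ℕ) :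
    partMult (l ∘ w) v = partMult l v := by
  rw [partMult, partMult]
  refine card_bij (fun i _ => w i) ?_ (fun _ _ _ _ h => w.injective h) ?_
  · intro i hi
    simpa using hi
  · intro j hj
    exact ⟨w.symm j, by simpa using hj, by simp⟩

theorem fillings_eq_image {m : ℕ → ℕ} {l : Fin k → ℕ} {N : ℕ} (hl : ∀ p, l p < N)
    (hm : ∀ v < N, m v = partMult l v) :
    fillings m 0 N univ = univ.image (fun w : Equiv.Perm (Fin k) => l ∘ w) := by
  ext a
  rw [mem_fillings, mem_image]
  constructor
  · rintro ⟨-, h2, h3⟩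
    have h2' : ∀ p, a p < N := fun p => by simpa using (h2 p (mem_univ _)).2
    obtain ⟨w, hw⟩ := exists_perm_of_partMult_eq (a := a) (l := l) fun v => by
      by_cases hv : v < N
      · rw [← hm v hv, ← h3 v (Nat.zero_le _) (by omega), partMult]
      · rw [partMult_eq_zero fun p => (h2' p).trans_le (not_lt.1 hv),
          partMult_eq_zero fun p => (hl p).trans_le (not_lt.1 hv)]
    exact ⟨w, mem_univ _, hw⟩
  · rintro ⟨w, -, rfl⟩
    refine ⟨fun i hi => absurd (mem_univ i) hi, fun i _ => ⟨Nat.zero_le _, ?_⟩, fun v _ hv => ?_⟩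
    · simpa using hl (w i)
    · rw [hm v (by omega), ← partMult_comp_perm l w, partMult]

/-- The generating function `(1 - t u x_i) / (1 - u x_i)`, a power series in `u`. -/
def seriesQ (i : Fin k) : PowerSeries (FracField k) :=
  PowerSeries.mk fun r => if r = 0 then 1 else (1 - fracT k) * fracX i ^ r

theorem isKernel_series (k : ℕ) :
    IsKernel (fun i : Fin k => PowerSeries.C (fracX i)) (fun i j => PowerSeries.C (fracG i j))
      seriesQ (PowerSeries.C (fracT k)) PowerSeries.X where
  ne i j h := by
    rw [← map_sub, Ne, map_eq_zero_iff _ PowerSeries.C_injective]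
    exact fracX_sub_ne_zero h
  mul_g i j h := by
    rw [← map_sub, ← map_mul, ← map_mul, ← map_sub, fracG, mul_div_cancel₀ _ (fracX_sub_ne_zero h)]
  ne' i h := by
    have := congrArg PowerSeries.constantCoeff h
    simp at this
  mul_Q i := by
    ext r
    rcases r with _ | r
    · simp [seriesQ]
    · have e1 : (1 - PowerSeries.X * PowerSeries.C (fracX i)) * seriesQ i =
          seriesQ i - PowerSeries.X * (PowerSeries.C (fracX i) * seriesQ i) := by ring
      have e2 : (1 - PowerSeries.C (fracT k) * PowerSeries.X * PowerSeries.C (fracX i)) =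
          1 - PowerSeries.X * PowerSeries.C (fracT k * fracX i) := by rw [map_mul]; ring
      rw [e1, e2, map_sub, map_sub, PowerSeries.coeff_succ_X_mul, PowerSeries.coeff_succ_X_mul,
        PowerSeries.coeff_C_mul, PowerSeries.coeff_C, PowerSeries.coeff_one, seriesQ,
        PowerSeries.coeff_mk, PowerSeries.coeff_mk]
      rcases r with _ | r
      · simp; ring
      · simp; ring

theorem map_fillTerm (S : Finset (Fin k)) (a : Fin k → ℕ) :
    PowerSeries.C (fillTerm fracG fracX S a) =
      fillTerm (fun i j => PowerSeries.C (fracG (k := k) i j)) (fun i => PowerSeries.C (fracX i))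
        S a := by
  simp [fillTerm, map_prod]

theorem C_hallLittlewoodFrac {m : ℕ → ℕ} {l : Fin k → ℕ} {N : ℕ} (hl : ∀ p, l p < N)
    (hm : ∀ v < N, m v = partMult l v) :
    PowerSeries.C (hallLittlewoodFrac l) =
      levels (fun i j => PowerSeries.C (fracG (k := k) i j)) (fun i => PowerSeries.C (fracX i))
        m 0 N univ := by
  rw [levels_eq_sum_fillings, fillings_eq_image hl hm, hallLittlewoodFrac_eq_sum, map_sum]
  exact sum_congr rfl fun a _ => map_fillTerm _ _

theorem row_comp_image {r : ℕ} (hk : 1 ≤ k) :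
    univ.image (fun w : Equiv.Perm (Fin k) => row k r ∘ w) =
      univ.image fun z : Fin k => Pi.single z r := by
  have hrow : row k r = Pi.single (⟨0, hk⟩ : Fin k) r := by
    funext i
    simp [row, Pi.single_apply, Fin.ext_iff]
  have hcomp : ∀ w : Equiv.Perm (Fin k), row k r ∘ w = Pi.single (w.symm ⟨0, hk⟩) r := by
    intro w
    funext i
    simp [hrow, Pi.single_apply, Equiv.eq_symm_apply]
  ext a
  simp only [mem_image, mem_univ, true_and, hcomp]
  constructor
  · rintro ⟨w, rfl⟩
    exact ⟨_, rfl⟩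
  · rintro ⟨z, rfl⟩
    exact ⟨Equiv.swap z ⟨0, hk⟩, by simp⟩

theorem hallLittlewoodFrac_row {r : ℕ} (hk : 1 ≤ k) (hr : 0 < r) :
    hallLittlewoodFrac (row k r) =
      ∑ z : Fin k, fracX z ^ r * ∏ y ∈ univ.erase z, fracG z y := by
  rw [hallLittlewoodFrac_eq_sum, row_comp_image hk, sum_image]
  · refine sum_congr rfl fun z _ => ?_
    rw [fillTerm, ← mul_prod_erase _ _ (mem_univ z), Pi.single_eq_same,
      prod_eq_one (s := univ.erase z), mul_one]
    · congr 1
      refine prod_bij' (fun p _ => p.2) (fun y _ => (z, y)) ?_ ?_ ?_ ?_ ?_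
      · rintro ⟨i, j⟩ h
        have h := (mem_filter.1 h).2
        simp only [Pi.single_apply] at h
        rw [mem_erase]
        split_ifs at h <;> simp_all
      · intro y hy
        have := (mem_erase.1 hy).1
        simp [Pi.single_apply, this, hr]
      · rintro ⟨i, j⟩ h
        have h := (mem_filter.1 h).2
        simp only [Pi.single_apply] at h
        split_ifs at h <;> simp_all
      · simp
      · rintro ⟨i, j⟩ h
        have h := (mem_filter.1 h).2
        simp only [Pi.single_apply] at h
        split_ifs at h <;> simp_all
    · intro y hy
      simp [(mem_erase.1 hy).1]
  · intro z _ z' _ h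
    by_contra hne
    have := congrFun h z
    simp [hne] at this
    omega

/-- The one-row Hall--Littlewood polynomials have the generating function `∏ seriesQ`. -/
theorem coeff_prod_seriesQ {r : ℕ} (hk : 1 ≤ k) (hr : 0 < r) :
    PowerSeries.coeff r (∏ z : Fin k, seriesQ z) =
      (1 - fracT k) * hallLittlewoodFrac (row k r) := by
  have h := (isKernel_series k).sum_Q_sub_one univ
  have h' : ∏ z : Fin k, seriesQ z = 1 + ∑ z : Fin k, (seriesQ z - 1) *
      PowerSeries.C (∏ y ∈ univ.erase z, fracG z y) := by
    simp only [map_prod]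
    rw [h]
    ring
  rw [h', map_add, map_sum, PowerSeries.coeff_one, if_neg hr.ne', zero_add,
    hallLittlewoodFrac_row hk hr, mul_sum]
  refine sum_congr rfl fun z _ => ?_
  rw [PowerSeries.coeff_mul_C, map_sub, PowerSeries.coeff_one, if_neg hr.ne', seriesQ,
    PowerSeries.coeff_mk, if_neg hr.ne', sub_zero, mul_assoc]

/-- If every box of the columns `C` is supported, the weights of the levels multiply to the
coefficient of the Pieri rule. -/
theorem prod_stepWeight {A : Type*} [CommRing A] {t u : A} {m : ℕ → ℕ} {C : Finset ℕ} {N : ℕ}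
    (hC : C ⊆ Ioc 0 N) (hm : ∀ v < N, chi C (v + 1) ≤ m v + chi C v) :
    ∏ v ∈ Ico 0 N, stepWeight t u m C v = u ^ C.card *
      ∏ v ∈ (Ico 0 N).filter (fun v => v ∈ C ∧ v + 1 ∉ C), (1 - t ^ (m v + 1)) := by
  have e : ∀ v ∈ Ico 0 N, stepWeight t u m C v =
      (if v + 1 ∈ C then u else 1) * if v ∈ C ∧ v + 1 ∉ C then 1 - t ^ (m v + 1) else 1 := by
    intro v hv
    have := hm v (mem_Ico.1 hv).2
    by_cases h : v + 1 ∈ C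
    · have h1 : chi C (v + 1) = 1 := if_pos h
      rw [stepWeight, if_pos h, if_neg (by omega)]
      simp [h]
    · simp [stepWeight, h]
  rw [prod_congr rfl e, prod_mul_distrib, ← prod_filter, ← prod_filter, prod_const]
  congr 2
  refine card_bij (fun v _ => v + 1) ?_ ?_ ?_
  · intro v hv
    exact (mem_filter.1 hv).2
  · intro v _ w _ h
    omega
  · intro c hc
    have := mem_Ioc.1 (hC hc)
    have hc' : c - 1 + 1 = c := by omega
    exact ⟨c - 1, mem_filter.2 ⟨mem_Ico.2 ⟨by omega, by omega⟩, by rwa [hc']⟩, hc'⟩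

theorem prod_stepWeight_eq_zero {A : Type*} [CommRing A] {t u : A} {m : ℕ → ℕ} {C : Finset ℕ}
    {N v : ℕ} (hv : v < N) (hm : m v + chi C v < chi C (v + 1)) :
    ∏ v ∈ Ico 0 N, stepWeight t u m C v = 0 := by
  refine prod_eq_zero (mem_Ico.2 ⟨Nat.zero_le v, hv⟩) ?_
  have h : v + 1 ∈ C := by
    by_contra h
    simp [chi, h] at hm
  have h' : m v + chi C v = 0 := by
    simp only [chi, if_pos h] at hm ⊢
    omega
  simp [stepWeight, h, h']

/-- A box in column `N`, far beyond the levels that are occupied, needs boxes in all columns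
between. -/
theorem lt_card_of_mem {m : ℕ → ℕ} {C : Finset ℕ} {N₀ N : ℕ} (hN : N₀ ≤ N)
    (hm₀ : ∀ v, N₀ ≤ v → m v = 0) (hm : ∀ v < N, chi C (v + 1) ≤ m v + chi C v) (hC : N ∈ C) :
    N - N₀ < C.card := by
  have h : ∀ d, d ≤ N - N₀ → N - d ∈ C := by
    intro d hd
    induction d with
    | zero => simpa using hC
    | succ d ih =>
      have h1 := ih (by omega)
      have h2 := hm (N - (d + 1)) (by omega)
      rw [hm₀ _ (by omega), show N - (d + 1) + 1 = N - d by omega] at h2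
      by_contra h3
      simp [chi, h1, h3] at h2
  have : Icc N₀ N ⊆ C := fun c hc => by
    have hc := mem_Icc.1 hc
    have := h (N - c) (by omega)
    rwa [show N - (N - c) = c by omega] at this
  have := card_le_card this
  rw [Nat.card_Icc] at this
  omega

end Pieri

section Pieri

variable {k : ℕ}

theorem mem_strips {n r : ℕ} {l : Fin k → ℕ} {ν : BoxPartition k n} :
    ν ∈ strips n l r ↔ IsHorizontalStrip l ν.1 r := by
  simp [strips]

/-- The contribution to the Pieri rule of the columns of a horizontal strip. -/
theorem coeff_transferTerm {l ν : Fin k → ℕ} {C : Finset ℕ} {N : ℕ} (hl : Antitone l)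
    (hν : Antitone ν) (hνN : ∀ p, ν p < N) (hC : AddsColumns l ν C) :
    PowerSeries.coeff C.card
        (transferTerm (fun i j => PowerSeries.C (fracG (k := k) i j))
          (fun i => PowerSeries.C (fracX i)) seriesQ (PowerSeries.C (fracT k)) PowerSeries.X
          (partMult l) C 0 N univ) =
      (1 - fracT k) * (algebraMap Coef _ (pieriCoeff l ν) * hallLittlewoodFrac ν) := by
  have hCN : ∀ c ∈ C, c < N := fun c hc => hC.lt_of_mem hνN hc
  have hC0 : ∀ c ∈ C, 0 < c := fun c hc =>
    Nat.pos_of_ne_zero fun h => hC.zero_notMem (h ▸ hc)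
  have hN : N ∉ C := fun h => lt_irrefl _ (hCN N h)
  have hm : ∀ v, chi C (v + 1) ≤ partMult l v + chi C v := fun v => by
    have := hC.partMult_add v
    omega
  have hadd : ∀ v, addStrip (partMult l) C v = partMult ν v := fun v => by
    have := hC.partMult_add v
    unfold addStrip
    omega
  have hset : (Ico 0 N).filter (fun v => v ∈ C ∧ v + 1 ∉ C) = C.filter fun c => c + 1 ∉ C := by
    ext c
    simp only [mem_filter, mem_Ico]
    have := hCN c
    grind
  have hprod : ∏ v ∈ C.filter (fun c => c + 1 ∉ C),
      (1 - PowerSeries.C (fracT k) ^ (partMult l v + 1)) =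
      PowerSeries.C ((1 - fracT k) * algebraMap Coef _ (pieriCoeff l ν)) := by
    have ht : 1 - fracT k = algebraMap Coef _ (1 - t) := by simp [fracT]
    rw [hC.pieriCoeff_eq hl hν, ht, ← map_mul (algebraMap Coef _), ← mul_assoc,
      mul_one_div_cancel one_sub_t_ne_zero, one_mul, map_prod, map_prod]
    refine prod_congr rfl fun v hv => ?_
    have hv := mem_filter.1 hv
    have : partMult ν v = partMult l v + 1 := by
      have := hC.partMult_add v
      rwa [chi, if_neg hv.2, chi, if_pos hv.1] at this
    rw [this]
    simp [fracT]
  rw [transferTerm_eq, zero_add, tailTerm, if_neg hN, shuffle_one_right, Pi.smul_apply,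
    ← C_hallLittlewoodFrac (l := ν) hνN fun v _ => hadd v,
    prod_stepWeight (fun c hc => mem_Ioc.2 ⟨hC0 c hc, (hCN c hc).le⟩) fun v _ => hm v, hset,
    hprod, smul_eq_mul, mul_assoc, ← map_mul, PowerSeries.coeff_X_pow_mul', if_pos le_rfl,
    PowerSeries.coeff_C, if_pos (Nat.sub_self _), mul_assoc]

/-- The sets of columns that do not come from a horizontal strip do not contribute. -/
theorem coeff_transferTerm_eq_zero {l : Fin k → ℕ} {C : Finset ℕ} {N₀ N r : ℕ}
    (hl : Antitone l) (hlN : ∀ p, l p < N₀) (hN : N₀ + r ≤ N) (hC : C ⊆ Ioc 0 N)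
    (h : ∀ ν : BoxPartition k N, ν ∈ strips N l r → ¬ AddsColumns l ν.1 C) :
    PowerSeries.coeff r
        (transferTerm (fun i j => PowerSeries.C (fracG (k := k) i j))
          (fun i => PowerSeries.C (fracX i)) seriesQ (PowerSeries.C (fracT k)) PowerSeries.X
          (partMult l) C 0 N univ) = 0 := by
  rw [transferTerm_eq, zero_add, Pi.smul_apply, smul_eq_mul]
  by_cases hm : ∀ v < N, chi C (v + 1) ≤ partMult l v + chi C v
  · rw [prod_stepWeight hC hm, mul_assoc, PowerSeries.coeff_X_pow_mul']
    split_ifs with hr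
    · have hNC : N ∉ C := fun hNC => by
        have := lt_card_of_mem (N₀ := N₀) (by omega)
          (fun v hv => partMult_eq_zero fun p => (hlN p).trans_le hv) hm hNC
        omega
      have hCN : ∀ c ∈ C, c < N := fun c hc =>
        lt_of_le_of_ne (mem_Ioc.1 (hC hc)).2 fun h' => hNC (h' ▸ hc)
      obtain ⟨ν, hν, hνN, hadd⟩ := exists_addsColumns (l := l) (C := C) (N := N)
        (fun h0 => lt_irrefl _ (mem_Ioc.1 (hC h0)).1)
        (fun s => by
          by_cases hs : s < N
          · exact hm s hs
          · have : s + 1 ∉ C := fun hsC => by have := hCN _ hsC; omega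
            simp [chi, this])
        (fun p => (hlN p).trans_le (by omega)) hCN
      have hstrip := hadd.isHorizontalStrip hl hν
      have hcard : C.card ≠ r := fun hcr =>
        h ⟨ν, hν, hνN⟩ (mem_strips.2 (hcr ▸ hstrip)) hadd
      have hset : (Ico 0 N).filter (fun v => v ∈ C ∧ v + 1 ∉ C) =
          C.filter fun c => c + 1 ∉ C := by
        ext c
        simp only [mem_filter, mem_Ico]
        have := hCN c
        grind
      have hadd' : ∀ v < N, addStrip (partMult l) C v = partMult ν v := fun v _ => by
        have := hadd.partMult_add v
        unfold addStrip
        omega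
      have hconst : ∏ v ∈ (Ico 0 N).filter (fun v => v ∈ C ∧ v + 1 ∉ C),
          (1 - PowerSeries.C (fracT k) ^ (partMult l v + 1)) =
          PowerSeries.C (∏ v ∈ (Ico 0 N).filter (fun v => v ∈ C ∧ v + 1 ∉ C),
            (1 - fracT k ^ (partMult l v + 1))) := by
        simp [map_prod]
      rw [tailTerm, if_neg hNC, shuffle_one_right, ← C_hallLittlewoodFrac hνN hadd', hconst,
        ← map_mul, PowerSeries.coeff_C, if_neg (by omega)]
    · rfl
  · push Not at hm
    obtain ⟨v, hv, hm⟩ := hm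
    rw [prod_stepWeight_eq_zero hv hm, zero_mul, map_zero]

/-- The Pieri rule for rational functions: the coefficient of `u ^ r` in the product with `∏ Q`,
divided by `1 - t`. -/
theorem hallLittlewoodFrac_mul_row {l : Fin k → ℕ} (hl : Antitone l) {N₀ N r : ℕ} (hk : 1 ≤ k)
    (hr : 0 < r) (hlN : ∀ p, l p < N₀) (hN : N₀ + r ≤ N) :
    hallLittlewoodFrac l * hallLittlewoodFrac (row k r) =
      ∑ ν ∈ strips N l r, algebraMap Coef _ (pieriCoeff l ν.1) * hallLittlewoodFrac ν.1 := by
  have ht : 1 - fracT k ≠ 0 := by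
    rw [fracT, ← map_one (algebraMap Coef _), ← map_sub, Ne, map_eq_zero_iff _
      (algebraMap Coef (FracField k)).injective]
    exact one_sub_t_ne_zero
  apply mul_left_cancel₀ ht
  have h1 := congrFun ((isKernel_series k).tailTerm_shuffle_levels (partMult l) N 0 ∅ (by simp)) univ
  have hone : ∀ s, tailTerm (fun i => PowerSeries.C (fracX i)) seriesQ (PowerSeries.C (fracT k)) ∅ s
      = shuffleOne := fun s => if_neg (notMem_empty s)
  rw [hone, shuffle_one_left, ← C_hallLittlewoodFrac (l := l)
    (fun p => (hlN p).trans_le (by omega)) fun v _ => rfl] at h1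
  have h2 := congrArg (PowerSeries.coeff r) h1
  rw [PowerSeries.coeff_mul_C, coeff_prod_seriesQ hk hr] at h2
  rw [mul_left_comm, ← mul_assoc, mul_assoc, mul_comm, h2, Finset.sum_apply, map_sum, mul_sum]
  have hcol : ∀ ν : BoxPartition k N, ∃ C : Finset ℕ, ν ∈ strips N l r →
      AddsColumns l ν.1 C ∧ C.card = r := fun ν => by
    by_cases h : ν ∈ strips N l r
    · obtain ⟨C, hC⟩ := (mem_strips.1 h).exists_addsColumns hl ν.2.1
      exact ⟨C, fun _ => hC⟩
    · exact ⟨∅, fun h' => absurd h' h⟩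
  choose col hcol using hcol
  symm
  refine sum_of_injOn col ?_ ?_ ?_ ?_
  · intro ν hν ν' hν' h
    have a1 := (hcol ν hν).1
    have a2 := (hcol ν' hν').1
    rw [← h] at a2
    exact Subtype.ext (a1.ext_right a2 ν.2.1 ν'.2.1)
  · intro ν hν
    have a1 := (hcol ν hν).1
    refine mem_coe.2 (mem_powerset.2 fun c hc => mem_Ioc.2 ⟨Nat.pos_of_ne_zero fun h =>
      a1.zero_notMem (h ▸ hc), ?_⟩)
    have := a1.lt_of_mem ν.2.2 hc
    omega
  · intro C hC hC'
    rw [empty_union]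
    refine coeff_transferTerm_eq_zero hl hlN hN (by simpa using hC) fun ν hν hadd => hC' ?_
    exact ⟨ν, hν, (hcol ν hν).1.ext_columns hadd⟩
  · intro ν hν
    obtain ⟨a1, a2⟩ := hcol ν hν
    rw [empty_union, ← coeff_transferTerm hl ν.2.1 ν.2.2 a1, a2]

theorem algebraMap_val_injective : Function.Injective
    fun p : MvPolynomial.symmetricSubalgebra (Fin k) Coef =>
      algebraMap (MvPolynomial (Fin k) Coef) (FracField k) p.1 :=
  (FaithfulSMul.algebraMap_injective _ _).comp Subtype.val_injective

/-- The Pieri rule: the box, of size `N`, has to be large enough to contain all `ν`. -/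
theorem hallLittlewood_mul_row {l : Fin k → ℕ} (hl : Antitone l) {N₀ N r : ℕ} (hk : 1 ≤ k)
    (hr : 0 < r) (hlN : ∀ p, l p < N₀) (hN : N₀ + r ≤ N) :
    hallLittlewood l * hallLittlewood (row k r) =
      ∑ ν ∈ strips N l r, pieriCoeff l ν.1 • hallLittlewood ν.1 := by
  apply algebraMap_val_injective
  have h := hallLittlewoodFrac_mul_row hl hk hr hlN hN
  simp only [← algebraMap_hallLittlewood] at h
  simp only [MulMemClass.coe_mul, map_mul, h, AddSubmonoidClass.coe_finsetSum, map_sum]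
  refine sum_congr rfl fun ν _ => ?_
  rw [SetLike.val_smul, Algebra.smul_def, map_mul,
    ← IsScalarTower.algebraMap_apply Coef (MvPolynomial (Fin k) Coef) (FracField k)]

end Pieri

/-! ### The one-row polynomials generate the ring of symmetric polynomials -/

section Generation

variable {k : ℕ}

/-- The inclusion of the symmetric polynomials into the rational functions. -/
def symmToFrac (k : ℕ) : MvPolynomial.symmetricSubalgebra (Fin k) Coef →ₐ[Coef] FracField k :=
  (IsScalarTower.toAlgHom Coef (MvPolynomial (Fin k) Coef) (FracField k)).comp
    (MvPolynomial.symmetricSubalgebra (Fin k) Coef).val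

/-- The elementary symmetric polynomial as a rational function. -/
def fracEsymm (k r : ℕ) : FracField k :=
  algebraMap (MvPolynomial (Fin k) Coef) _ (MvPolynomial.esymm (Fin k) Coef r)

theorem coeff_prod_one_add (c : FracField k) (r : ℕ) :
    PowerSeries.coeff r (∏ i : Fin k, (1 + PowerSeries.X * PowerSeries.C (c * fracX i))) =
      c ^ r * fracEsymm k r := by
  have e : ∀ s : Finset (Fin k), ∏ i ∈ s, (PowerSeries.X * PowerSeries.C (c * fracX i)) =
      PowerSeries.X ^ s.card * PowerSeries.C (c ^ s.card * ∏ i ∈ s, fracX i) := fun s => by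
    rw [prod_mul_distrib, prod_const, ← map_prod, prod_mul_distrib, prod_const]
  rw [prod_one_add, map_sum, fracEsymm, MvPolynomial.esymm, map_sum, mul_sum,
    powersetCard_eq_filter, sum_filter]
  refine sum_congr rfl fun s _ => ?_
  rw [e, PowerSeries.coeff_X_pow_mul', map_prod]
  split_ifs with h1 h2 h2
  · rw [PowerSeries.coeff_C, if_pos (by omega), h2]
    rfl
  · rw [PowerSeries.coeff_C, if_neg (by omega)]
  · omega
  · rfl

/-- The coefficients of `∏ (1 - u x i) ∏ Q i = ∏ (1 - t u x i)`. -/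
theorem sum_antidiagonal_seriesQ (r : ℕ) :
    ∑ p ∈ antidiagonal r, PowerSeries.coeff p.1 (∏ z : Fin k, seriesQ z) *
      ((-1) ^ p.2 * fracEsymm k p.2) = (-fracT k) ^ r * fracEsymm k r := by
  rw [← coeff_prod_one_add]
  simp only [← coeff_prod_one_add]
  rw [← PowerSeries.coeff_mul, ← prod_mul_distrib]
  congr 1
  refine prod_congr rfl fun i _ => ?_
  have h := (isKernel_series k).mul_Q i
  simp only [neg_mul, one_mul, map_neg, map_mul]
  linear_combination h

theorem coeff_zero_prod_seriesQ : PowerSeries.coeff 0 (∏ z : Fin k, seriesQ z) = 1 := by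
  rw [PowerSeries.coeff_zero_eq_constantCoeff_apply, map_prod]
  refine prod_eq_one fun i _ => ?_
  rw [← PowerSeries.coeff_zero_eq_constantCoeff_apply, seriesQ, PowerSeries.coeff_mk, if_pos rfl]

/-- The subalgebra generated by the one-row Hall--Littlewood polynomials. -/
def rowAlgebra (k : ℕ) : Subalgebra Coef (MvPolynomial.symmetricSubalgebra (Fin k) Coef) :=
  Algebra.adjoin Coef {p | ∃ r, 0 < r ∧ p = hallLittlewood (row k r)}

/-- By the recursion `sum_antidiagonal_seriesQ`, solved for `e_r`, which has the coefficient
`±(1 - t ^ r)`. -/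
theorem fracEsymm_mem (hk : 1 ≤ k) (r : ℕ) :
    fracEsymm k r ∈ (rowAlgebra k).map (symmToFrac k) := by
  induction r using Nat.strong_induction_on with
  | _ r ih =>
    rcases Nat.eq_zero_or_pos r with rfl | hr
    · rw [fracEsymm, MvPolynomial.esymm_zero, map_one]
      exact one_mem _
    have hq : ∀ a, PowerSeries.coeff a (∏ z : Fin k, seriesQ z) ∈
        (rowAlgebra k).map (symmToFrac k) := by
      intro a
      rcases Nat.eq_zero_or_pos a with rfl | ha
      · rw [coeff_zero_prod_seriesQ]
        exact one_mem _
      · rw [coeff_prod_seriesQ hk ha, fracT]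
        refine mul_mem (sub_mem (one_mem _) (Subalgebra.algebraMap_mem _ _)) ?_
        exact ⟨hallLittlewood (row k a), Algebra.subset_adjoin ⟨a, ha, rfl⟩,
          algebraMap_hallLittlewood _⟩
    have h := sum_antidiagonal_seriesQ (k := k) r
    obtain ⟨r, rfl⟩ : ∃ s, r = s + 1 := ⟨r - 1, by omega⟩
    rw [Nat.sum_antidiagonal_succ, coeff_zero_prod_seriesQ, one_mul] at h
    have hmem : ∑ p ∈ antidiagonal r, PowerSeries.coeff (p.1 + 1) (∏ z : Fin k, seriesQ z) *
        ((-1) ^ p.2 * fracEsymm k p.2) ∈ (rowAlgebra k).map (symmToFrac k) := by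
      refine sum_mem fun p hp => mul_mem (hq _) (mul_mem ?_ (ih _ ?_))
      · exact pow_mem (neg_mem (one_mem _)) _
      · have := mem_antidiagonal.1 hp
        omega
    have hc : (-t) ^ (r + 1) - (-1) ^ (r + 1) ≠ 0 := by
      have h1 : (-t) ^ (r + 1) - (-1) ^ (r + 1) = (-1) ^ r * (1 - t ^ (r + 1)) := by
        rw [neg_pow t]
        ring
      rw [h1]
      exact mul_ne_zero (pow_ne_zero _ (neg_ne_zero.2 one_ne_zero)) (t_pow_ne_one (by omega))
    have hs : ((-t) ^ (r + 1) - (-1) ^ (r + 1)) • fracEsymm k (r + 1) =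
        ∑ p ∈ antidiagonal r, PowerSeries.coeff (p.1 + 1) (∏ z : Fin k, seriesQ z) *
        ((-1) ^ p.2 * fracEsymm k p.2) := by
      rw [Algebra.smul_def, map_sub, map_pow, map_pow, map_neg, map_neg, map_one, ← fracT]
      linear_combination -h
    have := Subalgebra.smul_mem _ hmem ((-t) ^ (r + 1) - (-1) ^ (r + 1))⁻¹
    rwa [← hs, inv_smul_smul₀ hc] at this

theorem rowAlgebra_eq_top (hk : 1 ≤ k) : rowAlgebra k = ⊤ := by
  rw [eq_top_iff]
  rintro f -
  obtain ⟨p, rfl⟩ := MvPolynomial.esymmAlgHom_surjective (σ := Fin k) (R := Coef) (n := k)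
    (by simp) f
  induction p using MvPolynomial.induction_on with
  | C c =>
    rw [← MvPolynomial.algebraMap_eq, AlgHom.commutes]
    exact Subalgebra.algebraMap_mem _ _
  | add p q hp hq => rw [map_add]; exact add_mem hp hq
  | mul_X p i hp =>
    rw [map_mul]
    refine mul_mem hp ?_
    obtain ⟨y, hy, he⟩ := fracEsymm_mem hk ((i : ℕ) + 1)
    have : MvPolynomial.esymmAlgHom (Fin k) Coef k (MvPolynomial.X i) = y := by
      apply algebraMap_val_injective
      simp only [MvPolynomial.esymmAlgHom, MvPolynomial.aeval_X]
      exact he.symm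
    rw [this]
    exact hy

/-- A subspace that is stable under multiplication by the one-row polynomials is an ideal. -/
theorem mul_mem_of_row_mul_mem (hk : 1 ≤ k)
    (U : Submodule Coef (MvPolynomial.symmetricSubalgebra (Fin k) Coef))
    (hU : ∀ r, 0 < r → ∀ v ∈ U, v * hallLittlewood (row k r) ∈ U)
    (f v : MvPolynomial.symmetricSubalgebra (Fin k) Coef) (hv : v ∈ U) : f * v ∈ U := by
  have hf : f ∈ rowAlgebra k := rowAlgebra_eq_top hk ▸ Algebra.mem_top
  induction hf using Algebra.adjoin_induction generalizing v with
  | mem x hx =>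
    obtain ⟨r, hr, rfl⟩ := hx
    rw [mul_comm]
    exact hU r hr v hv
  | algebraMap c =>
    rw [← Algebra.smul_def]
    exact U.smul_mem c hv
  | add x y _ _ hx hy =>
    rw [add_mul]
    exact U.add_mem (hx v hv) (hy v hv)
  | mul x y _ _ hx hy =>
    rw [mul_assoc]
    exact hx _ (hy v hv)

theorem hallLittlewood_zero : hallLittlewood (0 : Fin k → ℕ) = 1 := by
  apply algebraMap_val_injective
  simp only [algebraMap_hallLittlewood]
  have : univ.image (fun w : Equiv.Perm (Fin k) => (0 : Fin k → ℕ) ∘ w) = {0} := by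
    ext a
    simp only [mem_image, mem_univ, true_and, mem_singleton, Pi.zero_comp]
    exact ⟨fun ⟨_, h⟩ => h.symm, fun h => ⟨1, h.symm⟩⟩
  rw [hallLittlewoodFrac_eq_sum, this]
  simp [fillTerm]

/-- A family of partitions that is stable under adding horizontal strips spans an ideal. -/
theorem mul_mem_span_hallLittlewood (hk : 1 ≤ k) (s : Set (Fin k → ℕ)) (hs : ∀ l ∈ s, Antitone l)
    (hs' : ∀ l ∈ s, ∀ ν, Antitone ν → (∀ p, l p ≤ ν p) → ν ∈ s)
    (f v : MvPolynomial.symmetricSubalgebra (Fin k) Coef)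
    (hv : v ∈ Submodule.span Coef (hallLittlewood '' s)) :
    f * v ∈ Submodule.span Coef (hallLittlewood '' s) := by
  refine mul_mem_of_row_mul_mem hk _ (fun r hr v hv => ?_) f v hv
  induction hv using Submodule.span_induction with
  | mem x hx =>
    obtain ⟨l, hl, rfl⟩ := hx
    have hN : ∀ p, l p < ∑ p, l p + 1 := fun p =>
      Nat.lt_succ_of_le (single_le_sum (f := l) (fun _ _ => Nat.zero_le _) (mem_univ p))
    rw [hallLittlewood_mul_row (hs l hl) hk hr hN le_rfl]
    refine Submodule.sum_mem _ fun ν hν => Submodule.smul_mem _ _ (Submodule.subset_span ?_)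
    exact ⟨ν.1, hs' l hl ν.1 ν.2.1 (mem_strips.1 hν).1, rfl⟩
  | zero => rw [zero_mul]; exact zero_mem _
  | add x y _ _ hx hy => rw [add_mul]; exact add_mem hx hy
  | smul c x _ hx => rw [smul_mul_assoc]; exact Submodule.smul_mem _ c hx

theorem span_hallLittlewood (hk : 1 ≤ k) :
    Submodule.span Coef (hallLittlewood '' {l : Fin k → ℕ | Antitone l}) = ⊤ := by
  rw [eq_top_iff]
  rintro f -
  have h1 : (1 : MvPolynomial.symmetricSubalgebra (Fin k) Coef) ∈
      Submodule.span Coef (hallLittlewood '' {l : Fin k → ℕ | Antitone l}) :=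
    Submodule.subset_span ⟨0, fun _ _ _ => le_rfl, hallLittlewood_zero⟩
  have := mul_mem_span_hallLittlewood hk {l | Antitone l} (fun _ h => h) (fun _ _ _ h _ => h) f 1 h1
  rwa [mul_one] at this

end Generation

/-! ### Linear independence, by specialization to `t = 1` -/

section Independence

open MvPolynomial

variable {k : ℕ} {R R' : Type*} [CommRing R] [CommRing R']

/-- The product of `X i - X j` over all `i ≠ j`, a common denominator of all Hall--Littlewood
polynomials. -/
def allDiffs (k : ℕ) (R : Type*) [CommRing R] : MvPolynomial (Fin k) R :=
  ∏ p ∈ univ.filter (fun p : Fin k × Fin k => p.1 ≠ p.2), (X p.1 - X p.2)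

/-- The product of `allDiffs` and the Hall--Littlewood polynomial with parameter `τ`, over an
arbitrary ring. -/
def clearedHL (τ : R) (l : Fin k → ℕ) : MvPolynomial (Fin k) R :=
  ∑ a ∈ univ.image (fun w : Equiv.Perm (Fin k) => l ∘ w),
    (∏ i, X i ^ a i) * ∏ p ∈ univ.filter (fun p : Fin k × Fin k => p.1 ≠ p.2),
      (if a p.2 < a p.1 then X p.1 - C τ * X p.2 else X p.1 - X p.2)

theorem map_clearedHL (f : R →+* R') (τ : R) (l : Fin k → ℕ) :
    map f (clearedHL τ l) = clearedHL (f τ) l := by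
  simp only [clearedHL, map_sum, map_mul, map_prod, map_pow, map_X, apply_ite (map f), map_sub,
    map_C]

theorem allDiffs_ne_zero [IsDomain R] : allDiffs k R ≠ 0 :=
  prod_ne_zero_iff.2 fun _ hp =>
    sub_ne_zero.2 fun h => (mem_filter.1 hp).2 (X_injective h)

theorem algebraMap_clearedHL (l : Fin k → ℕ) :
    clearedHL t l = (hallLittlewood l).1 * allDiffs k Coef := by
  apply FaithfulSMul.algebraMap_injective (MvPolynomial (Fin k) Coef) (FracField k)
  rw [map_mul, algebraMap_hallLittlewood, hallLittlewoodFrac_eq_sum, clearedHL, map_sum, sum_mul]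
  refine sum_congr rfl fun a _ => ?_
  have hne : univ.filter (fun p : Fin k × Fin k => a p.2 < a p.1) =
      (univ.filter fun p : Fin k × Fin k => p.1 ≠ p.2).filter fun p => a p.2 < a p.1 := by
    ext p
    simp only [mem_filter, mem_univ, true_and]
    exact ⟨fun h => ⟨fun h' => by rw [h'] at h; exact lt_irrefl _ h, h⟩, fun h => h.2⟩
  rw [fillTerm, univ_product_univ, hne,
    prod_filter (fun p : Fin k × Fin k => a p.2 < a p.1), map_mul, map_prod, map_prod, allDiffs,
    map_prod, mul_assoc, ← prod_mul_distrib]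
  congr 1
  · refine prod_congr rfl fun i _ => ?_
    rw [map_pow, fracX]
  · refine prod_congr rfl fun p hp => ?_
    split_ifs with h
    · rw [map_sub, map_sub, map_mul, ← fracT_eq]
      exact (div_mul_cancel₀ _ (fracX_sub_ne_zero (mem_filter.1 hp).2)).symm
    · rw [one_mul]

theorem clearedHL_one (l : Fin k → ℕ) :
    clearedHL (1 : R) l = (∑ a ∈ univ.image (fun w : Equiv.Perm (Fin k) => l ∘ w),
      ∏ i, X i ^ a i) * allDiffs k R := by
  simp [clearedHL, sum_mul, allDiffs]

theorem eq_of_partMult_eq {l ν : Fin k → ℕ} (hl : Antitone l) (hν : Antitone ν)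
    (h : ∀ v, partMult l v = partMult ν v) : l = ν := by
  have : AddsColumns l ν ∅ := AddsColumns.of_partMult (by simp [chi, h]) (notMem_empty _)
  exact eq_of_colLen_eq hl hν fun c => by simp [this c, chi]

/-- Coefficient extraction in a monomial symmetric polynomial. -/
theorem coeff_sum_rearrangements {l μ : Fin k → ℕ} (hl : Antitone l) (hμ : Antitone μ) :
    coeff (Finsupp.equivFunOnFinite.symm μ)
      (∑ a ∈ univ.image (fun w : Equiv.Perm (Fin k) => l ∘ w), ∏ i, X i ^ a i :
        MvPolynomial (Fin k) R) = if l = μ then 1 else 0 := by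
  have e : ∀ a : Fin k → ℕ, (∏ i, X i ^ a i : MvPolynomial (Fin k) R) =
      monomial (Finsupp.equivFunOnFinite.symm a) 1 := fun a => by
    rw [monomial_eq, map_one, one_mul, Finsupp.prod_fintype _ _ (by simp)]
    rfl
  simp only [e, coeff_sum, coeff_monomial, EmbeddingLike.apply_eq_iff_eq]
  rw [sum_ite_eq']
  refine if_congr ⟨fun h => ?_, fun h => ?_⟩ rfl rfl
  · obtain ⟨w, -, rfl⟩ := mem_image.1 h
    exact eq_of_partMult_eq hl hμ fun v => (partMult_comp_perm l w v).symm
  · exact mem_image.2 ⟨1, mem_univ _, h⟩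

/-- In a linear relation with polynomial coefficients, all coefficients vanish at `t = 1`; divide
by `t - 1` and repeat. -/
theorem pow_dvd_of_sum_eq_zero (s : Finset {l : Fin k → ℕ // Antitone l}) (e : ℕ)
    (c : {l : Fin k → ℕ // Antitone l} → Polynomial ℚ)
    (h : ∑ l ∈ s, C (c l) * clearedHL Polynomial.X l.1 = 0) :
    ∀ l ∈ s, (Polynomial.X - Polynomial.C 1) ^ e ∣ c l := by
  induction e generalizing c with
  | zero => simp
  | succ e ih =>
    have h0 : ∀ l ∈ s, (c l).eval 1 = 0 := by
      intro μ hμ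
      have h1 := congrArg (map (Polynomial.evalRingHom (1 : ℚ))) h
      simp only [map_sum, map_mul, map_clearedHL, map_C, Polynomial.coe_evalRingHom,
        Polynomial.eval_X, clearedHL_one, map_zero, ← mul_assoc] at h1
      rw [← sum_mul] at h1
      have h2 := (mul_eq_zero.1 h1).resolve_right allDiffs_ne_zero
      have h3 := congrArg (coeff (Finsupp.equivFunOnFinite.symm μ.1)) h2
      simp only [coeff_sum (s), coeff_C_mul, coeff_zero] at h3
      rw [sum_congr rfl fun l _ => by rw [coeff_sum_rearrangements l.2 μ.2]] at h3
      simp only [mul_ite, mul_one, mul_zero, Subtype.val_inj, sum_ite_eq', hμ, if_true] at h3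
      exact h3
    have h4 : ∀ l, ∃ d, l ∈ s → c l = (Polynomial.X - Polynomial.C 1) * d := fun l => by
      by_cases hl : l ∈ s
      · obtain ⟨d, hd⟩ := Polynomial.dvd_iff_isRoot.2 (h0 l hl)
        exact ⟨d, fun _ => hd⟩
      · exact ⟨0, fun h => absurd h hl⟩
    choose d hd using h4
    rw [sum_congr rfl fun l hl => by rw [hd l hl, map_mul, mul_assoc], ← mul_sum] at h
    have h5 : (C (Polynomial.X - Polynomial.C 1) : MvPolynomial (Fin k) (Polynomial ℚ)) ≠ 0 := by
      rw [Ne, C_eq_zero]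
      exact Polynomial.X_sub_C_ne_zero 1
    intro l hl
    rw [hd l hl, pow_succ']
    exact mul_dvd_mul_left _ (ih d ((mul_eq_zero.1 h).resolve_left h5) l hl)

theorem linearIndependent_hallLittlewood :
    LinearIndependent Coef fun l : {l : Fin k → ℕ // Antitone l} => hallLittlewood l.1 := by
  have h1 : LinearIndependent Coef fun l : {l : Fin k → ℕ // Antitone l} =>
      (clearedHL t l.1 : MvPolynomial (Fin k) Coef) := by
    rw [← LinearIndependent.iff_fractionRing (Polynomial ℚ) Coef, linearIndependent_iff']
    intro s c h l hl
    have h2 : ∑ l ∈ s, C (c l) * clearedHL Polynomial.X l.1 = 0 := by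
      apply map_injective _ (RatFunc.algebraMap_injective ℚ)
      rw [map_zero, map_sum, ← h]
      refine sum_congr rfl fun l _ => ?_
      rw [map_mul, map_clearedHL, map_C, RatFunc.algebraMap_X, Algebra.smul_def,
        IsScalarTower.algebraMap_apply (Polynomial ℚ) Coef (MvPolynomial (Fin k) Coef)]
      rfl
    by_contra hc
    have h3 := pow_dvd_of_sum_eq_zero s ((c l).natDegree + 1) c h2 l hl
    have h4 := Polynomial.natDegree_le_of_dvd h3 hc
    rw [Polynomial.natDegree_pow, Polynomial.natDegree_X_sub_C] at h4
    omega
  have h5 : (fun l : {l : Fin k → ℕ // Antitone l} => clearedHL t l.1) =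
      ((LinearMap.mulRight Coef (allDiffs k Coef)).comp
        (symmetricSubalgebra (Fin k) Coef).val.toLinearMap) ∘ fun l => hallLittlewood l.1 :=
    funext fun l => algebraMap_clearedHL l.1
  rw [h5] at h1
  exact LinearIndependent.of_comp _ h1

end Independence

/-! ### The basis of the quotient -/

section Basis

variable {k : ℕ}

theorem hallLittlewoodTrunc_eq_zero {n : ℕ} {l : Fin k → ℕ} (hl : Antitone l)
    (hn : ¬ ∀ i, l i < n) : hallLittlewoodTrunc n l = 0 :=
  Ideal.Quotient.eq_zero_iff_mem.2 (Ideal.subset_span ⟨l, hl, hn, rfl⟩)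

/-- The ideal is spanned by the Hall--Littlewood polynomials that generate it. -/
theorem truncIdeal_le_span (hk : 1 ≤ k) (n : ℕ) (f : MvPolynomial.symmetricSubalgebra (Fin k) Coef)
    (hf : f ∈ truncIdeal k n) :
    f ∈ Submodule.span Coef (hallLittlewood '' {l : Fin k → ℕ | Antitone l ∧ ¬ ∀ i, l i < n}) := by
  induction hf using Submodule.span_induction with
  | mem x hx =>
    obtain ⟨l, hl, hn, rfl⟩ := hx
    exact Submodule.subset_span ⟨l, ⟨hl, hn⟩, rfl⟩
  | zero => exact zero_mem _
  | add x y _ _ hx hy => exact add_mem hx hy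
  | smul c x _ hx =>
    exact mul_mem_span_hallLittlewood hk {l | Antitone l ∧ ¬ ∀ i, l i < n} (fun l h => h.1)
      (fun l h ν hν hle => ⟨hν, fun h' => h.2 fun i => (hle i).trans_lt (h' i)⟩) c x hx

theorem exists_basis (hk : 1 ≤ k) (n : ℕ) :
    ∃ b : Module.Basis (BoxPartition k n) Coef (TruncSym k n),
      ∀ l, b l = hallLittlewoodTrunc n l.1 := by
  let v : {l : Fin k → ℕ // Antitone l} → MvPolynomial.symmetricSubalgebra (Fin k) Coef :=
    fun l => hallLittlewood l.1
  let π : MvPolynomial.symmetricSubalgebra (Fin k) Coef →ₗ[Coef] TruncSym k n :=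
    (Ideal.Quotient.mkₐ Coef (truncIdeal k n)).toLinearMap
  let inc : BoxPartition k n → {l : Fin k → ℕ // Antitone l} := fun l => ⟨l.1, l.2.1⟩
  have hinc : Function.Injective inc := fun l l' h => by
    have h' : (inc l).1 = (inc l').1 := by rw [h]
    exact Subtype.ext h'
  have hv : LinearIndependent Coef v := linearIndependent_hallLittlewood
  have hker : ∀ f, f ∈ LinearMap.ker π → f ∈ Submodule.span Coef
      (v '' {l | ¬ ∀ i, l.1 i < n}) := by
    intro f hf
    rw [LinearMap.mem_ker] at hf
    have hf' : f ∈ truncIdeal k n := Ideal.Quotient.eq_zero_iff_mem.1 hf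
    have := truncIdeal_le_span hk n f hf'
    refine Submodule.span_mono ?_ this
    rintro _ ⟨l, ⟨hl, hn⟩, rfl⟩
    exact ⟨⟨l, hl⟩, hn, rfl⟩
  have hind : LinearIndependent Coef (π ∘ (v ∘ inc)) := by
    refine (hv.comp inc hinc).map ?_
    have hd : Disjoint (Set.range inc) {l | ¬ ∀ i, l.1 i < n} := by
      rw [Set.disjoint_left]
      rintro _ ⟨l, rfl⟩ h
      exact h l.2.2
    have := hv.disjoint_span_image hd
    rw [← Set.range_comp] at this
    exact this.mono_right hker
  have hspan : ⊤ ≤ Submodule.span Coef (Set.range (π ∘ (v ∘ inc))) := by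
    rintro y -
    obtain ⟨f, rfl⟩ := Ideal.Quotient.mk_surjective y
    have hf : f ∈ Submodule.span Coef (hallLittlewood '' {l : Fin k → ℕ | Antitone l}) :=
      span_hallLittlewood hk ▸ Submodule.mem_top
    have hf' : π f ∈ Submodule.map π (Submodule.span Coef
      (hallLittlewood '' {l : Fin k → ℕ | Antitone l})) := ⟨f, hf, rfl⟩
    rw [Submodule.map_span] at hf'
    refine Submodule.span_le.2 ?_ hf'
    rintro _ ⟨_, ⟨l, hl, rfl⟩, rfl⟩
    by_cases hn : ∀ i, l i < n
    · exact Submodule.subset_span ⟨⟨l, hl, hn⟩, rfl⟩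
    · have : π (hallLittlewood l) = 0 := hallLittlewoodTrunc_eq_zero hl hn
      rw [this]
      exact zero_mem _
  refine ⟨Module.Basis.mk hind hspan, fun l => ?_⟩
  rw [Module.Basis.mk_apply]
  rfl

/-- The Pieri rule in the quotient. -/
theorem hallLittlewoodTrunc_mul_row {n r : ℕ} (hk : 1 ≤ k) (hr : 0 < r) (l : BoxPartition k n) :
    hallLittlewoodTrunc n l.1 * hallLittlewoodTrunc n (row k r) =
      ∑ ν ∈ strips n l.1 r, pieriCoeff l.1 ν.1 • hallLittlewoodTrunc n ν.1 := by
  have h := hallLittlewood_mul_row l.2.1 hk hr l.2.2 le_rfl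
  have h' := congrArg (Ideal.Quotient.mkₐ Coef (truncIdeal k n)) h
  rw [map_mul, map_sum] at h'
  simp only [map_smul] at h'
  refine Eq.trans h' (Eq.symm ?_)
  let inc : BoxPartition k n → BoxPartition k (n + r) := fun ν =>
    ⟨ν.1, ν.2.1, fun i => (ν.2.2 i).trans_le (Nat.le_add_right n r)⟩
  refine sum_of_injOn inc ?_ ?_ ?_ ?_
  · intro ν _ ν' _ h
    have h' : (inc ν).1 = (inc ν').1 := by rw [h]
    exact Subtype.ext h'
  · intro ν hν
    have hν : IsHorizontalStrip l.1 ν.1 r := mem_strips.1 (mem_coe.1 hν)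
    exact mem_coe.2 (mem_strips.2 hν)
  · intro ν hν hν'
    have hν : IsHorizontalStrip l.1 ν.1 r := mem_strips.1 hν
    have : hallLittlewoodTrunc n ν.1 = 0 := hallLittlewoodTrunc_eq_zero ν.2.1 fun hn =>
      hν' ⟨⟨ν.1, ν.2.1, hn⟩, mem_coe.2 (mem_strips.2 hν), rfl⟩
    exact (congrArg _ this).trans (smul_zero _)
  · intro ν _
    rfl

end Basis

/-! ### The honeycomb of a horizontal strip -/

section Counting

variable {k : ℕ}

/-- A set of columns as a set of integers. -/
def zcols (C : Finset ℕ) : Finset ℤ := C.map Nat.castEmbedding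

/-- The number of columns of `C` that are at most `z`. -/
def cnt (C : Finset ℕ) (z : ℤ) : ℕ := ((zcols C).filter fun c => c ≤ z).card

/-- The number of parts equal to the integer `z`. -/
def zmult (l : Fin k → ℕ) (z : ℤ) : ℕ := (univ.filter fun p => (l p : ℤ) = z).card

/-- The number of parts that are at most `z`. -/
def zcum (l : Fin k → ℕ) (z : ℤ) : ℕ := (univ.filter fun p => (l p : ℤ) ≤ z).card

theorem natCast_mem_zcols {C : Finset ℕ} {c : ℕ} : (c : ℤ) ∈ zcols C ↔ c ∈ C := by
  simp [zcols]

theorem mem_zcols {C : Finset ℕ} {z : ℤ} : z ∈ zcols C ↔ ∃ c ∈ C, (c : ℤ) = z := by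
  simp [zcols]

theorem cnt_eq (C : Finset ℕ) (z : ℤ) :
    cnt C z = cnt C (z - 1) + if z ∈ zcols C then 1 else 0 := by
  split_ifs with h
  · have : (zcols C).filter (fun c => c ≤ z) =
        insert z ((zcols C).filter fun c => c ≤ z - 1) := by
      ext c
      simp only [mem_filter, mem_insert]
      constructor
      · rintro ⟨h1, h2⟩
        rcases eq_or_lt_of_le h2 with rfl | h3
        · exact Or.inl rfl
        · exact Or.inr ⟨h1, by omega⟩
      · rintro (rfl | ⟨h1, h2⟩)
        · exact ⟨h, le_rfl⟩
        · exact ⟨h1, by omega⟩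
    rw [cnt, this, card_insert_of_notMem (by simp), cnt]
  · rw [add_zero, cnt, cnt]
    congr 1
    ext c
    simp only [mem_filter]
    refine and_congr_right fun hc => ?_
    have : c ≠ z := fun h' => h (h' ▸ hc)
    omega

theorem cnt_succ (C : Finset ℕ) (z : ℤ) :
    cnt C (z + 1) = cnt C z + if z + 1 ∈ zcols C then 1 else 0 := by
  have := cnt_eq C (z + 1)
  rwa [add_sub_cancel_right] at this

theorem cnt_eq_zero_of_nonpos {C : Finset ℕ} (h0 : 0 ∉ C) {z : ℤ} (hz : z ≤ 0) : cnt C z = 0 := by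
  rw [cnt, card_eq_zero, filter_eq_empty_iff]
  intro c hc hcz
  obtain ⟨d, hd, rfl⟩ := mem_zcols.1 hc
  have : d = 0 := by omega
  exact h0 (this ▸ hd)

theorem cnt_le {C : Finset ℕ} (h0 : 0 ∉ C) {z : ℤ} (hz : 0 ≤ z) : (cnt C z : ℤ) ≤ z := by
  have : (zcols C).filter (fun c => c ≤ z) ⊆ Icc 1 z := by
    intro c hc
    obtain ⟨hc, hcz⟩ := mem_filter.1 hc
    obtain ⟨d, hd, rfl⟩ := mem_zcols.1 hc
    have : d ≠ 0 := fun h => h0 (h ▸ hd)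
    exact mem_Icc.2 ⟨by omega, hcz⟩
  have := card_le_card this
  rw [Int.card_Icc] at this
  unfold cnt
  omega

theorem cnt_eq_card {C : Finset ℕ} {z : ℤ} (h : ∀ c ∈ C, (c : ℤ) ≤ z) : cnt C z = C.card := by
  rw [cnt, filter_true_of_mem, zcols, card_map]
  intro c hc
  obtain ⟨d, hd, rfl⟩ := mem_zcols.1 hc
  exact h d hd

theorem zmult_natCast (l : Fin k → ℕ) (s : ℕ) : zmult l s = partMult l s := by
  simp [zmult, partMult]

theorem zmult_of_neg (l : Fin k → ℕ) {z : ℤ} (hz : z < 0) : zmult l z = 0 := by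
  rw [zmult, card_eq_zero, filter_eq_empty_iff]
  intro p _
  omega

theorem zmult_of_le {l : Fin k → ℕ} {n : ℕ} (hl : ∀ p, l p < n) {z : ℤ} (hz : n ≤ z) :
    zmult l z = 0 := by
  rw [zmult, card_eq_zero, filter_eq_empty_iff]
  intro p _
  have := hl p
  omega

theorem zcum_of_neg (l : Fin k → ℕ) {z : ℤ} (hz : z < 0) : zcum l z = 0 := by
  rw [zcum, card_eq_zero, filter_eq_empty_iff]
  intro p _
  omega

theorem zcum_eq (l : Fin k → ℕ) (z : ℤ) : zcum l z = zcum l (z - 1) + zmult l z := by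
  rw [zcum, zcum, zmult, ← card_union_of_disjoint]
  · congr 1
    ext p
    simp only [mem_union, mem_filter, mem_univ, true_and]
    omega
  · rw [disjoint_filter]
    intro p _ h
    omega

theorem zcum_of_le {l : Fin k → ℕ} {n : ℕ} (hl : ∀ p, l p < n) {z : ℤ} (hz : (n : ℤ) - 1 ≤ z) :
    zcum l z = k := by
  rw [zcum, filter_true_of_mem, card_univ, Fintype.card_fin]
  intro p _
  have := hl p
  omega

end Counting

/-- The partitions `l`, `ν` in the box and the columns `C` of a horizontal strip `ν / l`. -/
structure StripData {k : ℕ} (n : ℕ) (l ν : Fin k → ℕ) (C : Finset ℕ) : Prop where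
  lt_left : ∀ p, l p < n
  lt_right : ∀ p, ν p < n
  adds : AddsColumns l ν C

namespace StripData

variable {k n : ℕ} {l ν : Fin k → ℕ} {C : Finset ℕ}

theorem zmult_add (h : StripData n l ν C) (z : ℤ) :
    zmult ν z + (if z + 1 ∈ zcols C then 1 else 0) =
      zmult l z + if z ∈ zcols C then 1 else 0 := by
  rcases lt_or_ge z 0 with hz | hz
  · have h1 : z ∉ zcols C := fun h' => by
      obtain ⟨d, -, rfl⟩ := mem_zcols.1 h'
      omega
    have h2 : z + 1 ∉ zcols C := fun h' => by
      obtain ⟨d, hd, hd'⟩ := mem_zcols.1 h'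
      have : d = 0 := by omega
      exact h.adds.zero_notMem (this ▸ hd)
    simp [zmult_of_neg _ hz, h1, h2]
  · lift z to ℕ using hz
    have := h.adds.partMult_add z
    simpa only [zmult_natCast, ← Nat.cast_succ, natCast_mem_zcols, chi] using this

theorem lt_of_mem (h : StripData n l ν C) {z : ℤ} (hz : z ∈ zcols C) : 0 < z ∧ z < n := by
  obtain ⟨d, hd, rfl⟩ := mem_zcols.1 hz
  have h1 := h.adds.lt_of_mem h.lt_right hd
  have h2 : d ≠ 0 := fun h' => h.adds.zero_notMem (h' ▸ hd)
  omega

/-- The lowest box of the strip that lies in the columns up to `z + 1` rests on a part of `l`. -/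
theorem one_le_zcum (h : StripData n l ν C) {z : ℤ} (hz : 1 ≤ cnt C (z + 1)) : 1 ≤ zcum l z := by
  have hz' : 0 < cnt C (z + 1) := hz
  rw [cnt, card_pos] at hz'
  obtain ⟨c, hc⟩ := hz'
  obtain ⟨hc, hcz⟩ := mem_filter.1 hc
  obtain ⟨d, hd, rfl⟩ := mem_zcols.1 hc
  have h1 := h.adds d
  rw [chi, if_pos hd] at h1
  have h2 := colLen_le ν d
  have h3 : colLen l d < k := by omega
  rw [Nat.one_le_iff_ne_zero, zcum, card_ne_zero]
  by_contra hempty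
  rw [not_nonempty_iff_eq_empty, filter_eq_empty_iff] at hempty
  have : colLen l d = k := by
    rw [colLen, filter_true_of_mem, card_univ, Fintype.card_fin]
    intro p _
    have := @hempty p (mem_univ p)
    omega
  omega

end StripData

/-- The edge multiplicities of the honeycomb of a horizontal strip. A single path of multiplicity
one enters from the North-West side and winds through the triangle; in the vertical strip number
`x ≥ 1` it uses the horizontal edge in the diagonal `x + y = c`, where `c` is the `x`-th column in
`C`. The multiplicities in the other two directions follow from the balance condition. -/
def stripEdges {k : ℕ} (l : Fin k → ℕ) (C : Finset ℕ) : EdgeMult where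
  W v := if v.1 ≤ 0 then zmult l v.2
    else if v.1 + v.2 ∈ zcols C ∧ (cnt C (v.1 + v.2) : ℤ) = v.1 then 1 else 0
  NE v := if v.1 < 0 then 0
    else if v.1 = 0 then zcum l v.2 - (if 1 ≤ cnt C (v.2 + 1) then 1 else 0)
    else if v.1 ≤ cnt C (v.1 + v.2) ∧ (cnt C (v.1 + v.2 + 1) : ℤ) ≤ v.1 then 1 else 0
  SE v := if v.1 < 0 then 0
    else zmult l (v.1 + v.2) +
      (if v.1 + v.2 ∈ zcols C ∧ (cnt C (v.1 + v.2) : ℤ) ≤ v.1 then 1 else 0) -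
      (if v.1 + v.2 + 1 ∈ zcols C ∧ (cnt C (v.1 + v.2 + 1) : ℤ) ≤ v.1 + 1 then 1 else 0)

namespace EdgeMult

variable (H : EdgeMult) (x y : ℤ)

theorem E_mk : H.E (x, y) = H.W (x + 1, y) := by
  simp [E, dirW]

theorem SW_mk : H.SW (x, y) = H.NE (x, y - 1) := by
  simp [SW, dirNE]

theorem NW_mk : H.NW (x, y) = H.SE (x - 1, y + 1) := by
  simp [NW, dirSE]

end EdgeMult

section StripEdges

variable {k n : ℕ} {l ν : Fin k → ℕ} {C : Finset ℕ}

theorem stripEdges_W_nonpos {x : ℤ} (hx : x ≤ 0) (y : ℤ) :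
    (stripEdges l C).W (x, y) = zmult l y := by simp [stripEdges, hx]

theorem stripEdges_W_pos {x : ℤ} (hx : 0 < x) (y : ℤ) :
    (stripEdges l C).W (x, y) =
      if x + y ∈ zcols C ∧ (cnt C (x + y) : ℤ) = x then 1 else 0 := by
  simp [stripEdges, not_le.2 hx]

theorem stripEdges_NE_neg {x : ℤ} (hx : x < 0) (y : ℤ) : (stripEdges l C).NE (x, y) = 0 := by
  simp [stripEdges, hx]

theorem stripEdges_NE_zero (y : ℤ) : (stripEdges l C).NE (0, y) =
    zcum l y - (if 1 ≤ cnt C (y + 1) then 1 else 0) := by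
  simp [stripEdges]

theorem stripEdges_NE_pos {x : ℤ} (hx : 0 < x) (y : ℤ) :
    (stripEdges l C).NE (x, y) =
      if x ≤ cnt C (x + y) ∧ (cnt C (x + y + 1) : ℤ) ≤ x then 1 else 0 := by
  simp [stripEdges, not_lt.2 hx.le, hx.ne']

theorem stripEdges_SE_neg {x : ℤ} (hx : x < 0) (y : ℤ) : (stripEdges l C).SE (x, y) = 0 := by
  simp [stripEdges, hx]

theorem stripEdges_SE_nonneg {x : ℤ} (hx : 0 ≤ x) (y : ℤ) : (stripEdges l C).SE (x, y) =
    zmult l (x + y) + (if x + y ∈ zcols C ∧ (cnt C (x + y) : ℤ) ≤ x then 1 else 0) -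
      (if x + y + 1 ∈ zcols C ∧ (cnt C (x + y + 1) : ℤ) ≤ x + 1 then 1 else 0) := by
  simp [stripEdges, not_lt.2 hx]

theorem StripData.balanced (h : StripData n l ν C) (v : Lattice) :
    (stripEdges l C).Balanced v := by
  obtain ⟨x, y⟩ := v
  rw [EdgeMult.Balanced, EdgeMult.E_mk, EdgeMult.SW_mk, EdgeMult.NW_mk]
  have hz := h.zmult_add (x + y)
  have c1 := cnt_succ C (x + y)
  have c0 := cnt_eq C (x + y)
  have hm1 : x - 1 + (y + 1) = x + y := by ring
  have hm2 : x + 1 + y = x + y + 1 := by ring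
  have hm3 : x + (y - 1) = x + y - 1 := by ring
  rcases lt_trichotomy x 0 with hx | rfl | hx
  · rw [stripEdges_W_nonpos hx.le, stripEdges_W_nonpos (by omega), stripEdges_SE_neg hx,
      stripEdges_SE_neg (by omega), stripEdges_NE_neg hx, stripEdges_NE_neg hx]
    simp
  · have hcum := zcum_eq l y
    have h1 := h.one_le_zcum (z := y)
    have h2 := h.one_le_zcum (z := y - 1)
    rw [stripEdges_W_nonpos le_rfl, stripEdges_W_pos (by omega), stripEdges_SE_nonneg le_rfl,
      stripEdges_SE_neg (by omega), stripEdges_NE_zero, stripEdges_NE_zero, hm2]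
    simp only [zero_add, sub_add_cancel] at *
    by_cases m0 : y ∈ zcols C <;> by_cases m1 : y + 1 ∈ zcols C <;>
      simp only [m0, m1, if_true, if_false, true_and, false_and] at * <;> grind
  · rw [stripEdges_W_pos hx, stripEdges_W_pos (by omega), stripEdges_SE_nonneg hx.le,
      stripEdges_SE_nonneg (by omega), stripEdges_NE_pos hx, stripEdges_NE_pos hx, hm1, hm2, hm3,
      sub_add_cancel, sub_add_cancel]
    by_cases m0 : x + y ∈ zcols C <;> by_cases m1 : x + y + 1 ∈ zcols C <;>
      simp only [m0, m1, if_true, if_false, true_and, false_and] at * <;> grind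

end StripEdges

theorem finite_triangle (n : ℕ) : (triangle n).Finite := by
  refine Set.Finite.subset (Set.finite_Icc ((0, 0) : ℤ × ℤ) (n, n)) ?_
  rintro ⟨x, y⟩ ⟨h1, h2, h3⟩
  simp only at h1 h2 h3
  exact Set.mem_Icc.2 ⟨Prod.mk_le_mk.2 ⟨h1, h2⟩, Prod.mk_le_mk.2 ⟨by omega, by omega⟩⟩

section StripHoneycomb

variable {k n : ℕ} {l ν : Fin k → ℕ} {C : Finset ℕ}

theorem StripData.mem_triangle (h : StripData n l ν C) (v : Lattice)
    (hv : (stripEdges l C).IsVertex v) : v ∈ triangle n := by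
  by_contra hT
  obtain ⟨x, y⟩ := v
  apply hv
  obtain ⟨b1, b2⟩ := h.balanced (x, y)
  rw [EdgeMult.E_mk, EdgeMult.SW_mk, EdgeMult.NW_mk] at *
  have h0 := h.adds.zero_notMem
  simp only [triangle, Set.mem_ofPred_eq, not_and_or, not_le] at hT
  rcases lt_or_ge x 0 with hx | hx
  · left
    rw [stripEdges_W_nonpos hx.le, stripEdges_W_nonpos (by omega), stripEdges_SE_neg hx,
      stripEdges_SE_neg (by omega), stripEdges_NE_neg hx, stripEdges_NE_neg hx]
    simp
  · have hm : ∀ z, z ∈ zcols C → 0 < z ∧ z < n := fun z => h.lt_of_mem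
    have e1 : (stripEdges l C).W (x + 1, y) = 0 := by
      rw [stripEdges_W_pos (by omega), if_neg]
      rintro ⟨m1, m2⟩
      have m1 := hm _ m1
      have := cnt_le h0 m1.1.le
      omega
    have e2 : (stripEdges l C).W (x, y) = 0 := by
      rcases hx.eq_or_lt with rfl | hx
      · rw [stripEdges_W_nonpos le_rfl]
        rcases lt_or_ge y 0 with hy | hy
        · exact zmult_of_neg _ hy
        · exact zmult_of_le h.lt_left (by omega)
      · rw [stripEdges_W_pos hx, if_neg]
        rintro ⟨m1, m2⟩
        have m1 := hm _ m1
        have := cnt_le h0 m1.1.le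
        omega
    rw [e1, e2] at b1 ⊢
    rcases lt_or_ge y 0 with hy | hy
    · right; left
      have e3 : (stripEdges l C).NE (x, y) = 0 := by
        rcases hx.eq_or_lt with rfl | hx
        · rw [stripEdges_NE_zero, zcum_of_neg _ hy]
          simp
        · rw [stripEdges_NE_pos hx, if_neg]
          rintro ⟨m1, m2⟩
          rcases lt_or_ge (x + y) 0 with hs | hs
          · rw [cnt_eq_zero_of_nonpos h0 hs.le] at m1
            omega
          · have := cnt_le h0 hs
            omega
      omega
    · right; right
      have e3 : (stripEdges l C).SE (x, y) = 0 := by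
        have m0 : x + y ∉ zcols C := fun m => by
          have := hm _ m
          omega
        rw [stripEdges_SE_nonneg hx, zmult_of_le h.lt_left (by omega), if_neg fun m => m0 m.1]
        simp
      omega

theorem StripData.noRayE (h : StripData n l ν C) (v : Lattice) :
    ∃ s : ℕ, (stripEdges l C).W (v - s • dirW) = 0 := by
  obtain ⟨x, y⟩ := v
  refine ⟨n + x.natAbs + y.natAbs + 1, ?_⟩
  have e : ((x, y) : Lattice) - (n + x.natAbs + y.natAbs + 1) • dirW =
      (x + (n + x.natAbs + y.natAbs + 1), y) := by
    simp [dirW]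
    ring
  rw [e, stripEdges_W_pos (by omega), if_neg]
  rintro ⟨m1, m2⟩
  have := (h.lt_of_mem m1).2
  omega

theorem stripEdges_noRayNW (v : Lattice) : ∃ s : ℕ, (stripEdges l C).SE (v - s • dirSE) = 0 := by
  obtain ⟨x, y⟩ := v
  refine ⟨x.natAbs + 1, ?_⟩
  have e : ((x, y) : Lattice) - (x.natAbs + 1) • dirSE =
      (x - (x.natAbs + 1), y + (x.natAbs + 1)) := by
    simp [dirSE]
    ring
  rw [e, stripEdges_SE_neg (by omega)]

theorem StripData.noRaySW (h : StripData n l ν C) (v : Lattice) :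
    ∃ s : ℕ, (stripEdges l C).NE (v - s • dirNE) = 0 := by
  obtain ⟨x, y⟩ := v
  refine ⟨x.natAbs + y.natAbs + 1, ?_⟩
  have e : ((x, y) : Lattice) - (x.natAbs + y.natAbs + 1) • dirNE =
      (x, y - (x.natAbs + y.natAbs + 1)) := by
    simp [dirNE]
  rw [e]
  rcases lt_trichotomy x 0 with hx | rfl | hx
  · rw [stripEdges_NE_neg hx]
  · rw [stripEdges_NE_zero, zcum_of_neg _ (by omega)]
    simp
  · rw [stripEdges_NE_pos hx, if_neg]
    rintro ⟨m1, m2⟩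
    rw [cnt_eq_zero_of_nonpos h.adds.zero_notMem (by omega)] at m1
    omega

/-- The honeycomb of a horizontal strip. -/
def stripHoneycomb (h : StripData n l ν C) : Honeycomb where
  toEdgeMult := stripEdges l C
  balanced := h.balanced
  finite_vertices := (finite_triangle n).subset h.mem_triangle
  noRayE := h.noRayE
  noRayNW := stripEdges_noRayNW
  noRaySW := h.noRaySW

theorem partMult_row {r s : ℕ} (hk : 1 ≤ k) (hr : 0 < r) :
    partMult (row k r) s = if s = 0 then k - 1 else if s = r then 1 else 0 := by
  obtain ⟨k, rfl⟩ : ∃ j, k = j + 1 := ⟨k - 1, by omega⟩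
  have h0 : ∀ i : Fin (k + 1), row (k + 1) r i = if i = 0 then r else 0 := fun i =>
    if_congr (by rw [Fin.ext_iff, Fin.val_zero]) rfl rfl
  simp only [partMult, h0]
  split_ifs with h1 h2
  · subst h1
    have : univ.filter (fun i : Fin (k + 1) => (if i = 0 then r else 0) = 0) = univ.erase 0 := by
      ext i
      simp only [mem_filter, mem_univ, true_and, mem_erase, and_true]
      split_ifs with hi
      · simp [hi]; omega
      · simp [hi]
    rw [this, card_erase_of_mem (mem_univ _)]
    simp
  · subst h2
    have : univ.filter (fun i : Fin (k + 1) => (if i = 0 then s else 0) = s) = {0} := by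
      ext i
      simp only [mem_filter, mem_univ, true_and, mem_singleton]
      split_ifs with hi
      · simp [hi]
      · simp [hi]; omega
    rw [this, card_singleton]
  · rw [card_eq_zero, filter_eq_empty_iff]
    intro i _
    split_ifs
    · exact fun h => h2 h.symm
    · exact fun h => h1 h.symm

theorem stripHoneycomb_hasBoundaries (h : StripData n l ν C) (hk : 1 ≤ k) (hC : 0 < C.card) :
    (stripHoneycomb h).HasBoundaries n l (row k C.card) ν := by
  refine ⟨h.mem_triangle, fun r hr => ?_⟩
  have hall : ∀ z : ℤ, (n : ℤ) - 1 ≤ z → cnt C z = C.card := fun z hz =>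
    cnt_eq_card fun c hc => by
      have := h.lt_of_mem (natCast_mem_zcols.2 hc)
      omega
  have h0 := h.adds.zero_notMem
  change (stripEdges l C).W _ = _ ∧ (stripEdges l C).NE _ = _ ∧ (stripEdges l C).SE _ = _
  refine ⟨?_, ?_, ?_⟩
  · rw [stripEdges_W_nonpos le_rfl, zmult_natCast]
  · rw [partMult_row hk hC]
    rcases Nat.eq_zero_or_pos r with rfl | hr0
    · rw [Nat.cast_zero, stripEdges_NE_zero, zcum_of_le h.lt_left (by omega), hall _ (by omega)]
      have : 1 ≤ C.card := hC
      simp [this]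
    · rw [stripEdges_NE_pos (by omega), hall _ (by omega), hall _ (by omega), if_neg hr0.ne']
      refine if_congr ?_ rfl rfl
      omega
  · have hz := h.zmult_add r
    have c1 := cnt_succ C r
    have hle := cnt_le h0 (Int.natCast_nonneg r)
    have hle' := cnt_le h0 (z := (r : ℤ) + 1) (by omega)
    rw [stripEdges_SE_nonneg (Int.natCast_nonneg r), ← zmult_natCast, add_zero]
    simp only [hle, hle', and_true]
    omega

/-! ### Fugacities -/

/-- A vertex without edges to the North-East. -/
theorem fug_zero_NE (j j' i' : ℕ) : fug j 0 j' i' = alpha j / alpha i' := by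
  simp [fug, alpha]

theorem alpha_ne_zero (i : ℕ) : alpha i ≠ 0 :=
  prod_ne_zero_iff.2 fun _ hr => t_pow_ne_one (by have := mem_Icc.1 hr; omega)

theorem alpha_succ (i : ℕ) : alpha (i + 1) = alpha i * (1 - t ^ (i + 1)) :=
  prod_Icc_succ_top (by omega) _

/-- A vertex without edges to the West. -/
theorem fug_zero_W (j i j' : ℕ) : fug j i j' 0 = alpha (i + j) / alpha i := by
  simp [fug, alpha]

/-- Telescoping for `∑_r (-1)^r t^(r(r+1)/2) / (α_r α_(m-r)) = 1`. -/
theorem sum_alpha_eq_one (m : ℕ) :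
    ∑ p ∈ antidiagonal m, (-1) ^ p.1 * t ^ (p.1 * (p.1 + 1) / 2) / (alpha p.1 * alpha p.2) = 1 := by
  induction m with
  | zero => simp [alpha]
  | succ m ih =>
    apply mul_left_cancel₀ (t_pow_ne_one (Nat.succ_ne_zero m))
    have e : ∀ p ∈ antidiagonal (m + 1), (1 - t ^ (m + 1)) *
        ((-1) ^ p.1 * t ^ (p.1 * (p.1 + 1) / 2) / (alpha p.1 * alpha p.2)) =
        (-1) ^ p.1 * t ^ (p.1 * (p.1 + 1) / 2) / (alpha p.1 * alpha p.2) * (1 - t ^ p.2) +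
        t ^ p.2 * ((-1) ^ p.1 * t ^ (p.1 * (p.1 + 1) / 2) / (alpha p.1 * alpha p.2)) *
          (1 - t ^ p.1) := by
      intro p hp
      rw [← mem_antidiagonal.1 hp, pow_add]
      ring
    rw [mul_sum, sum_congr rfl e, sum_add_distrib, Nat.sum_antidiagonal_succ',
      Nat.sum_antidiagonal_succ]
    have e1 : ∀ p ∈ antidiagonal m, (-1) ^ p.1 * t ^ (p.1 * (p.1 + 1) / 2) /
        (alpha p.1 * alpha (p.2 + 1)) * (1 - t ^ (p.2 + 1)) =
        (-1) ^ p.1 * t ^ (p.1 * (p.1 + 1) / 2) / (alpha p.1 * alpha p.2) := by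
      intro p _
      have := t_pow_ne_one (Nat.succ_ne_zero p.2)
      have := alpha_ne_zero p.1
      have := alpha_ne_zero p.2
      rw [alpha_succ]
      field_simp
    have e2 : ∀ p ∈ antidiagonal m, t ^ p.2 * ((-1) ^ (p.1 + 1) *
        t ^ ((p.1 + 1) * (p.1 + 1 + 1) / 2) / (alpha (p.1 + 1) * alpha p.2)) *
          (1 - t ^ (p.1 + 1)) = -t ^ (m + 1) *
        ((-1) ^ p.1 * t ^ (p.1 * (p.1 + 1) / 2) / (alpha p.1 * alpha p.2)) := by
      intro p hp
      have := t_pow_ne_one (Nat.succ_ne_zero p.1)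
      have := alpha_ne_zero p.1
      have := alpha_ne_zero p.2
      have h1 : (p.1 + 1) * (p.1 + 1 + 1) / 2 = p.1 * (p.1 + 1) / 2 + (p.1 + 1) := by
        rw [show (p.1 + 1) * (p.1 + 1 + 1) = p.1 * (p.1 + 1) + (p.1 + 1) * 2 by ring,
          Nat.add_mul_div_right _ _ two_pos]
      rw [alpha_succ, h1, ← mem_antidiagonal.1 hp]
      field_simp
      ring
    rw [sum_congr rfl e1, sum_congr rfl e2, ih, ← mul_sum, ih]
    simp
    ring

/-- `∑_r (-1)^r t^(r(r-1)/2) / (α_r α_(m-r)) = 0` for `m > 0`. -/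
theorem sum_alpha_eq_zero (m : ℕ) :
    ∑ p ∈ antidiagonal (m + 1), (-1) ^ p.1 * t ^ (p.1 * (p.1 - 1) / 2) / (alpha p.1 * alpha p.2)
      = 0 := by
  apply mul_left_cancel₀ (t_pow_ne_one (Nat.succ_ne_zero m))
  have e : ∀ p ∈ antidiagonal (m + 1), (1 - t ^ (m + 1)) *
      ((-1) ^ p.1 * t ^ (p.1 * (p.1 - 1) / 2) / (alpha p.1 * alpha p.2)) =
      t ^ p.1 * ((-1) ^ p.1 * t ^ (p.1 * (p.1 - 1) / 2) / (alpha p.1 * alpha p.2)) *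
        (1 - t ^ p.2) +
      (-1) ^ p.1 * t ^ (p.1 * (p.1 - 1) / 2) / (alpha p.1 * alpha p.2) * (1 - t ^ p.1) := by
    intro p hp
    rw [← mem_antidiagonal.1 hp, pow_add]
    ring
  rw [mul_sum, sum_congr rfl e, sum_add_distrib, Nat.sum_antidiagonal_succ',
    Nat.sum_antidiagonal_succ]
  have e1 : ∀ p ∈ antidiagonal m, t ^ p.1 * ((-1) ^ p.1 * t ^ (p.1 * (p.1 - 1) / 2) /
      (alpha p.1 * alpha (p.2 + 1))) * (1 - t ^ (p.2 + 1)) =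
      (-1) ^ p.1 * t ^ (p.1 * (p.1 + 1) / 2) / (alpha p.1 * alpha p.2) := by
    intro p _
    have h2 : 1 - t ^ (p.2 + 1) ≠ 0 := t_pow_ne_one (Nat.succ_ne_zero p.2)
    have := alpha_ne_zero p.1
    have := alpha_ne_zero p.2
    have h1 : p.1 * (p.1 + 1) / 2 = p.1 * (p.1 - 1) / 2 + p.1 := by
      rw [show p.1 * (p.1 + 1) = p.1 * (p.1 - 1) + p.1 * 2 by
        rcases p.1 with _ | q
        · rfl
        · simp only [Nat.add_sub_cancel]; ring, Nat.add_mul_div_right _ _ two_pos]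
    rw [alpha_succ, h1, pow_add t (p.1 * (p.1 - 1) / 2) p.1]
    generalize 1 - t ^ (p.2 + 1) = z at h2 ⊢
    field_simp
  have e2 : ∀ p ∈ antidiagonal m, (-1) ^ (p.1 + 1) * t ^ ((p.1 + 1) * (p.1 + 1 - 1) / 2) /
      (alpha (p.1 + 1) * alpha p.2) * (1 - t ^ (p.1 + 1)) =
      -((-1) ^ p.1 * t ^ (p.1 * (p.1 + 1) / 2) / (alpha p.1 * alpha p.2)) := by
    intro p hp
    have := t_pow_ne_one (Nat.succ_ne_zero p.1)
    have := alpha_ne_zero p.1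
    have := alpha_ne_zero p.2
    rw [alpha_succ, Nat.add_sub_cancel, mul_comm (p.1 + 1) p.1]
    field_simp
    ring
  rw [sum_congr rfl e1, sum_congr rfl e2, sum_neg_distrib]
  simp

/-- A vertex on the North-West side that the path does not pass. -/
theorem fug_E_zero {i i' : ℕ} (h : i' ≤ i) : fug 0 i 0 i' = 1 := by
  rw [fug, min_eq_right h]
  refine Eq.trans ?_ (sum_alpha_eq_one i')
  rw [Nat.sum_antidiagonal_eq_sum_range_succ_mk]
  refine sum_congr rfl fun r _ => ?_
  have := alpha_ne_zero (i - r)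
  have := alpha_ne_zero r
  have := alpha_ne_zero (i' - r)
  simp only [zero_mul, zero_add, add_zero]
  field_simp

/-- The vertex at which the path leaves the North-West side. -/
theorem fug_E_one {i i' : ℕ} (h : i' ≤ i) : fug 1 i 0 (i' + 1) = 1 := by
  have e : fug 1 i 0 (i' + 1) = ∑ r ∈ range (i' + 1 + 1), (-1) ^ r * t ^ (r * (r + 1) / 2) *
      (1 - t ^ (i + 1 - r)) / (alpha r * alpha (i' + 1 - r)) := by
    rw [fug]
    have hle : min i (i' + 1) + 1 ≤ i' + 1 + 1 := by omega
    -- For `i = i'` the added term with `r = i' + 1` contains the factor `1 - t ^ 0`.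
    rw [← sum_subset (range_mono hle)]
    · refine sum_congr rfl fun r hr => ?_
      have hr := mem_range.1 hr
      have := alpha_ne_zero (i - r)
      have := alpha_ne_zero r
      have := alpha_ne_zero (i' + 1 - r)
      rw [show i + 1 - r = (i - r) + 1 by omega, alpha_succ]
      simp only [zero_mul, zero_add]
      field_simp
    · intro r hr hr'
      rw [mem_range] at hr hr'
      have : i + 1 - r = 0 := by omega
      simp [this]
  have e' : ∀ r ∈ range (i' + 1 + 1), (-1) ^ r * t ^ (r * (r + 1) / 2) *
      (1 - t ^ (i + 1 - r)) / (alpha r * alpha (i' + 1 - r)) =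
      (-1) ^ r * t ^ (r * (r + 1) / 2) / (alpha r * alpha (i' + 1 - r)) -
      t ^ (i + 1) *
        ((-1) ^ r * t ^ (r * (r - 1) / 2) / (alpha r * alpha (i' + 1 - r))) := by
    intro r hr
    have hr := mem_range.1 hr
    have h1 : r * (r + 1) / 2 = r * (r - 1) / 2 + r := by
      rw [show r * (r + 1) = r * (r - 1) + r * 2 by
        rcases r with _ | q
        · rfl
        · simp only [Nat.add_sub_cancel]; ring, Nat.add_mul_div_right _ _ two_pos]
    have h2 : t ^ (i + 1) = t ^ (i + 1 - r) * t ^ r := by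
      rw [← pow_add]
      congr 1
      omega
    rw [h1, h2, pow_add]
    ring
  have s1 := sum_alpha_eq_one (i' + 1)
  have s2 := sum_alpha_eq_zero i'
  rw [Nat.sum_antidiagonal_eq_sum_range_succ_mk] at s1 s2
  rw [e, sum_congr rfl e', sum_sub_distrib, ← mul_sum]
  simp only at s1 s2
  rw [s1, s2]
  ring

/-- A vertex at which the path turns from North-East to West. -/
theorem fug_turn (j' : ℕ) : fug 0 1 j' 1 = (1 - t ^ (j' + 1)) / (1 - t) := by
  have := one_sub_t_ne_zero
  simp [fug, alpha, sum_range_succ]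
  field_simp
  ring

end StripHoneycomb

section StripFugacity

variable {k n : ℕ} {l ν : Fin k → ℕ} {C : Finset ℕ}

/-- The fugacity of the lattice point where the diagonal `x + y = s` meets the path. -/
def diagFug {k : ℕ} (ν : Fin k → ℕ) (C : Finset ℕ) (s : ℕ) : Coef :=
  if cnt C s = 0 then 1
  else if s ∈ C then (if s + 1 ∈ C then 1 else (1 - t ^ partMult ν s) / (1 - t))
  else if s + 1 ∈ C then 1 - t else 1

theorem alpha_one : alpha 1 = 1 - t := by simp [alpha]

theorem alpha_div_self (i : ℕ) : alpha i / alpha i = 1 := div_self (alpha_ne_zero i)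

theorem fug_of_not_isVertex (H : EdgeMult) (v : Lattice) (hv : ¬ H.IsVertex v) :
    fug (H.E v) (H.NE v) (H.NW v) (H.W v) = 1 := by
  rw [EdgeMult.IsVertex, not_not] at hv
  rcases hv with ⟨h1, h2, h3, h4, h5⟩ | ⟨h1, h2, h3, h4, h5⟩ | ⟨h1, h2, h3, h4, h5⟩
  · rw [h4, fug_zero_NE, h1, alpha_div_self]
  · rw [h4, fug_zero_NE, h2, h3, alpha_div_self]
  · rw [h2, h3, fug_zero_W, add_zero, alpha_div_self]

/-- On the North-West side every fugacity is `1`. -/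
theorem StripData.fug_zero (h : StripData n l ν C) (y : ℤ) :
    fug ((stripEdges l C).W (1, y)) ((stripEdges l C).NE (0, y)) ((stripEdges l C).SE (-1, y + 1))
      ((stripEdges l C).W (0, y)) = 1 := by
  have hcum := zcum_eq l y
  have h2 := h.one_le_zcum (z := y - 1)
  have c1 := cnt_succ C y
  have hz := h.zmult_add y
  rw [stripEdges_W_nonpos le_rfl, stripEdges_W_pos one_pos, stripEdges_SE_neg (by omega),
    stripEdges_NE_zero, add_comm 1 y]
  rw [sub_add_cancel] at h2
  by_cases hE : y + 1 ∈ zcols C ∧ (cnt C (y + 1) : ℤ) = 1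
  · rw [if_pos hE]
    rw [if_pos hE.1] at c1 hz
    have hy : y ∉ zcols C := fun hy => by
      have := cnt_eq C y
      rw [if_pos hy] at this
      omega
    rw [if_neg hy] at hz
    obtain ⟨i', hi'⟩ : ∃ i', zmult l y = i' + 1 := ⟨zmult l y - 1, by omega⟩
    rw [hi', if_pos (by omega)]
    exact fug_E_one (by omega)
  · rw [if_neg hE]
    refine fug_E_zero ?_
    split_ifs at c1 ⊢ with h3 h4 <;> grind

/-- The points off the path have fugacity `1`; those on it are given by `diagFug`. -/
theorem StripData.fug_pos (h : StripData n l ν C) {x : ℤ} (hx : 0 < x) (s : ℤ) :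
    fug ((stripEdges l C).W (x + 1, s - x)) ((stripEdges l C).NE (x, s - x))
      ((stripEdges l C).SE (x - 1, s - x + 1)) ((stripEdges l C).W (x, s - x)) =
    if (cnt C s : ℤ) = x then
      (if s ∈ zcols C then (if s + 1 ∈ zcols C then 1 else (1 - t ^ zmult ν s) / (1 - t))
        else if s + 1 ∈ zcols C then 1 - t else 1)
    else 1 := by
  have c1 := cnt_succ C s
  have hz := h.zmult_add s
  rw [stripEdges_W_pos hx, stripEdges_W_pos (by omega), stripEdges_SE_nonneg (by omega),
    stripEdges_NE_pos hx, show x + 1 + (s - x) = s + 1 by ring, show x + (s - x) = s by ring,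
    show x - 1 + (s - x + 1) = s by ring]
  by_cases hc : (cnt C s : ℤ) = x
  · rw [if_pos hc]
    subst hc
    by_cases m0 : s ∈ zcols C <;> by_cases m1 : s + 1 ∈ zcols C <;>
      simp only [m0, m1, if_true, if_false, true_and, false_and, add_zero] at *
    · rw [if_pos (by omega), if_neg (by omega), fug_zero_NE, alpha_div_self]
    · rw [if_pos (by omega), if_neg (by omega), fug_turn, hz]
      simp
    · rw [if_pos (by omega), if_neg (by omega), fug_zero_NE, alpha_one]
      simp [alpha]
    · rw [fug_zero_W, add_zero, alpha_div_self]
  · have a1 : ¬ (s ∈ zcols C ∧ (cnt C s : ℤ) = x) := fun h' => hc h'.2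
    have a2 : ¬ (s + 1 ∈ zcols C ∧ (cnt C (s + 1) : ℤ) = x + 1) := by
      rintro ⟨m1, m2⟩
      rw [if_pos m1] at c1
      omega
    rw [if_neg hc, if_neg a1, if_neg a2, fug_zero_W, add_zero, alpha_div_self]

/-- The fugacities along the path telescope: each maximal run of columns ends with a factor
`(1 - t ^ m) / (1 - t)`, and each run but the first one begins with a factor `1 - t`. -/
theorem prod_diagFug (ν : Fin k → ℕ) (h0 : 0 ∉ C) (m : ℕ) :
    (∏ s ∈ range m, diagFug ν C s) * (if cnt C m = 0 ∨ m ∈ C then 1 else 1 - t) =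
      ∏ s ∈ (range m).filter (fun s => s ∈ C ∧ s + 1 ∉ C), (1 - t ^ partMult ν s) := by
  have ht := one_sub_t_ne_zero
  induction m with
  | zero => simp [cnt_eq_zero_of_nonpos h0 le_rfl]
  | succ m ih =>
    have c1 := cnt_succ C m
    have c0 := cnt_eq C m
    rw [prod_filter] at ih ⊢
    rw [prod_range_succ, prod_range_succ, ← ih, mul_assoc, mul_assoc]
    congr 1
    push_cast
    simp only [← Nat.cast_succ, natCast_mem_zcols] at c0 c1 ⊢
    rw [c1, diagFug]
    by_cases m0 : m ∈ C <;> by_cases m1 : m + 1 ∈ C <;> by_cases hc : cnt C m = 0 <;>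
      simp [m0, m1, hc] at c0 ⊢
    field_simp

theorem stripHoneycomb_fugacity (h : StripData n l ν C) (hl : Antitone l) (hν : Antitone ν)
    (hC : 0 < C.card) : (stripHoneycomb h).fugacity = pieriCoeff l ν := by
  classical
  have h0 := h.adds.zero_notMem
  set H := stripEdges l C with hH
  let f : Lattice → Coef := fun v => fug (H.E v) (H.NE v) (H.NW v) (H.W v)
  have e1 : (stripHoneycomb h).fugacity = ∏ᶠ v, f v := by
    refine finprod_congr fun v => ?_
    by_cases hv : H.IsVertex v
    · exact finprod_eq_if.trans (if_pos hv)
    · exact (finprod_eq_if.trans (if_neg hv)).trans (fug_of_not_isVertex H v hv).symm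
  -- The path meets the diagonal `x + y = s` in the point `pt s`.
  let pt : ℕ → Lattice := fun s => (cnt C s, s - cnt C s)
  have hpt : ∀ s : ℕ, f (pt s) = diagFug ν C s := by
    intro s
    rw [diagFug]
    simp only [f, pt, EdgeMult.E_mk, EdgeMult.NW_mk]
    rcases Nat.eq_zero_or_pos (cnt C s) with hc | hc
    · rw [hc, if_pos rfl]
      have := h.fug_zero s
      simpa using this
    · rw [if_neg hc.ne', h.fug_pos (by omega), if_pos rfl, zmult_natCast]
      simp only [← Nat.cast_succ, natCast_mem_zcols]
  have hsupp : Function.mulSupport f ⊆ ((range n).image pt : Finset Lattice) := by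
    intro v hv
    rw [Function.mem_mulSupport] at hv
    have hvert : H.IsVertex v := by
      by_contra hv'
      exact hv (fug_of_not_isVertex H v hv')
    obtain ⟨t1, t2, t3⟩ := h.mem_triangle v hvert
    obtain ⟨x, y⟩ := v
    simp only at t1 t2 t3
    simp only [f, EdgeMult.E_mk, EdgeMult.NW_mk] at hv
    rcases t1.eq_or_lt with rfl | hx
    · refine absurd ?_ hv
      have := h.fug_zero y
      simpa using this
    · have h1 := h.fug_pos hx (x + y)
      rw [add_sub_cancel_left] at h1
      rw [h1] at hv
      have hc : (cnt C (x + y) : ℤ) = x := by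
        by_contra hc
        rw [if_neg hc] at hv
        exact hv rfl
      rw [mem_coe, mem_image]
      refine ⟨(x + y).toNat, mem_range.2 (by omega), ?_⟩
      have h2 : ((x + y).toNat : ℤ) = x + y := Int.toNat_of_nonneg (by omega)
      simp only [pt, h2, hc, add_sub_cancel_left]
  have hinj : ∀ s ∈ range n, ∀ s' ∈ range n, pt s = pt s' → s = s' := by
    intro s _ s' _ h'
    simp only [pt, Prod.mk.injEq] at h'
    omega
  rw [e1, finprod_eq_prod_of_mulSupport_subset f hsupp, prod_image hinj,
    prod_congr rfl fun s _ => hpt s, h.adds.pieriCoeff_eq hl hν]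
  have h3 := prod_diagFug (C := C) ν h0 n
  have hn : n ∉ C := fun hn => lt_irrefl _ (h.adds.lt_of_mem h.lt_right hn)
  have hcn : cnt C n = C.card := cnt_eq_card fun c hc => by
    have := h.adds.lt_of_mem h.lt_right hc
    omega
  have hset : (range n).filter (fun s => s ∈ C ∧ s + 1 ∉ C) = C.filter fun c => c + 1 ∉ C := by
    ext c
    have := @AddsColumns.lt_of_mem k l ν C h.adds n h.lt_right c
    simp only [mem_filter, mem_range]
    tauto
  rw [if_neg (by rw [hcn]; rintro (h' | h'); exacts [hC.ne' h', hn h']), hset] at h3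
  rw [← h3]
  have := one_sub_t_ne_zero
  field_simp

end StripFugacity

/-! ### Every honeycomb with a one-row boundary comes from a horizontal strip -/

namespace Honeycomb

variable {n : ℕ} {H H' : Honeycomb}

theorem W_sub (H : Honeycomb) (x y : ℤ) :
    (H.W (x, y) : ℤ) - H.W (x + 1, y) = H.NE (x, y) - H.NE (x, y - 1) ∧
      (H.W (x, y) : ℤ) - H.W (x + 1, y) = H.SE (x, y) - H.SE (x - 1, y + 1) := by
  have h := H.balanced (x, y)
  rw [EdgeMult.Balanced, EdgeMult.E_mk, EdgeMult.SW_mk, EdgeMult.NW_mk] at h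
  exact ⟨h.1.trans h.2, h.1⟩

/-- Outside of the triangle, the lines are straight. -/
theorem straight (hV : ∀ v, H.IsVertex v → v ∈ triangle n) {x y : ℤ}
    (h : x < 0 ∨ y < 0 ∨ n ≤ x + y) :
    H.W (x, y) = H.W (x + 1, y) ∧ H.NE (x, y) = H.NE (x, y - 1) ∧
      H.SE (x, y) = H.SE (x - 1, y + 1) := by
  have hv : ¬ H.IsVertex (x, y) := fun hv => by
    obtain ⟨h1, h2, h3⟩ := hV _ hv
    simp only at h1 h2 h3
    omega
  rw [EdgeMult.IsVertex, not_not, EdgeMult.E_mk, EdgeMult.SW_mk, EdgeMult.NW_mk] at hv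
  omega

theorem W_eq_zero (hV : ∀ v, H.IsVertex v → v ∈ triangle n) {x y : ℤ}
    (h : y < 0 ∨ n ≤ x + y) : H.W (x, y) = 0 := by
  have hs : ∀ s : ℕ, H.W (x, y) = H.W (x + s, y) := by
    intro s
    induction s with
    | zero => simp
    | succ s ih =>
      rw [ih, (straight hV (by omega)).1]
      push_cast
      rw [add_assoc]
  obtain ⟨s, h0⟩ := H.noRayE (x, y)
  rw [hs s, ← h0]
  simp [dirW]

theorem NE_eq_zero (hV : ∀ v, H.IsVertex v → v ∈ triangle n) {x y : ℤ}
    (h : x < 0 ∨ y < 0) : H.NE (x, y) = 0 := by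
  have hs : ∀ s : ℕ, H.NE (x, y) = H.NE (x, y - s) := by
    intro s
    induction s with
    | zero => simp
    | succ s ih =>
      rw [ih, (straight hV (by omega)).2.1]
      push_cast
      rw [sub_sub]
  obtain ⟨s, h0⟩ := H.noRaySW (x, y)
  rw [hs s, ← h0]
  simp [dirNE]

theorem SE_eq_zero (hV : ∀ v, H.IsVertex v → v ∈ triangle n) {x y : ℤ}
    (h : x < 0) : H.SE (x, y) = 0 := by
  have hs : ∀ s : ℕ, H.SE (x, y) = H.SE (x - s, y + s) := by
    intro s
    induction s with
    | zero => simp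
    | succ s ih =>
      rw [ih, (straight hV (by omega)).2.2]
      push_cast
      rw [sub_sub, add_assoc]
  obtain ⟨s, h0⟩ := H.noRayNW (x, y)
  rw [hs s, ← h0]
  simp [dirSE]

theorem W_left (hV : ∀ v, H.IsVertex v → v ∈ triangle n) {x : ℤ} (hx : x ≤ 0) (y : ℤ) :
    H.W (x, y) = H.W (0, y) := by
  have hs : ∀ s : ℕ, H.W (-s, y) = H.W (0, y) := by
    intro s
    induction s with
    | zero => simp
    | succ s ih =>
      rw [← ih, (straight hV (by omega)).1]
      push_cast
      rw [neg_add_rev, neg_add_cancel_comm]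
  have := hs (-x).toNat
  rwa [Int.toNat_of_nonneg (by omega), neg_neg] at this

theorem NE_top (hV : ∀ v, H.IsVertex v → v ∈ triangle n) (x : ℤ) (s : ℕ) :
    H.NE (x, n - 1 - x + s) = H.NE (x, n - 1 - x) := by
  induction s with
  | zero => simp
  | succ s ih =>
    rw [← ih, (straight hV (by omega)).2.1]
    push_cast
    rw [← add_assoc, add_sub_cancel_right]

/-- A honeycomb is determined by its horizontal edges. -/
theorem eq_of_W_eq (hV : ∀ v, H.IsVertex v → v ∈ triangle n)
    (hV' : ∀ v, H'.IsVertex v → v ∈ triangle n) (h : ∀ x y, H.W (x, y) = H'.W (x, y)) :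
    H = H' := by
  have hNE : ∀ (s : ℕ) (x : ℤ), H.NE (x, (s : ℤ) - 1) = H'.NE (x, (s : ℤ) - 1) := by
    intro s x
    induction s with
    | zero => rw [NE_eq_zero hV (by omega), NE_eq_zero hV' (by omega)]
    | succ s ih =>
      push_cast
      rw [add_sub_cancel_right]
      have h1 := (H.W_sub x s).1
      have h2 := (H'.W_sub x s).1
      rw [h, h] at h1
      omega
  have hSE : ∀ (s : ℕ) (y : ℤ), H.SE ((s : ℤ) - 1, y) = H'.SE ((s : ℤ) - 1, y) := by
    intro s
    induction s with
    | zero => intro y; rw [SE_eq_zero hV (by omega), SE_eq_zero hV' (by omega)]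
    | succ s ih =>
      intro y
      push_cast
      rw [add_sub_cancel_right]
      have h1 := (H.W_sub s y).2
      have h2 := (H'.W_sub s y).2
      have h3 := ih (y + 1)
      rw [h, h] at h1
      omega
  apply Honeycomb.ext
  · funext ⟨x, y⟩
    exact h x y
  · funext ⟨x, y⟩
    rcases lt_or_ge y 0 with hy | hy
    · rw [NE_eq_zero hV (by omega), NE_eq_zero hV' (by omega)]
    · have := hNE (y + 1).toNat x
      rwa [Int.toNat_of_nonneg (by omega), add_sub_cancel_right] at this
  · funext ⟨x, y⟩
    rcases lt_or_ge x 0 with hx | hx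
    · rw [SE_eq_zero hV hx, SE_eq_zero hV' hx]
    · have := hSE (x + 1).toNat y
      rwa [Int.toNat_of_nonneg (by omega), add_sub_cancel_right] at this

/-- Summation of the balance condition upwards, from the edge that enters from the South. -/
theorem NE_eq_sum (hV : ∀ v, H.IsVertex v → v ∈ triangle n) (x : ℤ) (m : ℕ) :
    (H.NE (x, (m : ℤ) - 1) : ℤ) =
      ∑ j ∈ range m, (H.W (x, (j : ℤ)) : ℤ) - ∑ j ∈ range m, (H.W (x + 1, (j : ℤ)) : ℤ) := by
  induction m with
  | zero => simp [NE_eq_zero hV (show x < 0 ∨ (-1 : ℤ) < 0 by omega)]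
  | succ m ih =>
    rw [sum_range_succ, sum_range_succ]
    have := (H.W_sub x m).1
    push_cast
    rw [add_sub_cancel_right]
    omega

/-- Summation of the balance condition along a diagonal. -/
theorem SE_eq_sum (hV : ∀ v, H.IsVertex v → v ∈ triangle n) (s : ℤ) (m : ℕ) :
    (H.SE ((m : ℤ) - 1, s - (m - 1)) : ℤ) =
      ∑ x ∈ range m, (H.W ((x : ℤ), s - x) : ℤ) - ∑ x ∈ range m, (H.W ((x : ℤ) + 1, s - x) : ℤ) := by
  induction m with
  | zero => simp [SE_eq_zero hV (show (-1 : ℤ) < 0 by omega)]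
  | succ m ih =>
    rw [sum_range_succ, sum_range_succ]
    have := (H.W_sub m (s - m)).2
    rw [show s - (m : ℤ) + 1 = s - (m - 1) by ring] at this
    push_cast
    rw [add_sub_cancel_right]
    omega

variable {k : ℕ} {l μ ν : Fin k → ℕ}

/-- The number of horizontal lines that cross a column is determined by the North-East boundary. -/
theorem sum_W_add (hH : H.HasBoundaries n l μ ν) (m : ℕ) (hm : m ≤ n) :
    ∑ j ∈ range n, H.W (((n - m : ℕ) : ℤ), (j : ℤ)) + colLen μ n = colLen μ (n - m) := by
  induction m with
  | zero =>
    rw [sum_eq_zero, zero_add, Nat.sub_zero]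
    intro j _
    exact W_eq_zero hH.1 (by omega)
  | succ m ih =>
    have ih := ih (by omega)
    obtain ⟨x, hx⟩ : ∃ x, x = n - (m + 1) := ⟨_, rfl⟩
    have hx' : n - m = x + 1 := by omega
    rw [hx'] at ih
    rw [← hx]
    have h1 := NE_eq_sum hH.1 x n
    have h2 := NE_top hH.1 x x
    have h3 := (hH.2 x (by omega)).2.1
    have h4 := partMult_add_colLen μ x
    rw [sub_add_cancel] at h2
    rw [h2, h3] at h1
    push_cast at ih
    zify at ih h4 ⊢
    omega

theorem W_zero (hl : ∀ p, l p < n) (hH : H.HasBoundaries n l μ ν) (y : ℤ) :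
    H.W (0, y) = zmult l y := by
  rcases lt_or_ge y 0 with hy | hy
  · rw [W_eq_zero hH.1 (by omega), zmult_of_neg _ hy]
  · lift y to ℕ using hy
    rcases lt_or_ge y n with hn | hn
    · rw [(hH.2 y hn).1, zmult_natCast]
    · rw [W_eq_zero hH.1 (by omega), zmult_of_le hl (by omega)]

/-- The North-East boundary of a honeycomb lies in the box. -/
theorem colLen_eq_zero_of_hasBoundaries (hl : ∀ p, l p < n) (hH : H.HasBoundaries n l μ ν) :
    colLen μ n = 0 := by
  have h1 := sum_W_add hH n le_rfl
  have h2 : ∀ m ≤ n, ∑ j ∈ range m, partMult l j + colLen l m = k := by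
    intro m hm
    induction m with
    | zero => simp [colLen_zero]
    | succ m ih =>
      have h3 := ih (by omega)
      have h4 := partMult_add_colLen l m
      rw [sum_range_succ]
      omega
  have h3 := h2 n le_rfl
  rw [Nat.sub_self, Nat.cast_zero, colLen_zero, sum_congr rfl fun (j : ℕ) _ => W_zero hl hH (j : ℤ)] at h1
  simp only [zmult_natCast] at h1
  rw [colLen_eq_zero hl] at h3
  omega

theorem colLen_row {r c : ℕ} (hk : 1 ≤ k) (hc : 1 ≤ c) :
    colLen (row k r) c = if c ≤ r then 1 else 0 := by
  split_ifs with h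
  · rw [colLen, card_eq_one]
    refine ⟨⟨0, hk⟩, ?_⟩
    ext p
    rw [mem_filter, mem_singleton, Fin.ext_iff]
    simp only [row, mem_univ, true_and]
    split_ifs with hp <;> simp [hp] <;> omega
  · refine colLen_eq_zero fun p => ?_
    simp only [row]
    split_ifs <;> omega

/-- The path of a honeycomb whose North-East boundary is a row: its height in every column. -/
theorem exists_path {r : ℕ} (hk : 1 ≤ k) (hl : ∀ p, l p < n)
    (hH : H.HasBoundaries n l (row k r) ν) :
    ∃ p : ℕ → ℕ, (∀ x, 1 ≤ x → x ≤ r → ∀ y : ℤ, H.W ((x : ℤ), y) = if y = p x then 1 else 0) ∧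
      (∀ x, 1 ≤ x → x ≤ r → p x + x < n) ∧ (∀ x, 1 ≤ x → x + 1 ≤ r → p x ≤ p (x + 1)) ∧
      ∀ x : ℕ, r < x → ∀ y : ℤ, H.W ((x : ℤ), y) = 0 := by
  have hrow : ∀ x, 1 ≤ x → x ≤ n →
      ∑ j ∈ range n, H.W ((x : ℤ), (j : ℤ)) = if x ≤ r then 1 else 0 := by
    intro x hx hxn
    have h1 := sum_W_add hH (n - x) (by omega)
    rw [show n - (n - x) = x by omega, colLen_eq_zero_of_hasBoundaries hl hH, add_zero] at h1
    rw [h1, colLen_row hk hx]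
  have hlarge : ∀ x : ℕ, n ≤ x → ∀ y : ℤ, H.W ((x : ℤ), y) = 0 := fun x hx y =>
    W_eq_zero hH.1 (by omega)
  have hrn : r < n ∨ n = 0 := by
    by_contra h
    have h1 := colLen_eq_zero_of_hasBoundaries hl hH
    rw [colLen_row hk (by omega), if_pos (by omega)] at h1
    exact one_ne_zero h1
  have hn0 : n ≠ 0 := fun h => by
    have := hl ⟨0, hk⟩
    omega
  have hex : ∀ x, ∃ p : ℕ, 1 ≤ x → x ≤ r →
      ∀ y : ℤ, H.W ((x : ℤ), y) = if y = p then 1 else 0 := by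
    intro x
    by_cases hx : 1 ≤ x ∧ x ≤ r
    · have h1 := hrow x hx.1 (by omega)
      rw [if_pos hx.2] at h1
      obtain ⟨p, hp, hp1⟩ : ∃ p ∈ range n, H.W ((x : ℤ), (p : ℤ)) ≠ 0 :=
        exists_ne_zero_of_sum_ne_zero (by rw [h1]; exact one_ne_zero)
      refine ⟨p, fun _ _ y => ?_⟩
      have h2 := add_sum_erase (range n) (fun j : ℕ => H.W ((x : ℤ), (j : ℤ))) hp
      have h3 : ∑ j ∈ (range n).erase p, H.W ((x : ℤ), (j : ℤ)) = 0 := by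
        omega
      rw [sum_eq_zero_iff] at h3
      split_ifs with hy
      · subst hy
        have : H.W ((x : ℤ), (p : ℤ)) ≤ 1 := by
          rw [← h1]
          exact single_le_sum (f := fun j : ℕ => H.W ((x : ℤ), (j : ℤ)))
            (fun _ _ => Nat.zero_le _) hp
        omega
      · by_cases hy' : y < 0 ∨ (n : ℤ) ≤ y
        · exact W_eq_zero hH.1 (by omega)
        · obtain ⟨j, rfl⟩ := Int.eq_ofNat_of_zero_le (show 0 ≤ y by omega)
          exact h3 j (mem_erase.2 ⟨fun h => hy (by rw [h]), mem_range.2 (by omega)⟩)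
    · exact ⟨0, fun h1 h2 => absurd ⟨h1, h2⟩ hx⟩
  choose p hp using hex
  have hpn : ∀ x, 1 ≤ x → x ≤ r → p x + x < n := by
    intro x hx hxr
    by_contra h
    have h1 := hp x hx hxr (p x)
    rw [if_pos rfl, W_eq_zero hH.1 (by omega)] at h1
    exact zero_ne_one h1
  refine ⟨p, hp, hpn, fun x hx hxr => ?_, fun x hx y => ?_⟩
  · -- Otherwise the path would run South between the two columns.
    by_contra hlt
    have h1 := NE_eq_sum hH.1 x (p (x + 1) + 1)
    have e1 : ∑ j ∈ range (p (x + 1) + 1), (H.W ((x : ℤ), (j : ℤ)) : ℤ) = 0 := by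
      refine sum_eq_zero fun j hj => ?_
      have := mem_range.1 hj
      rw [hp x hx (by omega), if_neg (by omega)]
      rfl
    have e2 : (1 : ℤ) ≤ ∑ j ∈ range (p (x + 1) + 1), (H.W ((x : ℤ) + 1, (j : ℤ)) : ℤ) := by
      have h2 := hp (x + 1) (by omega) hxr (p (x + 1))
      rw [if_pos rfl] at h2
      have h3 := single_le_sum (f := fun j : ℕ => (H.W ((x : ℤ) + 1, (j : ℤ)) : ℤ))
        (s := range (p (x + 1) + 1)) (fun _ _ => Int.natCast_nonneg _) (self_mem_range_succ _)
      push_cast at h2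
      simp only [h2] at h3
      exact_mod_cast h3
    omega
  · rcases lt_or_ge x n with hxn | hxn
    · by_cases hy : y < 0 ∨ (n : ℤ) ≤ y
      · exact W_eq_zero hH.1 (by omega)
      · obtain ⟨j, rfl⟩ := Int.eq_ofNat_of_zero_le (show 0 ≤ y by omega)
        have h1 := hrow x (by omega) hxn.le
        rw [if_neg (by omega), sum_eq_zero_iff] at h1
        exact h1 j (mem_range.2 (by omega))
    · exact hlarge x hxn y

end Honeycomb

theorem cnt_natCast (C : Finset ℕ) (s : ℕ) : cnt C s = (C.filter fun c => c ≤ s).card := by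
  rw [cnt, zcols, filter_map, card_map]
  congr 1
  ext c
  simp

section Columns

variable {r : ℕ} {p : ℕ → ℕ}

/-- The columns of the strip that corresponds to a path with heights `p`. -/
def pathCols (p : ℕ → ℕ) (r : ℕ) : Finset ℕ := (Icc 1 r).image fun x => p x + x

theorem pathCols_lt (hp : ∀ x, 1 ≤ x → x + 1 ≤ r → p x ≤ p (x + 1)) {x x' : ℕ} (hx : 1 ≤ x)
    (hxx' : x < x') (hx' : x' ≤ r) : p x + x < p x' + x' := by
  induction x', hxx' using Nat.le_induction with
  | base =>
    have := hp x hx hx'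
    rw [Nat.succ_eq_add_one]
    omega
  | succ m hm ih =>
    have := ih (by omega)
    have := hp m (by omega) hx'
    omega

theorem pathCols_lt_iff (hp : ∀ x, 1 ≤ x → x + 1 ≤ r → p x ≤ p (x + 1)) {x x' : ℕ} (hx : 1 ≤ x)
    (hxr : x ≤ r) (hx' : 1 ≤ x') (hxr' : x' ≤ r) : p x + x < p x' + x' ↔ x < x' := by
  refine ⟨fun h => ?_, fun h => pathCols_lt hp hx h hxr'⟩
  by_contra hlt
  rcases (not_lt.1 hlt).eq_or_lt with rfl | h'
  · exact lt_irrefl _ h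
  · have := pathCols_lt hp hx' h' hxr
    omega

theorem card_pathCols (hp : ∀ x, 1 ≤ x → x + 1 ≤ r → p x ≤ p (x + 1)) :
    (pathCols p r).card = r := by
  rw [pathCols, card_image_of_injOn, Nat.card_Icc, Nat.add_sub_cancel]
  intro x hx x' hx' h
  have hx := mem_Icc.1 (mem_coe.1 hx)
  have hx' := mem_Icc.1 (mem_coe.1 hx')
  have h1 := pathCols_lt_iff hp hx.1 hx.2 hx'.1 hx'.2
  have h2 := pathCols_lt_iff hp hx'.1 hx'.2 hx.1 hx.2
  simp only at h
  omega

theorem cnt_pathCols (hp : ∀ x, 1 ≤ x → x + 1 ≤ r → p x ≤ p (x + 1)) {x : ℕ} (hx : 1 ≤ x)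
    (hxr : x ≤ r) : cnt (pathCols p r) ((p x + x : ℕ) : ℤ) = x := by
  have : (pathCols p r).filter (fun c => c ≤ p x + x) = pathCols p x := by
    ext c
    simp only [pathCols, mem_filter, mem_image, mem_Icc]
    constructor
    · rintro ⟨⟨x', hx', rfl⟩, hle⟩
      have := pathCols_lt_iff hp hx hxr hx'.1 hx'.2
      exact ⟨x', by omega, rfl⟩
    · rintro ⟨x', hx', rfl⟩
      have := pathCols_lt_iff hp hx hxr hx'.1 (by omega)
      exact ⟨⟨x', by omega, rfl⟩, by omega⟩
  rw [cnt_natCast, this, card_pathCols fun x' h1 h2 => hp x' h1 (by omega)]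

end Columns

namespace Honeycomb

variable {n k : ℕ} {H : Honeycomb} {l ν : Fin k → ℕ}

/-- The horizontal edges in the strips `1, …, r` lie on different diagonals, because their heights
increase weakly; these diagonals are the columns. -/
theorem exists_columns {r : ℕ} (hk : 1 ≤ k) (hl : ∀ p, l p < n)
    (hH : H.HasBoundaries n l (row k r) ν) :
    ∃ C : Finset ℕ, 0 ∉ C ∧ (∀ c ∈ C, c < n) ∧ C.card = r ∧ ∀ x : ℕ, 1 ≤ x → ∀ y : ℤ,
      H.W ((x : ℤ), y) = if (x : ℤ) + y ∈ zcols C ∧ (cnt C (x + y) : ℤ) = x then 1 else 0 := by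
  obtain ⟨p, h1, h2, h3, h4⟩ := exists_path hk hl hH
  refine ⟨pathCols p r, ?_, ?_, card_pathCols h3, ?_⟩
  · intro h0
    obtain ⟨x, hx, h⟩ := mem_image.1 h0
    have := mem_Icc.1 hx
    omega
  · intro c hc
    obtain ⟨x, hx, rfl⟩ := mem_image.1 hc
    have := mem_Icc.1 hx
    exact h2 x this.1 this.2
  · intro x hx y
    have key : ((x : ℤ) + y ∈ zcols (pathCols p r) ∧ (cnt (pathCols p r) (x + y) : ℤ) = x) ↔
        x ≤ r ∧ y = p x := by
      constructor
      · rintro ⟨m1, m2⟩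
        obtain ⟨c, hc, hcx⟩ := mem_zcols.1 m1
        obtain ⟨x', hx', rfl⟩ := mem_image.1 hc
        have hx' := mem_Icc.1 hx'
        rw [← hcx, cnt_pathCols h3 hx'.1 hx'.2] at m2
        have : x' = x := by omega
        subst this
        push_cast at hcx
        exact ⟨hx'.2, by omega⟩
      · rintro ⟨hxr, rfl⟩
        have e : (x : ℤ) + p x = ((p x + x : ℕ) : ℤ) := by push_cast; ring
        rw [e, cnt_pathCols h3 hx hxr, natCast_mem_zcols]
        exact ⟨mem_image.2 ⟨x, mem_Icc.2 ⟨hx, hxr⟩, rfl⟩, rfl⟩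
    rw [if_congr key rfl rfl]
    by_cases hxr : x ≤ r
    · rw [h1 x hx hxr]
      simp [hxr]
    · rw [h4 x (not_le.1 hxr), if_neg fun h => hxr h.1]

/-- A diagonal crosses the path in a horizontal edge exactly if it belongs to the columns. -/
theorem sum_diagonal {C : Finset ℕ} (h0 : 0 ∉ C) (hW : ∀ x : ℕ, 1 ≤ x → ∀ y : ℤ,
      H.W ((x : ℤ), y) = if (x : ℤ) + y ∈ zcols C ∧ (cnt C (x + y) : ℤ) = x then 1 else 0)
    (s : ℕ) : ∑ x ∈ range s, H.W ((x : ℤ) + 1, (s : ℤ) - (x + 1)) = chi C s := by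
  have e : ∀ x ∈ range s, H.W ((x : ℤ) + 1, (s : ℤ) - (x + 1)) =
      if s ∈ C ∧ cnt C s = x + 1 then 1 else 0 := by
    intro x _
    have := hW (x + 1) (by omega) ((s : ℤ) - (x + 1))
    push_cast at this
    rw [add_sub_cancel] at this
    rw [this]
    refine if_congr (and_congr natCast_mem_zcols ?_) rfl rfl
    omega
  rw [sum_congr rfl e, chi]
  split_ifs with hs
  · have h1 : 1 ≤ cnt C s := by
      rw [cnt_natCast]
      exact card_pos.2 ⟨s, mem_filter.2 ⟨hs, le_rfl⟩⟩
    have h2 := cnt_le h0 (Int.natCast_nonneg s)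
    rw [sum_eq_single (cnt C s - 1)]
    · rw [if_pos ⟨hs, by omega⟩]
    · intro x _ hx
      rw [if_neg]
      rintro ⟨-, h⟩
      omega
    · intro h
      rw [mem_range] at h
      omega
  · exact sum_eq_zero fun x _ => if_neg fun h => hs h.1

/-- A honeycomb whose North-East boundary is a row is the honeycomb of a horizontal strip. -/
theorem exists_eq_stripHoneycomb {r : ℕ} (hk : 1 ≤ k) (hl : ∀ p, l p < n) (hν : ∀ p, ν p < n)
    (hH : H.HasBoundaries n l (row k r) ν) :
    ∃ (C : Finset ℕ) (h : StripData n l ν C), C.card = r ∧ H = stripHoneycomb h := by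
  obtain ⟨C, h0, hCn, hcard, hW⟩ := exists_columns hk hl hH
  have hchi : ∀ s, n ≤ s → chi C s = 0 := fun s hs => if_neg fun h => by
    have := hCn s h
    omega
  have hadd : AddsColumns l ν C := by
    refine AddsColumns.of_partMult (fun s => ?_) h0
    rcases lt_or_ge s n with hs | hs
    · have h1 := SE_eq_sum hH.1 s (s + 1)
      have h2 := sum_diagonal h0 hW s
      have h3 := sum_diagonal h0 hW (s + 1)
      rw [sum_range_succ'] at h1
      push_cast at h1 h3
      simp only [add_sub_cancel_right, sub_self, add_sub_add_right_eq_sub, sub_zero] at h1 h3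
      rw [(hH.2 s hs).2.2, (hH.2 s hs).1] at h1
      zify at h2 h3 ⊢
      omega
    · rw [partMult_eq_zero fun p => (hν p).trans_le hs, partMult_eq_zero fun p =>
        (hl p).trans_le hs, hchi s hs, hchi (s + 1) (by omega)]
  refine ⟨C, ⟨hl, hν, hadd⟩, hcard, eq_of_W_eq hH.1 (StripData.mem_triangle ⟨hl, hν, hadd⟩) ?_⟩
  intro x y
  change H.W (x, y) = (stripEdges l C).W (x, y)
  rcases le_or_gt x 0 with hx | hx
  · rw [W_left hH.1 hx, W_zero hl hH, stripEdges_W_nonpos hx]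
  · rw [stripEdges_W_pos hx]
    lift x to ℕ using hx.le
    exact hW x (by omega) y

end Honeycomb

/-! ### The honeycomb product with a row -/

section Pieri

variable {k n r : ℕ} {l ν : Fin k → ℕ}

theorem isHorizontalStrip_of_hasBoundaries (hk : 1 ≤ k) (hl : Antitone l) (hν : Antitone ν)
    (hln : ∀ p, l p < n) (hνn : ∀ p, ν p < n) {H : Honeycomb}
    (hH : H.HasBoundaries n l (row k r) ν) : IsHorizontalStrip l ν r := by
  obtain ⟨C, h, rfl, -⟩ := Honeycomb.exists_eq_stripHoneycomb hk hln hνn hH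
  exact h.adds.isHorizontalStrip hl hν

theorem existsUnique_honeycomb (hk : 1 ≤ k) (hr : 0 < r) (hl : Antitone l) (hν : Antitone ν)
    (hln : ∀ p, l p < n) (hνn : ∀ p, ν p < n) (hs : IsHorizontalStrip l ν r) :
    ∃ H₀ : Honeycomb, (∀ H : Honeycomb, H.HasBoundaries n l (row k r) ν ↔ H = H₀) ∧
      H₀.fugacity = pieriCoeff l ν := by
  obtain ⟨C, hC, rfl⟩ := hs.exists_addsColumns hl hν
  have h : StripData n l ν C := ⟨hln, hνn, hC⟩
  refine ⟨stripHoneycomb h, fun H => ⟨fun hH => ?_, ?_⟩, stripHoneycomb_fugacity h hl hν hr⟩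
  · obtain ⟨C', h', -, rfl⟩ := Honeycomb.exists_eq_stripHoneycomb hk hln hνn hH
    obtain rfl := hC.ext_columns h'.adds
    rfl
  · rintro rfl
    exact stripHoneycomb_hasBoundaries h hk hr

open Classical in
theorem honeycombCoeff_row (hk : 1 ≤ k) (hr : 0 < r) (l : BoxPartition k n)
    (ν : BoxPartition k n) :
    honeycombCoeff n l.1 (row k r) ν.1 = if ν ∈ strips n l.1 r then pieriCoeff l.1 ν.1 else 0 := by
  rw [honeycombCoeff]
  split_ifs with h
  · obtain ⟨H₀, h1, h2⟩ := existsUnique_honeycomb hk hr l.2.1 ν.2.1 l.2.2 ν.2.2 (mem_strips.1 h)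
    simp only [h1]
    rw [← h2, finsum_eq_single _ H₀ fun H hH => by simp [hH]]
    simp
  · have : ∀ H : Honeycomb, ¬ H.HasBoundaries n l.1 (row k r) ν.1 := fun H hH =>
      h (mem_strips.2 (isHorizontalStrip_of_hasBoundaries hk l.2.1 ν.2.1 l.2.2 ν.2.2 hH))
    simp [this]

theorem antitone_row (k r : ℕ) : Antitone (row k r) := by
  intro i j hij
  simp only [row]
  have : (i : ℕ) ≤ j := hij
  split_ifs <;> omega

theorem strips_eq_empty (hr : 0 < r) (hrn : n ≤ r) (l : BoxPartition k n) : strips n l.1 r = ∅ := by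
  rw [eq_empty_iff_forall_notMem]
  intro ν hν
  obtain ⟨C, hC, hcard⟩ := (mem_strips.1 hν).exists_addsColumns l.2.1 ν.2.1
  have hsub : C ⊆ Ico 1 n := fun c hc => mem_Ico.2
    ⟨Nat.one_le_iff_ne_zero.2 fun h => hC.zero_notMem (h ▸ hc), hC.lt_of_mem ν.2.2 hc⟩
  have := card_le_card hsub
  rw [Nat.card_Ico] at this
  omega

/-- The honeycomb product with a row. -/
theorem honeycombMul_row (hk : 1 ≤ k) (hr : 0 < r)
    (b : Module.Basis (BoxPartition k n) Coef (TruncSym k n))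
    (hb : ∀ l, b l = hallLittlewoodTrunc n l.1) (l : BoxPartition k n) :
    honeycombMul b (hallLittlewoodTrunc n l.1) (hallLittlewoodTrunc n (row k r)) =
      ∑ ν ∈ strips n l.1 r, pieriCoeff l.1 ν.1 • hallLittlewoodTrunc n ν.1 := by
  rcases lt_or_ge r n with hrn | hrn
  · have hrow : ∀ i, row k r i < n := fun i => by
      simp only [row]
      split_ifs <;> omega
    let ρ : BoxPartition k n := ⟨row k r, antitone_row k r, hrow⟩
    have hρ : hallLittlewoodTrunc n (row k r) = b ρ := (hb ρ).symm
    have h : honeycombMul b (b l) (b ρ) = ∑ ν, honeycombCoeff n l.1 (row k r) ν.1 • b ν := by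
      rw [honeycombMul, Module.Basis.constr_basis]
      exact Module.Basis.constr_basis _ _ _ _
    rw [← hb l, hρ, h]
    simp only [honeycombCoeff_row hk hr, ite_smul, zero_smul, hb]
    rw [← sum_filter]
    refine sum_congr ?_ fun _ _ => rfl
    ext ν
    simp
  · rw [hallLittlewoodTrunc_eq_zero (antitone_row k r), map_zero, strips_eq_empty hr hrn, sum_empty]
    intro h
    have := h ⟨0, hk⟩
    simp [row] at this
    omega

end Pieri

end HallHoneycomb

end

theorem mainTheorem3 (k n : ℕ) (hk : 1 ≤ k) (hn : 1 ≤ n) :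
    ∃ b : Module.Basis (HallHoneycomb.BoxPartition k n) HallHoneycomb.Coef
        (HallHoneycomb.TruncSym k n),
      (∀ l : HallHoneycomb.BoxPartition k n,
        b l = HallHoneycomb.hallLittlewoodTrunc n l.1) ∧
      ∀ (l : HallHoneycomb.BoxPartition k n) (r : ℕ), 0 < r →
        HallHoneycomb.honeycombMul b (HallHoneycomb.hallLittlewoodTrunc n l.1)
            (HallHoneycomb.hallLittlewoodTrunc n (HallHoneycomb.row k r)) =
          HallHoneycomb.hallLittlewoodTrunc n l.1 *
            HallHoneycomb.hallLittlewoodTrunc n (HallHoneycomb.row k r) ∧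
        HallHoneycomb.hallLittlewoodTrunc n l.1 *
            HallHoneycomb.hallLittlewoodTrunc n (HallHoneycomb.row k r) =
          ∑ ν ∈ HallHoneycomb.strips n l.1 r,
            HallHoneycomb.pieriCoeff l.1 ν.1 • HallHoneycomb.hallLittlewoodTrunc n ν.1 ∧
        ∀ ν : HallHoneycomb.BoxPartition k n,
          ((∃ H : HallHoneycomb.Honeycomb,
              H.HasBoundaries n l.1 (HallHoneycomb.row k r) ν.1) →
            HallHoneycomb.IsHorizontalStrip l.1 ν.1 r) ∧
          (HallHoneycomb.IsHorizontalStrip l.1 ν.1 r →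
            (∃! H : HallHoneycomb.Honeycomb,
              H.HasBoundaries n l.1 (HallHoneycomb.row k r) ν.1) ∧
            ∀ H : HallHoneycomb.Honeycomb,
              H.HasBoundaries n l.1 (HallHoneycomb.row k r) ν.1 →
                H.fugacity = HallHoneycomb.pieriCoeff l.1 ν.1) := by
  obtain ⟨b, hb⟩ := HallHoneycomb.exists_basis hk n
  refine ⟨b, hb, fun l r hr => ⟨?_, HallHoneycomb.hallLittlewoodTrunc_mul_row hk hr l,
    fun ν => ⟨?_, fun hs => ?_⟩⟩⟩
  · rw [HallHoneycomb.honeycombMul_row hk hr b hb l,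
      HallHoneycomb.hallLittlewoodTrunc_mul_row hk hr l]
  · rintro ⟨H, hH⟩
    exact HallHoneycomb.isHorizontalStrip_of_hasBoundaries hk l.2.1 ν.2.1 l.2.2 ν.2.2 hH
  · obtain ⟨H₀, h1, h2⟩ := HallHoneycomb.existsUnique_honeycomb hk hr l.2.1 ν.2.1 l.2.2 ν.2.2 hs
    refine ⟨⟨H₀, (h1 H₀).2 rfl, fun H hH => (h1 H).1 hH⟩, fun H hH => ?_⟩
    rw [(h1 H).1 hH, h2]
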